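/- Work over $\mathbb{C}$. On $\mathbb{P}^n$ let $\mathcal{Q}$ be the tautological quotient bundle, the cokernel of the tautological inclusion $\mathcal{O}(-1)\to\mathcal{O}^{\oplus(n+1)}$; on products of projective spaces write $\mathcal{O}(a,b,\dots)$ for the external tensor products of line bundles, write $F(a,b,\dots)=F\otimes\mathcal{O}(a,b,\dots)$, and omit pullbacks from the factors. For a vector bundle $E$ let $\mathbb{P}(E)=\mathrm{Proj}(\mathrm{Sym}\,E^\vee)$ be the bundle of lines in the fibres of $E$, with tautological line subbundle $\mathcal{O}_{\mathbb{P}(E)}(-1)$. **Lemma 4.2.** (i) The twisted Euler sequence and the (dual) sequence of principal parts on $\mathbb{P}^2$ and the Euler sequence on $\mathbb{P}^1$, $$0\to\mathcal{O}(-2)\to\mathcal{O}(-1)^{\oplus 3}\to\mathcal{Q}(-1)\to 0,\qquad 0\to\mathcal{O}(-1)^{\oplus 3}\to\mathcal{O}^{\oplus 6}\to\mathrm{Sym}^2\mathcal{Q}\to 0,\qquad 0\to\mathcal{O}(-1)\to\mathcal{O}^{\oplus 2}\to\mathcal{O}(1)\to 0,$$ are exact. Here $\mathcal{O}^{\oplus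 6}=\mathrm{Sym}^2(\mathcal{O}^{\oplus 3})$ and the maps of the second sequence are $t\otimes v\mapsto t\cdot v$ and the projection induced by $\mathcal{O}^{\oplus3}\to\mathcal{Q}$. They can be completed to commutative diagrams with exact rows and columns, on $\mathbb{P}^2$ $$\begin{array}{ccccc} \mathcal{O}(-2)&\to&\mathcal{O}(-1)^{\oplus 3}&\to&\mathcal{Q}(-1)\\ \|&&\downarrow&&\downarrow\\ \mathcal{O}(-2)&\to&\mathcal{O}^{\oplus 6}&\to&\Lambda\\ &&\downarrow&&\downarrow\\ &&\mathrm{Sym}^2\mathcal{Q}&=&\mathrm{Sym}^2\mathcal{Q} \end{array}$$ and on $\mathbb{P}^1\times\mathbb{P}^2$ $$\begin{array}{ccccc} \mathcal{O}(-1,-2)&\to&\mathcal{O}(-1,0)^{\oplus 6}&\to&\Lambda(-1,0)\\ \|&&\downarrow&&\downarrow\\ \mathcal{O}(-1,-2)&\to&\mathcal{O}^{\oplus 12}&\to&K\\ &&\downarrow&&\downarrow\\ &&\mathcal{O}(1,0)^{\oplus 6}&=&\mathcal{O}(1,0)^{\oplus 6} \end{array}$$ (all rows and columns extended by zeros; the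 first row of the second diagram is the pullback of the second row of the first diagram, twisted by $\mathcal{O}(-1,0)$, and its middle column is the direct sum of six copies of the Euler sequence of $\mathbb{P}^1$). The completion $(\Lambda,K)$, with all its maps, is unique up to a unique isomorphism. (ii) $\Lambda$ is a vector bundle of rank $5$ and $K$ is an $(\mathrm{SL}_2\times\mathrm{SL}_3)$-homogeneous vector bundle of rank $11$. It is the iterated extension of $\mathcal{O}(1,0)^{\oplus 6}$, $\mathrm{Sym}^2\mathcal{Q}_{\mathbb{P}^2}(-1,0)$ and $\mathcal{Q}_{\mathbb{P}^2}(-1,-1)$ given by the exact sequences $$0\to\mathcal{Q}_{\mathbb{P}^2}(-1,-1)\to\Lambda(-1,0)\to\mathrm{Sym}^2\mathcal{Q}_{\mathbb{P}^2}(-1,0)\to 0,\qquad 0\to\Lambda(-1,0)\to K\to\mathcal{O}(1,0)^{\oplus 6}\to 0 .$$ (iii) The space $H^0(\mathbb{P}^1\times\mathbb{P}^2\times\mathbb{P}^{12},K(0,0,1))$ is finite dimensional, and for a general section $s$ in it (every $s$ in some nonempty Zariski open subset) the zero locus of $s$, as a scheme over $\mathbb{P}^1\times\mathbb{P}^2$,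 is isomorphic to the projective bundle $\mathbb{P}(\mathcal{O}(-1,-2)\oplus\mathcal{O})$, in such a way that the restriction of $\mathcal{O}(0,0,-1)$ to it is the tautological line subbundle $\mathcal{O}_{\mathbb{P}(\mathcal{O}(-1,-2)\oplus\mathcal{O})}(-1)$. -/

import Mathlib

open AlgebraicGeometry CategoryTheory Limits TensorProduct

attribute [local instance] MvPolynomial.gradedAlgebra

noncomputable section

namespace Fano

/-! ## Modules on a scheme through affine points

A quasi-coherent module `E` on a scheme `X` is the same thing as the family of modules
`E(x) = Γ(Spec R, x^* E)`, for all affine points `x : Spec R ⟶ X`, together with the base change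
maps `E(x) → E(x ∘ Spec f)` for `f : R ⟶ S`, which identify `E(x ∘ Spec f)` with
`S ⊗_R E(x)`. `OModule` records the family and the maps, the last condition is part of `IsVectorBundle`. -/

/-- A module over the structure sheaf of `X`, given on affine points. -/
structure OModule (X : Scheme.{0}) where
  /-- the `R`-module of sections of the pull back along `x : Spec R ⟶ X` -/
  obj : ∀ {R : CommRingCat.{0}}, (Spec R ⟶ X) → ModuleCat.{0} R
  /-- the base change map along `Spec S ⟶ Spec R` -/
  map : ∀ {R S : CommRingCat.{0}} (f : R ⟶ S) (x : Spec R ⟶ X) (y : Spec S ⟶ X),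
    Spec.map f ≫ x = y → (obj x →ₛₗ[f.hom] obj y)
  map_id : ∀ {R : CommRingCat.{0}} (x : Spec R ⟶ X) (h : Spec.map (𝟙 R) ≫ x = x) (m : obj x),
    map (𝟙 R) x x h m = m
  map_comp : ∀ {R S T : CommRingCat.{0}} (f : R ⟶ S) (g : S ⟶ T) (x : Spec R ⟶ X)
    (y : Spec S ⟶ X) (z : Spec T ⟶ X) (hxy : Spec.map f ≫ x = y) (hyz : Spec.map g ≫ y = z)
    (hxz : Spec.map (f ≫ g) ≫ x = z) (m : obj x),
    map (f ≫ g) x z hxz m = map g y z hyz (map f x y hxy m)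

namespace OModule

variable {X Y : Scheme.{0}}

/-- Homomorphisms: `R`-linear maps on all affine points, compatible with base change. -/
@[ext]
structure Hom (E F : OModule X) where
  app : ∀ {R : CommRingCat.{0}} (x : Spec R ⟶ X), E.obj x →ₗ[R] F.obj x
  naturality : ∀ {R S : CommRingCat.{0}} (f : R ⟶ S) (x : Spec R ⟶ X) (y : Spec S ⟶ X)
    (h : Spec.map f ≫ x = y) (m : E.obj x), F.map f x y h (app x m) = app y (E.map f x y h m)

instance : Category (OModule X) where
  Hom := Hom
  id E := { app := fun _ => LinearMap.id, naturality := fun _ _ _ _ _ => rfl }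
  comp φ ψ :=
    { app := fun x => ψ.app x ∘ₗ φ.app x
      naturality := fun f x y h m => by
        simp only [LinearMap.comp_apply, ψ.naturality, φ.naturality] }

/-- The pull back of a module along a morphism of schemes. -/
def pullback (g : Y ⟶ X) (E : OModule X) : OModule Y where
  obj y := E.obj (y ≫ g)
  map f x y h := E.map f (x ≫ g) (y ≫ g) (by rw [← h, Category.assoc])
  map_id x _ m := E.map_id (x ≫ g) _ m
  map_comp f f' x y z _ _ _ m := E.map_comp f f' (x ≫ g) (y ≫ g) (z ≫ g) _ _ _ m

/-- The pull back of a homomorphism. -/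
def pullbackMap (g : Y ⟶ X) {E F : OModule X} (φ : E ⟶ F) : E.pullback g ⟶ F.pullback g where
  app y := φ.app (y ≫ g)
  naturality f x y _ m := φ.naturality f (x ≫ g) (y ≫ g) _ m

/-- The trivial module `𝒪^{⊕ι}`. -/
def free (X : Scheme.{0}) (ι : Type) : OModule X where
  obj {R} _ := ModuleCat.of R (ι → R)
  map f _ _ _ :=
    { toFun := fun v i => f.hom (v i)
      map_add' := fun v w => funext fun i => map_add f.hom (v i) (w i)
      map_smul' := fun r v => funext fun i => map_mul f.hom r (v i) }
  map_id _ _ _ := rfl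
  map_comp _ _ _ _ _ _ _ _ _ := rfl

/-- The tensor product `E ⊗ F`. -/
def tensor (E F : OModule X) : OModule X where
  obj {R} x := ModuleCat.of R (E.obj x ⊗[R] F.obj x)
  map f x y h := TensorProduct.map (E.map f x y h) (F.map f x y h)
  map_id x h m := by
    induction m using TensorProduct.induction_on with
    | zero => exact map_zero _
    | tmul a b => exact congrArg₂ (· ⊗ₜ ·) (E.map_id x h a) (F.map_id x h b)
    | add a b ha hb => exact (map_add _ a b).trans (congrArg₂ _ ha hb)
  map_comp f g x y z hxy hyz hxz m := by
    induction m using TensorProduct.induction_on with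
    | zero => erw [map_zero]
    | tmul a b =>
      exact congrArg₂ (· ⊗ₜ ·) (E.map_comp f g x y z hxy hyz hxz a)
        (F.map_comp f g x y z hxy hyz hxz b)
    | add a b ha hb => erw [map_add, map_add, map_add, ha, hb]

/-- The tensor product of two homomorphisms. -/
def tensorMap {E E' F F' : OModule X} (φ : E ⟶ E') (ψ : F ⟶ F') : E.tensor F ⟶ E'.tensor F' where
  app x := TensorProduct.map (φ.app x) (ψ.app x)
  naturality f x y h m := by
    induction m using TensorProduct.induction_on with
    | zero => erw [map_zero]
    | tmul a b =>
      exact congrArg₂ (· ⊗ₜ ·) (φ.naturality f x y h a) (ψ.naturality f x y h b)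
    | add a b ha hb => erw [map_add, map_add, map_add, map_add, ha, hb]

/-- The external tensor product `E ⊠ F` on `X ×_S Y`. -/
def box {S : Scheme.{0}} (p : X ⟶ S) (q : Y ⟶ S) (E : OModule X) (F : OModule Y) :
    OModule (Limits.pullback p q) :=
  (E.pullback (pullback.fst p q)).tensor (F.pullback (pullback.snd p q))

/-- The external tensor product of two homomorphisms. -/
def boxMap {S : Scheme.{0}} (p : X ⟶ S) (q : Y ⟶ S) {E E' : OModule X} {F F' : OModule Y}
    (φ : E ⟶ E') (ψ : F ⟶ F') : box p q E F ⟶ box p q E' F' :=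
  tensorMap (pullbackMap _ φ) (pullbackMap _ ψ)

/-- The direct sum `E ⊕ F`. -/
def sum (E F : OModule X) : OModule X where
  obj {R} x := ModuleCat.of R (E.obj x × F.obj x)
  map f x y h :=
    { toFun := fun m => (E.map f x y h m.1, F.map f x y h m.2)
      map_add' := fun a b => Prod.ext (map_add _ a.1 b.1) (map_add _ a.2 b.2)
      map_smul' := fun r a =>
        Prod.ext ((E.map f x y h).map_smulₛₗ r a.1) ((F.map f x y h).map_smulₛₗ r a.2) }
  map_id x h m := Prod.ext (E.map_id x h m.1) (F.map_id x h m.2)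
  map_comp f g x y z hxy hyz hxz m :=
    Prod.ext (E.map_comp f g x y z hxy hyz hxz m.1) (F.map_comp f g x y z hxy hyz hxz m.2)

/-- The cokernel of a homomorphism. -/
def coker {E F : OModule X} (φ : E ⟶ F) : OModule X where
  obj {R} x := ModuleCat.of R (F.obj x ⧸ LinearMap.range (φ.app x))
  map f x y h := Submodule.mapQ _ _ (F.map f x y h) (by
    rintro _ ⟨m, rfl⟩
    exact ⟨E.map f x y h m, (φ.naturality f x y h m).symm⟩)
  map_id x h m := by
    obtain ⟨m, rfl⟩ := Submodule.Quotient.mk_surjective _ m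
    exact congrArg Submodule.Quotient.mk (F.map_id x h m)
  map_comp f g x y z hxy hyz hxz m := by
    obtain ⟨m, rfl⟩ := Submodule.Quotient.mk_surjective _ m
    exact congrArg Submodule.Quotient.mk (F.map_comp f g x y z hxy hyz hxz m)

/-- The projection onto the cokernel. -/
def cokerπ {E F : OModule X} (φ : E ⟶ F) : F ⟶ coker φ where
  app x := (LinearMap.range (φ.app x)).mkQ
  naturality _ _ _ _ _ := rfl

/-- The relations `a ⊗ b - b ⊗ a` that define the symmetric square of a module. -/
def sym2Rel (R M : Type) [CommRing R] [AddCommGroup M] [Module R M] : Submodule R (M ⊗[R] M) :=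
  Submodule.span R (Set.range fun p : M × M => p.1 ⊗ₜ[R] p.2 - p.2 ⊗ₜ[R] p.1)

lemma sym2Rel_le {R S M N : Type} [CommRing R] [CommRing S] [AddCommGroup M] [Module R M]
    [AddCommGroup N] [Module S N] {f : R →+* S} (φ : M →ₛₗ[f] N) :
    sym2Rel R M ≤ (sym2Rel S N).comap (TensorProduct.map φ φ) := by
  refine Submodule.span_le.2 ?_
  rintro _ ⟨⟨a, b⟩, rfl⟩
  refine Submodule.subset_span ⟨(φ a, φ b), ?_⟩
  simp

/-- The symmetric square `Sym² E`. -/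
def sym2 (E : OModule X) : OModule X where
  obj {R} x := ModuleCat.of R ((E.obj x ⊗[R] E.obj x) ⧸ sym2Rel R (E.obj x))
  map f x y h := Submodule.mapQ _ _ (TensorProduct.map (E.map f x y h) (E.map f x y h))
    (sym2Rel_le (E.map f x y h))
  map_id x h m := by
    obtain ⟨m, rfl⟩ := Submodule.Quotient.mk_surjective _ m
    exact congrArg Submodule.Quotient.mk ((E.tensor E).map_id x h m)
  map_comp f g x y z hxy hyz hxz m := by
    obtain ⟨m, rfl⟩ := Submodule.Quotient.mk_surjective _ m
    exact congrArg Submodule.Quotient.mk ((E.tensor E).map_comp f g x y z hxy hyz hxz m)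

/-- The multiplication `E ⊗ E → Sym² E`. -/
def sym2Mul (E : OModule X) : E.tensor E ⟶ E.sym2 where
  app {R} x := (sym2Rel R (E.obj x)).mkQ
  naturality _ _ _ _ _ := rfl

/-- The map `Sym² E → Sym² F` induced by `E → F`. -/
def sym2Map {E F : OModule X} (φ : E ⟶ F) : E.sym2 ⟶ F.sym2 where
  app x := Submodule.mapQ _ _ (TensorProduct.map (φ.app x) (φ.app x)) (sym2Rel_le (φ.app x))
  naturality f x y h m := by
    obtain ⟨m, rfl⟩ := Submodule.Quotient.mk_surjective _ m
    exact congrArg Submodule.Quotient.mk ((tensorMap φ φ).naturality f x y h m)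

/-- A semilinear map `φ : M → N` over `f : R →+* S` is a base change, that is, identifies `N` with
`S ⊗_R M`: it is universal among the semilinear maps from `M` to `S`-modules. -/
def IsBaseChangeMap {R S M N : Type} [CommRing R] [CommRing S] [AddCommGroup M] [Module R M]
    [AddCommGroup N] [Module S N] (f : R →+* S) (φ : M →ₛₗ[f] N) : Prop :=
  ∀ (T : Type) [AddCommGroup T] [Module S T] (ψ : M →ₛₗ[f] T), ∃! g : N →ₗ[S] T, g ∘ₛₗ φ = ψ

/-- `E` is (the quasi-coherent module of sections of) a vector bundle of rank `r`. -/
structure IsVectorBundle (r : ℕ) (E : OModule X) : Prop where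
  baseChange : ∀ {R S : CommRingCat.{0}} (f : R ⟶ S) (x : Spec R ⟶ X) (y : Spec S ⟶ X)
    (h : Spec.map f ≫ x = y), IsBaseChangeMap f.hom (E.map f x y h)
  finite : ∀ {R : CommRingCat.{0}} (x : Spec R ⟶ X), Module.Finite R (E.obj x)
  projective : ∀ {R : CommRingCat.{0}} (x : Spec R ⟶ X), Module.Projective R (E.obj x)
  rank : ∀ {R : CommRingCat.{0}} (x : Spec R ⟶ X) (𝔭 : PrimeSpectrum R),
    Module.rankAtStalk (E.obj x) 𝔭 = r

/-- `0 → E → F → G → 0` is exact on every affine point. For vector bundles this is exactness of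
the sequence of sheaves of sections, since such sequences are locally split. -/
def IsShortExact {E F G : OModule X} (φ : E ⟶ F) (ψ : F ⟶ G) : Prop :=
  ∀ {R : CommRingCat.{0}} (x : Spec R ⟶ X), Function.Injective (φ.app x) ∧
    Function.Exact (φ.app x) (ψ.app x) ∧ Function.Surjective (ψ.app x)

/-! ### Global sections -/

/-- The group of families of elements of the `E(x)` that are compatible with base change. -/
def sections (E : OModule X) :
    AddSubgroup (∀ (R : CommRingCat.{0}) (x : Spec R ⟶ X), E.obj x) where
  carrier := {s | ∀ (R S : CommRingCat.{0}) (f : R ⟶ S) (x : Spec R ⟶ X) (y : Spec S ⟶ X)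
    (h : Spec.map f ≫ x = y), E.map f x y h (s R x) = s S y}
  zero_mem' _ _ _ _ _ _ := map_zero _
  add_mem' {s t} hs ht R S f x y h :=
    (map_add _ (s R x) (t R x)).trans (congrArg₂ _ (hs R S f x y h) (ht R S f x y h))
  neg_mem' {s} hs R S f x y h :=
    (map_neg _ (s R x)).trans (congrArg _ (hs R S f x y h))

/-- The space `H⁰(X, E)` of global sections, for a scheme `q : X ⟶ Spec ℂ` over `ℂ`. -/
def H0 (_q : X ⟶ Spec (.of ℂ)) (E : OModule X) : Type 1 := E.sections

instance (q : X ⟶ Spec (.of ℂ)) (E : OModule X) : AddCommGroup (E.H0 q) :=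
  inferInstanceAs (AddCommGroup E.sections)

/-- The `ℂ`-algebra structure of `R` that belongs to a point `Spec R ⟶ X`. -/
def scalar (q : X ⟶ Spec (.of ℂ)) {R : CommRingCat.{0}} (x : Spec R ⟶ X) : ℂ →+* R :=
  (Spec.preimage (x ≫ q)).hom

lemma scalar_map (q : X ⟶ Spec (.of ℂ)) {R S : CommRingCat.{0}} (f : R ⟶ S) (x : Spec R ⟶ X)
    (y : Spec S ⟶ X) (h : Spec.map f ≫ x = y) (c : ℂ) :
    f.hom (scalar q x c) = scalar q y c := by
  subst h
  have : Spec.preimage (x ≫ q) ≫ f = Spec.preimage ((Spec.map f ≫ x) ≫ q) :=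
    Spec.map_injective (by simp)
  exact congrArg (fun g => g.hom c) this

instance (q : X ⟶ Spec (.of ℂ)) (E : OModule X) : Module ℂ (E.H0 q) where
  smul c s := ⟨fun R x => scalar q x c • s.1 R x, fun R S f x y h => by
    rw [LinearMap.map_smulₛₗ, s.2 R S f x y h, scalar_map q f x y h]⟩
  one_smul s := Subtype.ext (funext fun R => funext fun x =>
    (congrArg (· • s.1 R x) (map_one (scalar q x))).trans (one_smul _ _))
  mul_smul a b s := Subtype.ext (funext fun R => funext fun x =>
    (congrArg (· • s.1 R x) (map_mul (scalar q x) a b)).trans (mul_smul _ _ _))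
  smul_zero _ := Subtype.ext (funext fun _ => funext fun _ => smul_zero _)
  smul_add _ _ _ := Subtype.ext (funext fun _ => funext fun _ => smul_add _ _ _)
  add_smul a b s := Subtype.ext (funext fun R => funext fun x =>
    (congrArg (· • s.1 R x) (map_add (scalar q x) a b)).trans (add_smul _ _ _))
  zero_smul s := Subtype.ext (funext fun R => funext fun x =>
    (congrArg (· • s.1 R x) (map_zero (scalar q x))).trans (zero_smul _ _))

/-- `i : Z ⟶ X` is the zero locus of the section `s`: the closed subscheme through which an
affine point `x` factors if and only if `x^* s = 0`. -/
def IsZeroLocus {q : X ⟶ Spec (.of ℂ)} {E : OModule X} (s : E.H0 q) {Z : Scheme.{0}}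
    (i : Z ⟶ X) : Prop :=
  IsClosedImmersion i ∧
    ∀ {R : CommRingCat.{0}} (x : Spec R ⟶ X), (∃ y : Spec R ⟶ Z, y ≫ i = x) ↔ s.1 R x = 0

/-! ### Projective bundles -/

/-- `N ⊆ M` is a line subbundle: of constant rank one, with projective quotient. (`M` will be
finitely generated projective, so that `N` is a direct summand.) -/
def IsLineSubbundle {R M : Type} [CommRing R] [AddCommGroup M] [Module R M]
    (N : Submodule R M) : Prop :=
  Module.Projective R (M ⧸ N) ∧ ∀ 𝔭 : PrimeSpectrum R, Module.rankAtStalk N 𝔭 = 1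

/-- `π : P ⟶ X`, with `τ : T → π^* E`, is the projective bundle `ℙ_X(E) = Proj (Sym E^∨)` of lines
in the vector bundle `E`, with its tautological line subbundle `T = 𝒪_{ℙ(E)}(-1) ⊆ π^* E`: lifting
an affine point `x` of `X` to `P` is the same as choosing a line subbundle of `x^* E`. -/
structure IsProjectiveBundle (E : OModule X) {P : Scheme.{0}} (π : P ⟶ X) (T : OModule P)
    (τ : T ⟶ E.pullback π) : Prop where
  injective : ∀ {R : CommRingCat.{0}} (y : Spec R ⟶ P), Function.Injective (τ.app y)
  line : ∀ {R : CommRingCat.{0}} (y : Spec R ⟶ P), IsLineSubbundle (LinearMap.range (τ.app y))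
  existsUnique_lift : ∀ {R : CommRingCat.{0}} (x : Spec R ⟶ X) (N : Submodule R (E.obj x)),
    IsLineSubbundle N → ∃! y : Spec R ⟶ P, ∃ h : y ≫ π = x,
      (N : Set (E.obj x)) =
        Set.range fun t => E.map (𝟙 R) (y ≫ π) x (by simp [h]) (τ.app y t)

end OModule

/-- A property holds for the general element of a finite dimensional complex vector space `V`: it
holds on a nonempty Zariski open subset, namely where some nonzero polynomial does not vanish. -/
def General {V : Type 1} [AddCommGroup V] [Module ℂ V] (p : V → Prop) : Prop :=
  ∃ (n : ℕ) (b : Module.Basis (Fin n) ℂ V) (F : MvPolynomial (Fin n) ℂ), F ≠ 0 ∧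
    ∀ v, MvPolynomial.eval (fun i => b.repr v i) F ≠ 0 → p v

/-! ## Projective spaces and their line bundles -/

/-- The homogeneous coordinate ring of `ℙⁿ`. -/
abbrev grading (n : ℕ) : ℕ → Submodule ℂ (MvPolynomial (Fin (n + 1)) ℂ) :=
  MvPolynomial.homogeneousSubmodule (Fin (n + 1)) ℂ

/-- The complex projective space `ℙⁿ`. -/
def P (n : ℕ) : Scheme.{0} := Proj (grading n)

/-- The structure morphism of `ℙⁿ`. -/
def P.toC (n : ℕ) : P n ⟶ Spec (.of ℂ) :=
  Proj.toSpecZero (grading n) ≫ Spec.map (CommRingCat.ofHom (algebraMap ℂ (grading n 0)))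

/-- The standard chart `X_i ≠ 0`. -/
def chart (n : ℕ) (i : Fin (n + 1)) : (P n).Opens :=
  Proj.basicOpen (grading n) (MvPolynomial.X i)

lemma X_mem (n : ℕ) (i : Fin (n + 1)) : (MvPolynomial.X i : MvPolynomial _ ℂ) ∈ grading n 1 :=
  MvPolynomial.isHomogeneous_X ℂ i

/-- The regular function `X_j / X_i` on the chart `X_i ≠ 0`. -/
def ratio (n : ℕ) (i j : Fin (n + 1)) : Γ(P n, chart n i) :=
  Proj.awayToSection (grading n) (MvPolynomial.X i)
    (HomogeneousLocalization.Away.mk (grading n) (X_mem n i) 1 (MvPolynomial.X j)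
      (by simpa using X_mem n j))

/-- Restriction of regular functions. -/
def res {X : Scheme.{0}} {U V : X.Opens} (h : U ≤ V) : Γ(X, V) →+* Γ(X, U) :=
  (X.presheaf.map (homOfLE h).op).hom


lemma res_res {X : Scheme.{0}} {U V W : X.Opens} (h : U ≤ V) (h' : V ≤ W) (s : Γ(X, W)) :
    res h (res h' s) = res (h.trans h') s := by
  simp only [res, ← CommRingCat.comp_apply, ← Functor.map_comp]
  rfl

lemma appLE_res {X Y : Scheme.{0}} (f : X ⟶ Y) {U U' : Y.Opens} {V V' : X.Opens} (hU : U' ≤ U)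
    (hV : V' ≤ V) (e : V ≤ f ⁻¹ᵁ U) (e' : V' ≤ f ⁻¹ᵁ U') (t : Γ(Y, U)) :
    (f.appLE U' V' e').hom (res hU t) = res hV ((f.appLE U V e).hom t) := by
  have h : Y.presheaf.map (homOfLE hU).op ≫ f.appLE U' V' e' =
      f.appLE U V e ≫ X.presheaf.map (homOfLE hV).op := by
    rw [Scheme.Hom.map_appLE, Scheme.Hom.appLE_map]
  exact congrArg (fun φ => φ.hom t) h

lemma res_smul {R : CommRingCat.{0}} {U V : (Spec R).Opens} (h : U ≤ V) (r : R)
    (s : Γ(Spec R, V)) : res h (r • s) = r • res h s := by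
  rw [Algebra.smul_def, Algebra.smul_def, map_mul]
  rfl

lemma ratio_self (n : ℕ) (i : Fin (n + 1)) : ratio n i i = 1 := by
  have : HomogeneousLocalization.Away.mk (grading n) (X_mem n i) 1 (MvPolynomial.X i)
      (by simpa using X_mem n i) = 1 := by
    apply HomogeneousLocalization.val_injective
    rw [HomogeneousLocalization.Away.val_mk, HomogeneousLocalization.val_one,
      Localization.mk_eq_monoidOf_mk', Submonoid.LocalizationMap.mk'_eq_iff_eq_mul]
    simp
  rw [ratio, this]
  exact map_one _

lemma ratio_val (n : ℕ) (i j : Fin (n + 1)) (p : chart n i) :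
    ((ratio n i j).val p).val =
      Localization.mk (MvPolynomial.X j) ⟨MvPolynomial.X i, p.2⟩ := by
  refine (ProjectiveSpectrum.Proj.awayToSection_apply (𝒜 := grading n) (MvPolynomial.X i) _ p).trans ?_
  rw [HomogeneousLocalization.Away.val_mk, Localization.mk_eq_mk', IsLocalization.map_mk',
    ← Localization.mk_eq_mk']
  simp

lemma ratio_mul (n : ℕ) (i j k : Fin (n + 1)) :
    res (inf_le_left : chart n i ⊓ chart n j ≤ _) (ratio n i j) * res inf_le_right (ratio n j k) =
      res inf_le_left (ratio n i k) := by
  apply Subtype.ext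
  funext p
  apply HomogeneousLocalization.val_injective
  refine (HomogeneousLocalization.val_mul (ratio n i j |>.val ⟨p.1, p.2.1⟩) (ratio n j k |>.val ⟨p.1, p.2.2⟩)).trans ?_
  refine Eq.trans ?_ (ratio_val n i k ⟨p.1, p.2.1⟩).symm
  refine (congrArg₂ (· * ·) (ratio_val n i j ⟨p.1, p.2.1⟩) (ratio_val n j k ⟨p.1, p.2.2⟩)).trans ?_
  rw [Localization.mk_mul, Localization.mk_eq_mk_iff, Localization.r_iff_exists]
  refine ⟨1, ?_⟩
  simp
  ring

lemma iSup_chart (n : ℕ) : ⨆ i, chart n i = ⊤ := by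
  refine Proj.iSup_basicOpen_eq_top' (grading n) _ (fun i => ⟨1, X_mem n i⟩) ?_
  refine eq_top_iff.2 fun p _ => ?_
  induction p using MvPolynomial.induction_on with
  | C a =>
    exact (Algebra.adjoin (grading n 0) (Set.range MvPolynomial.X)).algebraMap_mem
      ⟨MvPolynomial.C a, MvPolynomial.isHomogeneous_C _ a⟩
  | add p q hp hq => exact add_mem (hp trivial) (hq trivial)
  | mul_X p i hp => exact mul_mem (hp trivial) (Algebra.subset_adjoin ⟨i, rfl⟩)

section Points

variable {n : ℕ} {R S : CommRingCat.{0}}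

/-- The open subset `X_i ≠ 0` of `Spec R`, for a point `x : Spec R ⟶ ℙⁿ`. -/
def dom (x : Spec R ⟶ P n) (i : Fin (n + 1)) : (Spec R).Opens := x ⁻¹ᵁ chart n i

/-- The function `X_j / X_i` on the open subset `X_i ≠ 0` of `Spec R`. -/
def coord (x : Spec R ⟶ P n) (i j : Fin (n + 1)) : Γ(Spec R, dom x i) :=
  x.app (chart n i) (ratio n i j)

lemma coord_self (x : Spec R ⟶ P n) (i : Fin (n + 1)) : coord x i i = 1 := by
  rw [coord, ratio_self]
  exact map_one _

lemma coord_mul (x : Spec R ⟶ P n) (i j k : Fin (n + 1)) :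
    res (inf_le_left : dom x i ⊓ dom x j ≤ _) (coord x i j) * res inf_le_right (coord x j k) =
      res inf_le_left (coord x i k) := by
  have key (U : (P n).Opens) (a : Fin (n + 1)) (h : U ≤ chart n a) (b : Fin (n + 1))
      (h' : x ⁻¹ᵁ U ≤ dom x a) : res h' (coord x a b) = (x.app U).hom (res h (ratio n a b)) :=
    congrArg (fun φ => φ.hom (ratio n a b)) (x.naturality (homOfLE h).op).symm
  have := congrArg (x.app (chart n i ⊓ chart n j)).hom (ratio_mul n i j k)
  rw [map_mul] at this
  refine Eq.trans (congrArg₂ (· * ·) (key (chart n i ⊓ chart n j) i inf_le_left j ?_)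
    (key (chart n i ⊓ chart n j) j inf_le_right k ?_)) (this.trans
      (key (chart n i ⊓ chart n j) i inf_le_left k ?_).symm)
  · exact (inf_le_left : dom x i ⊓ dom x j ≤ _)
  · exact (inf_le_right : dom x i ⊓ dom x j ≤ _)
  · exact (inf_le_left : dom x i ⊓ dom x j ≤ _)

lemma dom_le {f : R ⟶ S} {x : Spec R ⟶ P n} {y : Spec S ⟶ P n} (h : Spec.map f ≫ x = y)
    (i : Fin (n + 1)) : dom y i ≤ Spec.map f ⁻¹ᵁ dom x i := by
  subst h
  exact le_rfl

/-- The base change of functions on `X_i ≠ 0` along `Spec S ⟶ Spec R`. -/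
def pull (f : R ⟶ S) (x : Spec R ⟶ P n) (y : Spec S ⟶ P n) (h : Spec.map f ≫ x = y)
    (i : Fin (n + 1)) : Γ(Spec R, dom x i) →+* Γ(Spec S, dom y i) :=
  ((Spec.map f).appLE (dom x i) (dom y i) (dom_le h i)).hom

lemma pull_coord (f : R ⟶ S) (x : Spec R ⟶ P n) (y : Spec S ⟶ P n) (h : Spec.map f ≫ x = y)
    (i j : Fin (n + 1)) : pull f x y h i (coord x i j) = coord y i j := by
  subst h
  have := Scheme.Hom.comp_appLE (Spec.map f) x (chart n i) _ le_rfl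
  rw [← Scheme.Hom.app_eq_appLE] at this
  exact (congrArg (fun φ => φ.hom (ratio n i j)) this).symm

lemma pull_smul (f : R ⟶ S) (x : Spec R ⟶ P n) (y : Spec S ⟶ P n) (h : Spec.map f ≫ x = y)
    (i : Fin (n + 1)) (r : R) (t : Γ(Spec R, dom x i)) :
    pull f x y h i (r • t) = f.hom r • pull f x y h i t := by
  rw [Algebra.smul_def, Algebra.smul_def, map_mul]
  congr 1
  refine (appLE_res (Spec.map f) le_top le_top (U := ⊤) (V := ⊤) le_top (dom_le h i)
    ((Scheme.ΓSpecIso R).inv.hom r)).trans ?_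
  have := congrArg (fun φ => φ.hom r) (Scheme.ΓSpecIso_inv_naturality f)
  have e : (Spec.map f).appLE ⊤ ⊤ le_top = (Spec.map f).appTop := Scheme.Hom.appLE_eq_app _
  rw [e]
  exact congrArg (res le_top) this.symm

lemma pull_id (x : Spec R ⟶ P n) (h : Spec.map (𝟙 R) ≫ x = x) (i : Fin (n + 1))
    (t : Γ(Spec R, dom x i)) : pull (𝟙 R) x x h i t = t := by
  have key : ∀ (g : Spec R ⟶ Spec R) (hg : g = 𝟙 _) (e : dom x i ≤ g ⁻¹ᵁ dom x i),
      g.appLE (dom x i) (dom x i) e = 𝟙 _ := by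
    rintro g rfl e
    exact (Category.id_comp _).trans ((Spec R).presheaf.map_id _)
  exact congrArg (fun φ => φ.hom t) (key _ (Spec.map_id R) (dom_le h i))

lemma pull_comp {T : CommRingCat.{0}} (f : R ⟶ S) (g : S ⟶ T) (x : Spec R ⟶ P n)
    (y : Spec S ⟶ P n) (z : Spec T ⟶ P n) (hxy : Spec.map f ≫ x = y) (hyz : Spec.map g ≫ y = z)
    (hxz : Spec.map (f ≫ g) ≫ x = z) (i : Fin (n + 1)) (t : Γ(Spec R, dom x i)) :
    pull (f ≫ g) x z hxz i t = pull g y z hyz i (pull f x y hxy i t) := by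
  simp only [pull, ← CommRingCat.comp_apply, Scheme.Hom.appLE_comp_appLE, Spec.map_comp]

lemma pull_overlap {f : R ⟶ S} {x : Spec R ⟶ P n} {y : Spec S ⟶ P n} (h : Spec.map f ≫ x = y)
    (i j : Fin (n + 1)) : ∃ ρ : Γ(Spec R, dom x i ⊓ dom x j) →+* Γ(Spec S, dom y i ⊓ dom y j),
      (∀ t, ρ (res inf_le_left t) = res inf_le_left (pull f x y h i t)) ∧
      ∀ t, ρ (res inf_le_right t) = res inf_le_right (pull f x y h j t) := by
  refine ⟨((Spec.map f).appLE _ _ (inf_le_inf (dom_le h i) (dom_le h j))).hom, ?_, ?_⟩ <;>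
  · intro t
    exact appLE_res _ _ _ _ _ t

/-- The sections of `x^* 𝒪(d)` over `Spec R`: families `t_i` of functions on the `X_i ≠ 0` (standing
for `t / X_i^d`) with `t_i = (X_j / X_i)^d t_j` on the overlaps; `d` may be negative, and
`X_j / X_i` has the inverse `X_i / X_j` on the overlap. -/
def twistSections (d : ℤ) (x : Spec R ⟶ P n) : Submodule R (∀ i, Γ(Spec R, dom x i)) where
  carrier := {t | ∀ i j, res (inf_le_left : dom x i ⊓ dom x j ≤ _) (t i) =
    res inf_le_left (coord x i j) ^ d.toNat * res inf_le_right (coord x j i) ^ (-d).toNat *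
      res inf_le_right (t j)}
  zero_mem' i j := by simp
  add_mem' ht hu i j := by
    simp only [Pi.add_apply, map_add, ht i j, hu i j, mul_add]
  smul_mem' r t ht i j := by
    simp only [Pi.smul_apply, res_smul, ht i j, mul_smul_comm]

lemma pull_mem {d : ℤ} {f : R ⟶ S} {x : Spec R ⟶ P n} {y : Spec S ⟶ P n}
    (h : Spec.map f ≫ x = y) {t : ∀ i, Γ(Spec R, dom x i)} (ht : t ∈ twistSections d x) :
    (fun i => pull f x y h i (t i)) ∈ twistSections d y := by
  intro i j
  obtain ⟨ρ, h₁, h₂⟩ := pull_overlap h i j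
  have := congrArg ρ (ht i j)
  rwa [map_mul, map_mul, map_pow, map_pow, h₁, h₁, h₂, h₂, pull_coord, pull_coord] at this

/-- The base change of sections of `𝒪(d)`. -/
def pullTwist (d : ℤ) (f : R ⟶ S) (x : Spec R ⟶ P n) (y : Spec S ⟶ P n)
    (h : Spec.map f ≫ x = y) : twistSections d x →ₛₗ[f.hom] twistSections d y where
  toFun t := ⟨fun i => pull f x y h i (t.1 i), pull_mem h t.2⟩
  map_add' t u := Subtype.ext (funext fun i => map_add (pull f x y h i) (t.1 i) (u.1 i))
  map_smul' r t := Subtype.ext (funext fun i => pull_smul f x y h i r (t.1 i))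

/-- Two functions on `Spec R` that agree on all the `X_i ≠ 0` are equal, and functions on the
`X_i ≠ 0` that agree on the overlaps come from an element of `R`. -/
lemma existsUnique_glue (x : Spec R ⟶ P n) (t : ∀ i, Γ(Spec R, dom x i))
    (ht : ∀ i j, res (inf_le_left : dom x i ⊓ dom x j ≤ _) (t i) = res inf_le_right (t j)) :
    ∃! r : R, ∀ i, algebraMap R Γ(Spec R, dom x i) r = t i := by
  have cover : (⊤ : (Spec R).Opens) ≤ ⨆ i, dom x i := by
    intro p _
    have hp : x.base p ∈ ⨆ i, chart n i := by
      rw [iSup_chart]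
      trivial
    obtain ⟨i, hi⟩ := TopologicalSpace.Opens.mem_iSup.1 hp
    exact TopologicalSpace.Opens.mem_iSup.2 ⟨i, hi⟩
  obtain ⟨s, hs, hu⟩ := (Spec R).sheaf.existsUnique_gluing' (dom x) ⊤
    (fun i => homOfLE le_top) cover t ht
  have alg (r : R) (i : Fin (n + 1)) : algebraMap R Γ(Spec R, dom x i) r =
      res le_top ((Scheme.ΓSpecIso R).inv.hom r) := rfl
  refine ⟨(Scheme.ΓSpecIso R).hom.hom s, fun i => ?_, fun r hr => ?_⟩
  · rw [alg]
    refine Eq.trans (congrArg (res le_top) ?_) (hs i)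
    exact congrArg (fun φ => φ.hom s) (Scheme.ΓSpecIso R).hom_inv_id
  · rw [← hu ((Scheme.ΓSpecIso R).inv.hom r) fun i => hr i]
    exact (congrArg (fun φ => φ.hom r) (Scheme.ΓSpecIso R).inv_hom_id).symm

lemma coord_mul_inv (x : Spec R ⟶ P n) (i j : Fin (n + 1)) :
    res (inf_le_left : dom x i ⊓ dom x j ≤ _) (coord x i j) * res inf_le_right (coord x j i) =
      1 := by
  rw [coord_mul, coord_self, map_one]

lemma mulX_mem {d e : ℤ} (hde : e = d + 1) (k : Fin (n + 1)) (x : Spec R ⟶ P n)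
    {t : ∀ i, Γ(Spec R, dom x i)} (ht : t ∈ twistSections d x) :
    (fun i => t i * coord x i k) ∈ twistSections e x := by
  intro i j
  rw [map_mul, map_mul, ht i j, ← coord_mul x i j k]
  have h := coord_mul_inv x i j
  obtain hd | hd := le_or_gt 0 d
  · rw [show e.toNat = d.toNat + 1 by omega, show (-e).toNat = (-d).toNat by omega]
    ring
  · rw [show e.toNat = d.toNat by omega, show (-d).toNat = (-e).toNat + 1 by omega]
    linear_combination (res inf_le_left (coord x i j) ^ d.toNat *
      res inf_le_right (coord x j i) ^ (-e).toNat * res inf_le_right (t j) *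
      res inf_le_right (coord x j k)) * h

lemma existsUnique_tautCoord (x : Spec R ⟶ P n) (t : twistSections (-1) x) (k : Fin (n + 1)) :
    ∃! r : R, ∀ i, algebraMap R Γ(Spec R, dom x i) r = t.1 i * coord x i k := by
  refine existsUnique_glue x _ fun i j => ?_
  have := mulX_mem (e := 0) (by norm_num) k x t.2 i j
  simpa using this

/-- The element `t X_k` of `R`, for a section `t` of `𝒪(-1)`. -/
def tautCoord (x : Spec R ⟶ P n) (t : twistSections (-1) x) (k : Fin (n + 1)) : R :=
  (existsUnique_tautCoord x t k).choose

lemma algebraMap_tautCoord (x : Spec R ⟶ P n) (t : twistSections (-1) x) (k i : Fin (n + 1)) :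
    algebraMap R Γ(Spec R, dom x i) (tautCoord x t k) = t.1 i * coord x i k :=
  (existsUnique_tautCoord x t k).choose_spec.1 i

lemma eq_tautCoord {x : Spec R ⟶ P n} {t : twistSections (-1) x} {k : Fin (n + 1)} {r : R}
    (h : ∀ i, algebraMap R Γ(Spec R, dom x i) r = t.1 i * coord x i k) : r = tautCoord x t k :=
  (existsUnique_tautCoord x t k).choose_spec.2 r h

lemma tautCoord_add (x : Spec R ⟶ P n) (t u : twistSections (-1) x) (k : Fin (n + 1)) :
    tautCoord x (t + u) k = tautCoord x t k + tautCoord x u k :=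
  (eq_tautCoord fun i => by
    rw [map_add, algebraMap_tautCoord, algebraMap_tautCoord, ← add_mul]
    rfl).symm

lemma tautCoord_smul (x : Spec R ⟶ P n) (r : R) (t : twistSections (-1) x) (k : Fin (n + 1)) :
    tautCoord x (r • t) k = r * tautCoord x t k :=
  (eq_tautCoord fun i => by
    rw [map_mul, algebraMap_tautCoord, ← Algebra.smul_def]
    exact (smul_mul_assoc _ _ _).symm).symm

lemma tautCoord_pull (f : R ⟶ S) (x : Spec R ⟶ P n) (y : Spec S ⟶ P n) (h : Spec.map f ≫ x = y)
    (t : twistSections (-1) x) (k : Fin (n + 1)) :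
    f.hom (tautCoord x t k) = tautCoord y (pullTwist (-1) f x y h t) k :=
  eq_tautCoord fun i => by
    have h₁ := pull_smul f x y h i (tautCoord x t k) 1
    rw [map_one, Algebra.smul_def, Algebra.smul_def, mul_one, mul_one, algebraMap_tautCoord,
      map_mul, pull_coord] at h₁
    exact h₁.symm

lemma detForm_mem (x : Spec R ⟶ P 1) (a b : R) :
    (fun i => b • coord x i 0 - a • coord x i 1) ∈ twistSections 1 x := by
  intro i j
  rw [map_sub, res_smul, res_smul, map_sub, res_smul, res_smul, ← coord_mul x i j 0,
    ← coord_mul x i j 1]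
  rw [show (1 : ℤ).toNat = 1 from rfl, show (-1 : ℤ).toNat = 0 from rfl, pow_one, pow_zero,
    mul_one, mul_sub, mul_smul_comm, mul_smul_comm]

end Points

/-- The line bundle `𝒪(d)` on `ℙⁿ`, with transition functions `(X_j / X_i)^d`. -/
def O (n : ℕ) (d : ℤ) : OModule (P n) where
  obj {R} x := ModuleCat.of R (twistSections d x)
  map f x y h := pullTwist d f x y h
  map_id x h t := Subtype.ext (funext fun i => pull_id x h i (t.1 i))
  map_comp f g x y z hxy hyz hxz t :=
    Subtype.ext (funext fun i => pull_comp f g x y z hxy hyz hxz i (t.1 i))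

/-- Multiplication by the homogeneous coordinate `X_k`, for `e = d + 1`. -/
def mulX (n : ℕ) {d e : ℤ} (hde : e = d + 1) (k : Fin (n + 1)) : O n d ⟶ O n e where
  app x :=
    { toFun := fun t => ⟨fun i => t.1 i * coord x i k, mulX_mem hde k x t.2⟩
      map_add' := fun t u => Subtype.ext (funext fun i => add_mul (t.1 i) (u.1 i) _)
      map_smul' := fun r t => Subtype.ext (funext fun i => smul_mul_assoc r (t.1 i) _) }
  naturality f x y h t := Subtype.ext (funext fun i =>
    (map_mul (pull f x y h i) (t.1 i) _).trans
      (congrArg (pull f x y h i (t.1 i) * ·) (pull_coord f x y h i k)))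

/-- The tautological inclusion `𝒪(-1) → 𝒪^{⊕(n+1)}`, `t ↦ (t X_0, …, t X_n)`. -/
def taut (n : ℕ) : O n (-1) ⟶ OModule.free (P n) (Fin (n + 1)) where
  app x :=
    { toFun := fun t k => tautCoord x t k
      map_add' := fun t u => funext fun k => tautCoord_add x t u k
      map_smul' := fun r t => funext fun k => tautCoord_smul x r t k }
  naturality f x y h t := funext fun k => tautCoord_pull f x y h t k

/-- The tautological quotient bundle `𝒬` on `ℙⁿ`. -/
def Q (n : ℕ) : OModule (P n) := OModule.coker (taut n)

/-- The projection `𝒪^{⊕(n+1)} → 𝒬`. -/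
def toQ (n : ℕ) : OModule.free (P n) (Fin (n + 1)) ⟶ Q n := OModule.cokerπ (taut n)

/-- The second map `v ↦ X_0 v_1 - X_1 v_0` of the Euler sequence
`0 → 𝒪(-1) → 𝒪^{⊕2} → 𝒪(1) → 0` on `ℙ¹`. -/
def toO1 : OModule.free (P 1) (Fin 2) ⟶ O 1 1 where
  app x :=
    { toFun := fun v => ⟨fun i => v 1 • coord x i 0 - v 0 • coord x i 1,
        detForm_mem x (v 0) (v 1)⟩
      map_add' := fun v w => Subtype.ext (funext fun i => by
        change (v 1 + w 1) • coord x i 0 - (v 0 + w 0) • coord x i 1 =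
          (v 1 • coord x i 0 - v 0 • coord x i 1) +
            (w 1 • coord x i 0 - w 0 • coord x i 1)
        rw [add_smul, add_smul]
        abel)
      map_smul' := fun r v => Subtype.ext (funext fun i => by
        change (r * v 1) • coord x i 0 - (r * v 0) • coord x i 1 =
          r • (v 1 • coord x i 0 - v 0 • coord x i 1)
        rw [mul_smul, mul_smul, smul_sub]) }
  naturality f x y h v := Subtype.ext (funext fun i => by
    refine (map_sub (pull f x y h i) _ _).trans ?_
    rw [pull_smul, pull_smul, pull_coord, pull_coord]
    rfl)

/-- The map `𝒪(-2) → 𝒪(-1)^{⊕3} = 𝒪(-1) ⊗ 𝒪^{⊕3}`, `t ↦ ∑ (t X_k) ⊗ e_k`, of the twisted Euler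
sequence on `ℙ²`. -/
def eulerIncl : O 2 (-2) ⟶ (O 2 (-1)).tensor (OModule.free (P 2) (Fin 3)) where
  app {R} x := ∑ k : Fin 3,
    ((TensorProduct.mk R ((O 2 (-1)).obj x) (Fin 3 → R)).flip (Pi.single k 1)) ∘ₗ
      (mulX 2 (by norm_num : (-1 : ℤ) = -2 + 1) k).app x
  naturality {R S} f x y h t := by
    rw [LinearMap.sum_apply, LinearMap.sum_apply, map_sum]
    refine Finset.sum_congr rfl fun k _ => congrArg₂ (· ⊗ₜ[S] ·)
      ((mulX 2 (by norm_num : (-1 : ℤ) = -2 + 1) k).naturality f x y h t) (funext fun i => ?_)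
    change f.hom ((Pi.single k (1 : R) : Fin 3 → R) i) = (Pi.single k (1 : S) : Fin 3 → S) i
    rw [Pi.single_apply, Pi.single_apply, apply_ite f.hom, map_one, map_zero]

/-- `𝒪(-1)^{⊕3}` on `ℙ²`. -/
def Om1_3 : OModule (P 2) := (O 2 (-1)).tensor (OModule.free (P 2) (Fin 3))

/-- `𝒪^{⊕6} = Sym² (𝒪^{⊕3})` on `ℙ²`. -/
def O_6 : OModule (P 2) := (OModule.free (P 2) (Fin 3)).sym2

/-- `𝒬(-1)` on `ℙ²`. -/
def Qm1 : OModule (P 2) := (O 2 (-1)).tensor (Q 2)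

/-- The second map of the twisted Euler sequence `0 → 𝒪(-2) → 𝒪(-1)^{⊕3} → 𝒬(-1) → 0`. -/
def eulerProj : Om1_3 ⟶ Qm1 := OModule.tensorMap (𝟙 _) (toQ 2)

/-- The first map `t ⊗ v ↦ t v` of the (dual) sequence of principal parts
`0 → 𝒪(-1)^{⊕3} → 𝒪^{⊕6} → Sym² 𝒬 → 0`. -/
def partsIncl : Om1_3 ⟶ O_6 := OModule.tensorMap (taut 2) (𝟙 _) ≫ OModule.sym2Mul _

/-- The second map of the (dual) sequence of principal parts. -/
def partsProj : O_6 ⟶ (Q 2).sym2 := OModule.sym2Map (toQ 2)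

/-- The composition `𝒪(-2) → 𝒪(-1)^{⊕3} → 𝒪^{⊕6}`. -/
def veronese : O 2 (-2) ⟶ O_6 := eulerIncl ≫ partsIncl

/-! ## The product `ℙ¹ × ℙ²` and the bundle `K` -/

/-- `ℙ¹ × ℙ²`. -/
def P12 : Scheme.{0} := Limits.pullback (P.toC 1) (P.toC 2)

/-- The projection to `ℙ¹`. -/
def P12.pr₁ : P12 ⟶ P 1 := pullback.fst (P.toC 1) (P.toC 2)

/-- The projection to `ℙ²`. -/
def P12.pr₂ : P12 ⟶ P 2 := pullback.snd (P.toC 1) (P.toC 2)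

/-- The structure morphism of `ℙ¹ × ℙ²`. -/
def P12.toC : P12 ⟶ Spec (.of ℂ) := P12.pr₁ ≫ P.toC 1

/-- The external tensor product on `ℙ¹ × ℙ²`. -/
def ext (E : OModule (P 1)) (F : OModule (P 2)) : OModule P12 := OModule.box (P.toC 1) (P.toC 2) E F

infixl:70 " ⊠ " => ext

/-- The external tensor product of homomorphisms. -/
def extMap {E E' : OModule (P 1)} {F F' : OModule (P 2)} (φ : E ⟶ E') (ψ : F ⟶ F') :
    E ⊠ F ⟶ E' ⊠ F' :=
  OModule.boxMap (P.toC 1) (P.toC 2) φ ψ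

/-- `𝒪^{⊕12} = 𝒪^{⊕2} ⊠ 𝒪^{⊕6}` on `ℙ¹ × ℙ²`. -/
def O_12 : OModule P12 := OModule.free (P 1) (Fin 2) ⊠ O_6

/-- The composition `𝒪(-1,-2) → 𝒪(-1,0)^{⊕6} → 𝒪^{⊕12}`, of the pull back of
`𝒪(-2) → 𝒪^{⊕6}` twisted by `𝒪(-1,0)` with six copies of the tautological inclusion on `ℙ¹`. -/
def segreVeronese : O 1 (-1) ⊠ O 2 (-2) ⟶ O_12 :=
  extMap (𝟙 (O 1 (-1))) veronese ≫ extMap (taut 1) (𝟙 O_6)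

/-- Completions of the two diagrams. On `ℙ²`, with exact rows and columns,
```
  𝒪(-2) → 𝒪(-1)^3 → 𝒬(-1)
    ‖         ↓         ↓ i
  𝒪(-2) →  𝒪^6   →p    Λ
              ↓         ↓ j
           Sym² 𝒬   =  Sym² 𝒬
```
where the first row is the twisted Euler sequence and the middle column is the dual sequence of
principal parts. On `ℙ¹ × ℙ²`, with exact rows and columns,
```
  𝒪(-1,-2) → 𝒪(-1,0)^6 → Λ(-1,0)
     ‖           ↓          ↓ i'
  𝒪(-1,-2) →  𝒪^12   →p'    K
                 ↓          ↓ j'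
             𝒪(1,0)^6  =  𝒪(1,0)^6
```
where the first row is the twist by `𝒪(-1,0)` of the pull back of the middle row of the first
diagram and the middle column consists of six copies of the Euler sequence of `ℙ¹`. -/
structure Completion where
  Λ : OModule (P 2)
  p : O_6 ⟶ Λ
  i : Qm1 ⟶ Λ
  j : Λ ⟶ (Q 2).sym2
  exact_row : OModule.IsShortExact veronese p
  exact_col : OModule.IsShortExact i j
  comm : partsIncl ≫ p = eulerProj ≫ i
  comm_sym2 : p ≫ j = partsProj
  K : OModule P12
  p' : O_12 ⟶ K
  i' : O 1 (-1) ⊠ Λ ⟶ K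
  j' : K ⟶ O 1 1 ⊠ O_6
  exact_row' : OModule.IsShortExact segreVeronese p'
  exact_col' : OModule.IsShortExact i' j'
  comm' : extMap (taut 1) (𝟙 O_6) ≫ p' = extMap (𝟙 (O 1 (-1))) p ≫ i'
  comm_O1 : p' ≫ j' = extMap toO1 (𝟙 O_6)

/-- Isomorphisms of completions: isomorphisms of `Λ` and of `K` that are compatible with all the
maps of the diagrams. -/
structure Completion.Iso (D D' : Completion) where
  isoΛ : D.Λ ≅ D'.Λ
  isoK : D.K ≅ D'.K
  p_comp : D.p ≫ isoΛ.hom = D'.p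
  i_comp : D.i ≫ isoΛ.hom = D'.i
  comp_j : isoΛ.hom ≫ D'.j = D.j
  p'_comp : D.p' ≫ isoK.hom = D'.p'
  i'_comp : D.i' ≫ isoK.hom = extMap (𝟙 (O 1 (-1))) isoΛ.hom ≫ D'.i'
  comp_j' : isoK.hom ≫ D'.j' = D.j'

/-! ### Homogeneous bundles -/

/-- The line `[X_0 : … : X_n]` in `R^{n+1}` that belongs to a point of `ℙⁿ`. -/
def tautLine {n : ℕ} {R : CommRingCat.{0}} (x : Spec R ⟶ P n) : Submodule R (Fin (n + 1) → R) :=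
  LinearMap.range ((taut n).app x)

/-- `y = g x` for the action of `SL_{n+1}` on `ℙⁿ`. -/
def IsTranslate {n : ℕ} {R : CommRingCat.{0}} (g : Matrix.SpecialLinearGroup (Fin (n + 1)) R)
    (x y : Spec R ⟶ P n) : Prop :=
  x ≫ P.toC n = y ≫ P.toC n ∧ tautLine y = (tautLine x).map (Matrix.toLin' g.1)

/-- `y = (g, h) x` for the action of `SL_2 × SL_3` on `ℙ¹ × ℙ²`. -/
def IsTranslate₁₂ {R : CommRingCat.{0}}
    (g : Matrix.SpecialLinearGroup (Fin 2) R × Matrix.SpecialLinearGroup (Fin 3) R)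
    (x y : Spec R ⟶ P12) : Prop :=
  IsTranslate g.1 (x ≫ P12.pr₁) (y ≫ P12.pr₁) ∧ IsTranslate g.2 (x ≫ P12.pr₂) (y ≫ P12.pr₂)

/-- A lift to `E` of the action of `SL_2 × SL_3` on `ℙ¹ × ℙ²`: linear isomorphisms
`E(x) ≃ E(g x)`, for all rings `R`, all `R`-points `x` and all `R`-points `g` of the group, that
are multiplicative in `g` and compatible with base change. -/
structure Linearization (E : OModule P12) where
  act : ∀ {R : CommRingCat.{0}}
    (g : Matrix.SpecialLinearGroup (Fin 2) R × Matrix.SpecialLinearGroup (Fin 3) R)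
    (x y : Spec R ⟶ P12), IsTranslate₁₂ g x y → (E.obj x ≃ₗ[R] E.obj y)
  act_one : ∀ {R : CommRingCat.{0}} (x : Spec R ⟶ P12) (h : IsTranslate₁₂ 1 x x) (m : E.obj x),
    act 1 x x h m = m
  act_mul : ∀ {R : CommRingCat.{0}}
    (g g' : Matrix.SpecialLinearGroup (Fin 2) R × Matrix.SpecialLinearGroup (Fin 3) R)
    (x y z : Spec R ⟶ P12) (h : IsTranslate₁₂ g x y) (h' : IsTranslate₁₂ g' y z)
    (h'' : IsTranslate₁₂ (g' * g) x z) (m : E.obj x),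
    act (g' * g) x z h'' m = act g' y z h' (act g x y h m)
  act_map : ∀ {R S : CommRingCat.{0}} (f : R ⟶ S)
    (g : Matrix.SpecialLinearGroup (Fin 2) R × Matrix.SpecialLinearGroup (Fin 3) R)
    (x y : Spec R ⟶ P12) (x' y' : Spec S ⟶ P12)
    (hx : Spec.map f ≫ x = x') (hy : Spec.map f ≫ y = y') (h : IsTranslate₁₂ g x y)
    (h' : IsTranslate₁₂ (Matrix.SpecialLinearGroup.map f.hom g.1,
      Matrix.SpecialLinearGroup.map f.hom g.2) x' y') (m : E.obj x),
    E.map f y y' hy (act g x y h m) = act _ x' y' h' (E.map f x x' hx m)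

/-- `E` is a homogeneous bundle on `ℙ¹ × ℙ²`. -/
def IsHomogeneous (E : OModule P12) : Prop := Nonempty (Linearization E)

/-! ## The product `ℙ¹ × ℙ² × ℙ¹²` -/

/-- `ℙ¹ × ℙ² × ℙ¹²`. -/
def Ambient : Scheme.{0} := Limits.pullback P12.toC (P.toC 12)

/-- The projection to `ℙ¹ × ℙ²`. -/
def Ambient.pr₁₂ : Ambient ⟶ P12 := pullback.fst P12.toC (P.toC 12)

/-- The projection to `ℙ¹²`. -/
def Ambient.pr₃ : Ambient ⟶ P 12 := pullback.snd P12.toC (P.toC 12)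

/-- The structure morphism of `ℙ¹ × ℙ² × ℙ¹²`. -/
def Ambient.toC : Ambient ⟶ Spec (.of ℂ) := Ambient.pr₁₂ ≫ P12.toC

/-- `E(0,0,1)`, for a module `E` on `ℙ¹ × ℙ²`. -/
def twist001 (E : OModule P12) : OModule Ambient := OModule.box P12.toC (P.toC 12) E (O 12 1)

/-- The vector bundle `𝒪(-1,-2) ⊕ 𝒪` on `ℙ¹ × ℙ²`. -/
def splitBundle : OModule P12 := (O 1 (-1) ⊠ O 2 (-2)).sum (OModule.free P12 (Fin 1))

/-- `i : Z ⟶ ℙ¹ × ℙ² × ℙ¹²`, with the projection to `ℙ¹ × ℙ²`, is the projective bundle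
`ℙ(𝒪(-1,-2) ⊕ 𝒪)`, and `𝒪(0,0,-1)` restricts on it to the tautological line subbundle
`𝒪_{ℙ(𝒪(-1,-2) ⊕ 𝒪)}(-1)`. -/
def IsModel {Z : Scheme.{0}} (i : Z ⟶ Ambient) : Prop :=
  ∃ τ : ((O 12 (-1)).pullback Ambient.pr₃).pullback i ⟶ splitBundle.pullback (i ≫ Ambient.pr₁₂),
    OModule.IsProjectiveBundle splitBundle (i ≫ Ambient.pr₁₂) _ τ

end Fano

end

noncomputable section

namespace Fano

/-! Everything local rests on `exists_frame`: over each affine point of `ℙⁿ` there are sections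
`s_k` of `𝒪(-1)` with `∑ s_k X_k = 1`. Together with the coordinates they form a dual basis of
`𝒪(-1)`. Hence the tautological inclusion, its square `𝒪(-2) → Sym² 𝒪^3` and the product `𝒪(-1,-2) →
𝒪^2 ⊠ Sym² 𝒪^3` are split injective over every affine point, although not compatibly with base
change.

The diagrams are then formal. The exact rows force `Λ` and `K` to be cokernels of the two inclusions
of line bundles, which gives uniqueness; a row and a column that cross induce an exact column of
cokernels (`exact_of_cross`). The only arithmetic input is that `2` is invertible, for the
injectivity of `𝒪(-1)^3 → Sym² 𝒪^3`. The cokernels of the split inclusions are projective of ranks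
`6 - 1` and `12 - 1`. The group acts on `𝒪^12` and preserves the subbundle `𝒪(-1,-2)`, so it acts on
the quotient `K`.

The sections of `K(0,0,1)` are the complex matrices with 12 rows and 13 columns (`matrixEquiv`). The
tool is that a function of homogeneous coordinates, natural in the coefficient algebra and
homogeneous of degree `0` or `1`, is constant or linear (`CoordFun`). It follows that `Λ(-1,0)` has
no sections and that those of `𝒪(1,0)^6` come from `𝒪^12`; so `K` has the same sections as `𝒪^12`,
and a section of `K(0,0,1)` is a linear form on `ℙ¹²` with values in these.

The section of a matrix `A` vanishes at a point `w` of `ℙ¹ × ℙ²` and a line `ℓ` exactly when `A ℓ`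
lies in the fibre of `𝒪(-1,-2)` at `w`. If the first twelve columns of `A` are independent, then `A`
and the last coordinate give an isomorphism of `𝒪^13` with `𝒪^12 ⊕ 𝒪`, which identifies the preimage
of `𝒪(-1,-2)` under `A` with `𝒪(-1,-2) ⊕ 𝒪`. The zero locus therefore parametrises the lines in this
bundle, and the line `ℓ` is the fibre of `𝒪(0,0,-1)`. To conclude, points of `ℙ¹²` are identified
with line subbundles of `R^13` (`exists_point`, `eq_of_tautLine`), and the zero scheme is built from
an ideal sheaf (`isZeroLocus_zeroIdeal`). -/

instance (n : ℕ) : Scheme.IsSeparated (P n) := inferInstanceAs (Scheme.IsSeparated (Proj (grading n)))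

lemma isAffineOpen_chart (n : ℕ) (i : Fin (n + 1)) : IsAffineOpen (chart n i) :=
  Proj.isAffineOpen_basicOpen (grading n) (MvPolynomial.X i) (X_mem n i) one_pos

/-! ### Pairings of the line bundles `𝒪(d)`, and generation of `𝒪(1)` by the coordinates. -/

section Twist

variable {n : ℕ} {R S : CommRingCat.{0}} (x : Spec R ⟶ P n)

/-- A morphism from an affine scheme to a separated scheme is quasi-compact. Compactness is what
allows denominators to be cleared on the charts. -/
lemma isCompact_dom (i : Fin (n + 1)) : IsCompact (dom x i).1 :=
  QuasiCompact.isCompact_preimage (f := x) _ (chart n i).2 (isAffineOpen_chart n i).isCompact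

variable {x} in
lemma eq_of_algebraMap_eq {r r' : R}
    (h : ∀ i, algebraMap R Γ(Spec R, dom x i) r = algebraMap R Γ(Spec R, dom x i) r') : r = r' :=
  (existsUnique_glue x (fun i => algebraMap R Γ(Spec R, dom x i) r') fun _ _ => rfl).unique h
    fun _ => rfl

lemma res_algebraMap {U V : (Spec R).Opens} (h : U ≤ V) (r : R) :
    res h (algebraMap R Γ(Spec R, V) r) = algebraMap R Γ(Spec R, U) r := rfl

lemma pull_algebraMap (f : R ⟶ S) (x : Spec R ⟶ P n) (y : Spec S ⟶ P n) (h : Spec.map f ≫ x = y)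
    (i : Fin (n + 1)) (r : R) : pull f x y h i (algebraMap R _ r) = algebraMap S _ (f.hom r) := by
  have := pull_smul f x y h i r 1
  rwa [map_one, Algebra.smul_def, Algebra.smul_def, mul_one, mul_one] at this

/-- Since `v` is the inverse of `u`, each product is the integer power of a unit. This converts the
truncated exponents of `twistSections` into `zpow`. -/
lemma toNat_pow_mul_pow {A : Type} [CommRing A] {u v : A} (h : u * v = 1) (d e : ℤ) :
    u ^ (d + e).toNat * v ^ (-(d + e)).toNat =
      (u ^ d.toNat * v ^ (-d).toNat) * (u ^ e.toNat * v ^ (-e).toNat) := by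
  have key (m : ℤ) : u ^ m.toNat * v ^ (-m).toNat =
      ((⟨u, v, h, (mul_comm _ _).trans h⟩ : Aˣ) ^ m : Aˣ) := by
    obtain ⟨k, rfl | rfl⟩ := m.eq_nat_or_neg
    · simp
    · simp
  rw [key, key, key, zpow_add, Units.val_mul]

/-- The multiplication `𝒪(d) ⊗ 𝒪(e) → 𝒪(d + e)`. -/
def mulSec {d e f : ℤ} (h : d + e = f) :
    twistSections d x →ₗ[R] twistSections e x →ₗ[R] twistSections f x :=
  LinearMap.mk₂ R (fun t u => ⟨fun i => t.1 i * u.1 i, fun i j => by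
      subst h
      rw [map_mul, map_mul, t.2 i j, u.2 i j, toNat_pow_mul_pow (coord_mul_inv x i j)]
      ring⟩)
    (fun t t' u => Subtype.ext (funext fun i => add_mul _ _ _))
    (fun r t u => Subtype.ext (funext fun i => smul_mul_assoc r (t.1 i) _))
    (fun t u u' => Subtype.ext (funext fun i => mul_add _ _ _))
    (fun r t u => Subtype.ext (funext fun i => mul_smul_comm r (t.1 i) _))

/-- Sections of `𝒪(0)` are functions. -/
lemma existsUnique_pair {d e : ℤ} (h : d + e = 0) (t : twistSections d x) (u : twistSections e x) :
    ∃! r : R, ∀ i, algebraMap R Γ(Spec R, dom x i) r = t.1 i * u.1 i := by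
  refine existsUnique_glue x _ fun i j => ?_
  have := (mulSec x h t u).2 i j
  rw [show (0 : ℤ).toNat = 0 from rfl, show (-0 : ℤ).toNat = 0 from rfl, pow_zero, pow_zero,
    one_mul, one_mul] at this
  exact this

/-- The pairing `𝒪(d) ⊗ 𝒪(-d) → 𝒪`. -/
def pair {d e : ℤ} (h : d + e = 0) : twistSections d x →ₗ[R] twistSections e x →ₗ[R] R :=
  have key (t : twistSections d x) (u : twistSections e x) :=
    (existsUnique_pair x h t u).choose_spec
  LinearMap.mk₂ R (fun t u => (existsUnique_pair x h t u).choose)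
    (fun t t' u => eq_of_algebraMap_eq fun i => by
      rw [(key _ _).1 i, map_add, (key _ _).1 i, (key _ _).1 i]; exact add_mul _ _ _)
    (fun r t u => eq_of_algebraMap_eq fun i => by
      rw [(key _ _).1 i, smul_eq_mul, map_mul, (key _ _).1 i, ← Algebra.smul_def]
      exact smul_mul_assoc r (t.1 i) _)
    (fun t u u' => eq_of_algebraMap_eq fun i => by
      rw [(key _ _).1 i, map_add, (key _ _).1 i, (key _ _).1 i]; exact mul_add _ _ _)
    (fun r t u => eq_of_algebraMap_eq fun i => by
      rw [(key _ _).1 i, smul_eq_mul, map_mul, (key _ _).1 i, ← Algebra.smul_def]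
      exact mul_smul_comm r (t.1 i) _)

lemma algebraMap_pair {d e : ℤ} (h : d + e = 0) (t : twistSections d x) (u : twistSections e x)
    (i : Fin (n + 1)) : algebraMap R Γ(Spec R, dom x i) (pair x h t u) = t.1 i * u.1 i :=
  (existsUnique_pair x h t u).choose_spec.1 i

/-- The homogeneous coordinate `X_k` as a section of `𝒪(1)`. -/
def coordSec (k : Fin (n + 1)) : twistSections 1 x :=
  ⟨fun i => coord x i k, fun i j => by
    rw [← coord_mul x i j k]; simp⟩

lemma tautCoord_eq_pair (t : twistSections (-1) x) (k : Fin (n + 1)) :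
    tautCoord x t k = pair x (neg_add_cancel 1) t (coordSec x k) :=
  eq_of_algebraMap_eq fun i => by rw [algebraMap_tautCoord, algebraMap_pair]; rfl

lemma pullTwist_coordSec (f : R ⟶ S) (x : Spec R ⟶ P n)
    (y : Spec S ⟶ P n) (h : Spec.map f ≫ x = y) (k : Fin (n + 1)) :
    pullTwist 1 f x y h (coordSec x k) = coordSec y k :=
  Subtype.ext (funext fun i => pull_coord f x y h i k)

lemma map_pair {d e : ℤ} (hd : d + e = 0) (f : R ⟶ S) (x : Spec R ⟶ P n)
    (y : Spec S ⟶ P n) (h : Spec.map f ≫ x = y) (t : twistSections d x) (u : twistSections e x) :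
    f.hom (pair x hd t u) = pair y hd (pullTwist d f x y h t) (pullTwist e f x y h u) :=
  eq_of_algebraMap_eq (x := y) fun i => by
    rw [algebraMap_pair, ← pull_algebraMap f x y h, algebraMap_pair, map_mul]
    rfl

lemma pair_comm {d e : ℤ} (h : d + e = 0) (h' : e + d = 0) (t : twistSections d x)
    (u : twistSections e x) : pair x h t u = pair x h' u t :=
  eq_of_algebraMap_eq fun i => by rw [algebraMap_pair, algebraMap_pair, mul_comm]

lemma mulSec_comm {d e f : ℤ} (h : d + e = f) (h' : e + d = f) (t : twistSections d x)
    (u : twistSections e x) : mulSec x h t u = mulSec x h' u t :=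
  Subtype.ext (funext fun _ => mul_comm _ _)

/-- On every chart both sides are the product of the three local functions. This swap identity
expresses that `𝒪(d)` has rank one, without localising. -/
lemma pair_smul' {d e : ℤ} (h : d + e = 0)
    (t : twistSections d x) (u : twistSections e x) (v : twistSections d x) :
    pair x h t u • v = pair x h v u • t :=
  Subtype.ext (funext fun i => by
    change pair x h t u • v.1 i = pair x h v u • t.1 i
    rw [Algebra.smul_def, algebraMap_pair, Algebra.smul_def, algebraMap_pair]
    ring)

/-- The basic open subset `D(g)` of `Spec R`. -/
def basic {R : CommRingCat.{0}} (g : R) : (Spec R).Opens := PrimeSpectrum.basicOpen g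

instance (g : R) : IsLocalization.Away g Γ(Spec R, basic g) := by
  delta basic
  infer_instance

lemma algebraMap_basicOpen_eq (g : R) (U : (Spec R).Opens) :
    (Spec R).basicOpen (algebraMap R Γ(Spec R, U) g) = U ⊓ basic g := by
  change (Spec R).basicOpen (((Spec R).presheaf.map (homOfLE le_top : U ⟶ ⊤).op).hom
    ((Scheme.ΓSpecIso R).inv.hom g)) = _
  rw [Scheme.basicOpen_res]
  congr 1
  exact basicOpen_eq_of_affine g

/-- The usual annihilation by a power of `g` on a quasi-compact open. Any `V` between `U ⊓ D(g)` and
`U` is admitted, which avoids transport between equal opens. -/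
lemma exists_pow_mul_eq_zero {U V : (Spec R).Opens} (hU : IsCompact U.1) {g : R}
    (s : Γ(Spec R, U)) (hV : V ≤ U) (h : U ⊓ basic g ≤ V) (hs : res hV s = 0) :
    ∃ m : ℕ, algebraMap R Γ(Spec R, U) (g ^ m) * s = 0 := by
  obtain ⟨m, hm⟩ := exists_pow_mul_eq_zero_of_res_basicOpen_eq_zero_of_isCompact (Spec R) hU s
    (algebraMap R Γ(Spec R, U) g) (by
      have : (Spec R).basicOpen (algebraMap R Γ(Spec R, U) g) ≤ V :=
        (algebraMap_basicOpen_eq g U).le.trans h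
      have e := congrArg (res this) hs
      rw [res_res, map_zero] at e
      exact e)
  exact ⟨m, by rw [map_pow, hm]⟩

/-- Over `D(g)` the section `1 / X_i` of `𝒪(-1)` exists, and a high multiple `g^m / X_i` extends to
all of `Spec R`: the functions `g^N X_j / X_i` lift to elements `r_j` of `R`, and after a further
factor `g^M` the relations `r_j = r_l X_j / X_l` hold on every chart. The local function on chart
`l` is then `g^M r_l`. -/
lemma exists_tautCoord_eq_pow {g : R} {i : Fin (n + 1)}
    (hg : basic g ≤ dom x i) :
    ∃ (m : ℕ) (t : twistSections (-1) x), tautCoord x t i = g ^ m := by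
  classical
  obtain ⟨⟨_, N, rfl⟩, hb⟩ := IsLocalization.exist_integer_multiples_of_finite (Submonoid.powers g)
    (S := Γ(Spec R, basic g)) fun j => res hg (coord x i j)
  choose r hr using hb
  replace hr (j) : algebraMap R Γ(Spec R, basic g) (r j) =
      algebraMap R _ (g ^ N) * res hg (coord x i j) := by
    rw [hr, Algebra.smul_def]
  have h₁ (l j) : ∃ m : ℕ, algebraMap R Γ(Spec R, dom x l) (g ^ m) *
      (algebraMap R _ (r j) - algebraMap R _ (r l) * coord x l j) = 0 := by
    refine exists_pow_mul_eq_zero (isCompact_dom x l) (V := dom x l ⊓ basic g) _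
      inf_le_left le_rfl ?_
    have e₁ (j) : algebraMap R Γ(Spec R, dom x l ⊓ basic g) (r j) =
        algebraMap R _ (g ^ N) * res (inf_le_right.trans hg) (coord x i j) := by
      have := congrArg (res (inf_le_right : dom x l ⊓ basic g ≤ _)) (hr j)
      rwa [map_mul, res_res] at this
    have e₂ := congrArg (res (le_inf (inf_le_right.trans hg) inf_le_left :
      dom x l ⊓ basic g ≤ dom x i ⊓ dom x l)) (coord_mul x i l j)
    rw [map_mul, res_res, res_res, res_res] at e₂
    rw [map_sub, map_mul, res_algebraMap, res_algebraMap, e₁, e₁, ← e₂]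
    ring
  have h₂ : ∃ m : ℕ, algebraMap R Γ(Spec R, (⊤ : (Spec R).Opens)) (g ^ m) *
      (algebraMap R _ (r i) - algebraMap R _ (g ^ N)) = 0 := by
    refine exists_pow_mul_eq_zero isCompact_univ (V := basic g) _
      le_top inf_le_right ?_
    rw [map_sub, res_algebraMap, res_algebraMap, hr, coord_self, map_one, mul_one, sub_self]
  choose m hm using h₁
  obtain ⟨m', hm'⟩ := h₂
  -- One exponent that dominates all the finitely many exponents found so far.
  set M := (∑ l, ∑ j, m l j) + m' with hM
  have hle (l j) : m l j ≤ M :=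
    (Finset.single_le_sum (f := fun j => m l j) (fun _ _ => Nat.zero_le _) (Finset.mem_univ j)).trans
      ((Finset.single_le_sum (f := fun l => ∑ j, m l j) (fun _ _ => Nat.zero_le _)
        (Finset.mem_univ l)).trans (Nat.le_add_right _ _))
  have h₃ (l j) : algebraMap R Γ(Spec R, dom x l) (g ^ M * r j) =
      algebraMap R _ (g ^ M * r l) * coord x l j := by
    have := congrArg (algebraMap R Γ(Spec R, dom x l) (g ^ (M - m l j)) * ·) (hm l j)
    simp only [mul_zero] at this
    rw [← mul_assoc, ← map_mul, ← pow_add, Nat.sub_add_cancel (hle l j)] at this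
    rw [map_mul, map_mul]
    linear_combination this
  have h₄ : g ^ M * r i = g ^ (M + N) := by
    refine eq_of_algebraMap_eq (x := x) fun l => ?_
    have := congrArg (fun z => res (le_top : dom x l ≤ ⊤) (algebraMap R Γ(Spec R, (⊤ : (Spec R).Opens))
      (g ^ (∑ l, ∑ j, m l j)) * z)) hm'
    simp only [mul_zero, map_zero] at this
    rw [← mul_assoc, ← map_mul, ← pow_add, map_mul, map_sub, res_algebraMap, res_algebraMap,
      res_algebraMap (U := dom x l)] at this
    rw [← hM] at this
    rw [map_mul, pow_add g M N, map_mul]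
    linear_combination this
  refine ⟨M + N, ⟨fun l => algebraMap R _ (g ^ M * r l), fun l j => ?_⟩, ?_⟩
  · have := congrArg (res (inf_le_right : dom x l ⊓ dom x j ≤ _)) (h₃ j l)
    rw [show (-1 : ℤ).toNat = 0 from rfl, show (- -1 : ℤ).toNat = 1 from rfl, pow_zero, one_mul,
      pow_one]
    exact this.trans ((map_mul _ _ _).trans (mul_comm _ _))
  · refine (eq_tautCoord fun l => ?_).symm
    rw [← h₄]
    exact h₃ l i

/-- The homogeneous coordinates generate: there are sections `s_k` of `𝒪(-1)` with
`∑ s_k X_k = 1`. -/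
lemma exists_frame : ∃ s : Fin (n + 1) → twistSections (-1) x, ∑ k, tautCoord x (s k) k = 1 := by
  let Φ : (Fin (n + 1) → twistSections (-1) x) →ₗ[R] R :=
    { toFun := fun s => ∑ k, tautCoord x (s k) k
      map_add' := fun s t => by simp [tautCoord_add, Finset.sum_add_distrib]
      map_smul' := fun r s => by simp [tautCoord_smul, Finset.mul_sum] }
  have hΦ (t : twistSections (-1) x) (k) : tautCoord x t k ∈ LinearMap.range Φ := by
    refine ⟨Pi.single k t, ?_⟩
    change ∑ j, tautCoord x ((Pi.single k t : Fin (n + 1) → twistSections (-1) x) j) j = _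
    rw [Finset.sum_eq_single k]
    · simp
    · intro j _ hj
      rw [Pi.single_eq_of_ne hj]
      simpa using tautCoord_smul x 0 0 j
    · simp
  suffices h : (LinearMap.range Φ : Ideal R) = ⊤ by
    have : (1 : R) ∈ LinearMap.range Φ := by rw [h]; trivial
    exact this
  -- The ideal generated by all products `t X_k` contains a power of every `g` for which `D(g)` lies
  -- in a chart. Such `D(g)` cover `Spec R`, so the radical of the ideal is everything.
  rw [← Ideal.radical_eq_top, ← top_le_iff]
  rw [← (PrimeSpectrum.iSup_basicOpen_eq_top_iff (R := R)
    (f := fun g : {g : R // ∃ i, basic g ≤ dom x i} => g.1)).1 ?_,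
    Ideal.span_le]
  · rintro _ ⟨⟨g, i, hg⟩, rfl⟩
    obtain ⟨m, t, ht⟩ := exists_tautCoord_eq_pow x hg
    exact ⟨m, ht ▸ hΦ t i⟩
  · rw [eq_top_iff]
    intro p _
    have hp : x.base p ∈ ⨆ i, chart n i := by
      rw [iSup_chart]
      trivial
    obtain ⟨i, hi⟩ := TopologicalSpace.Opens.mem_iSup.1 hp
    obtain ⟨_, ⟨⟨_, ⟨g, rfl⟩, rfl⟩, hpg, hg⟩⟩ :=
      TopologicalSpace.IsTopologicalBasis.exists_subset_of_mem_open
        (PrimeSpectrum.isBasis_basic_opens (R := R))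
        (show p ∈ ((dom x i).1 : Set (PrimeSpectrum R)) from hi) (dom x i).2
    exact TopologicalSpace.Opens.mem_iSup.2 ⟨⟨g, i, hg⟩, hpg⟩

end Twist

end Fano

namespace Fano

/-! ### Frames of modules -/

section Algebra

variable {R S M N : Type} [CommRing R] [CommRing S] [AddCommGroup M] [Module R M]
  [AddCommGroup N] [Module S N]

lemma finite_projective_of_frame {ι : Type} [Finite ι] (e : ι → M) (α : M →ₗ[R] (ι → R))
    (h : ∀ m, ∑ᶠ i, α m i • e i = m) : Module.Finite R M ∧ Module.Projective R M := by
  classical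
  have := Fintype.ofFinite ι
  simp only [finsum_eq_sum_of_fintype] at h
  have hs : Fintype.linearCombination R e ∘ₗ α = LinearMap.id := LinearMap.ext fun m => by
    simpa [Fintype.linearCombination_apply] using h m
  exact ⟨Module.Finite.of_surjective (Fintype.linearCombination R e)
    (LinearMap.surjective_of_comp_eq_id _ _ hs), Module.Projective.of_split _ _ hs⟩

/-- The dual basis `e`, `α` stays a dual basis over `S`, and so the extension of `ψ` can only be `n
↦ ∑ β_i(n) ψ(e_i)`. -/
lemma isBaseChangeMap_of_frame {f : R →+* S} (φ : M →ₛₗ[f] N) {ι : Type} [Fintype ι] (e : ι → M)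
    (α : ι → M → R) (β : ι → N →ₗ[S] S) (hα : ∀ m, ∑ i, α i m • e i = m)
    (hβ : ∀ n, ∑ i, β i n • φ (e i) = n) (hαβ : ∀ i m, β i (φ m) = f (α i m)) :
    OModule.IsBaseChangeMap f φ := by
  intro T _ _ ψ
  refine ⟨∑ i, (β i).smulRight (ψ (e i)), LinearMap.ext fun m => ?_, fun g hg =>
    LinearMap.ext fun n => ?_⟩
  · conv_rhs => rw [← hα m]
    simp [hαβ]
  · conv_lhs => rw [← hβ n]
    simp [← hg]

lemma IsBaseChangeMap.hom_ext {f : R →+* S} {φ : M →ₛₗ[f] N} (h : OModule.IsBaseChangeMap f φ)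
    {T : Type} [AddCommGroup T] [Module S T] {g g' : N →ₗ[S] T} (hg : ∀ m, g (φ m) = g' (φ m)) :
    g = g' :=
  (h T (g' ∘ₛₗ φ)).unique (LinearMap.ext hg) rfl

/-- Functionals extend along base changes. -/
lemma IsBaseChangeMap.exists_functional {f : R →+* S} {φ : M →ₛₗ[f] N}
    (h : OModule.IsBaseChangeMap f φ) (α : M →ₗ[R] R) :
    ∃ β : N →ₗ[S] S, ∀ m, β (φ m) = f (α m) := by
  let ψ : M →ₛₗ[f] S :=
    { toFun := fun m => f (α m)
      map_add' := by simp
      map_smul' := by simp }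
  obtain ⟨β, hβ, -⟩ := h S ψ
  exact ⟨β, fun m => congrArg (fun g => g m) hβ⟩

/-- Right exactness of base change, through universal properties: the extension `g` of `ψ ∘ b` to
`N` satisfies `g ∘ a' = 0`, because this can be tested on the image of `φ₁`; hence `g` descends
along `b'`. -/
lemma IsBaseChangeMap.coker {f : R →+* S} {φ : M →ₛₗ[f] N} {M₁ M₂ N₁ N₂ : Type}
    [AddCommGroup M₁] [Module R M₁] [AddCommGroup N₁] [Module S N₁]
    [AddCommGroup M₂] [Module R M₂] [AddCommGroup N₂] [Module S N₂]
    {φ₁ : M₁ →ₛₗ[f] N₁} {φ₂ : M₂ →ₛₗ[f] N₂}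
    (h₁ : OModule.IsBaseChangeMap f φ₁) (h : OModule.IsBaseChangeMap f φ)
    (a : M₁ →ₗ[R] M) (b : M →ₗ[R] M₂) (a' : N₁ →ₗ[S] N) (b' : N →ₗ[S] N₂)
    (hb : Function.Surjective b) (hb' : Function.Surjective b')
    (hab : ∀ m, b (a m) = 0) (hab' : ∀ n, b' n = 0 → ∃ m, a' m = n)
    (ha : ∀ m, a' (φ₁ m) = φ (a m)) (hbφ : ∀ m, b' (φ m) = φ₂ (b m)) :
    OModule.IsBaseChangeMap f φ₂ := by
  intro T _ _ ψ
  obtain ⟨g, hg, -⟩ := h T (ψ.comp b)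
  replace hg (m) : g (φ m) = ψ (b m) := congrArg (fun g => g m) hg
  have hga : g ∘ₗ a' = 0 := IsBaseChangeMap.hom_ext h₁ fun m => by simp [ha, hg, hab]
  have hker : LinearMap.ker b' ≤ LinearMap.ker g := fun n hn => by
    obtain ⟨m, rfl⟩ := hab' n hn
    exact congrArg (fun g => g m) hga
  let g' : N₂ →ₗ[S] T := ((LinearMap.ker b').liftQ g hker) ∘ₗ
    (b'.quotKerEquivOfSurjective hb').symm.toLinearMap
  have hg' (n) : g' (b' n) = g n := by
    change (LinearMap.ker b').liftQ g hker ((b'.quotKerEquivOfSurjective hb').symm (b' n)) = _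
    have : (b'.quotKerEquivOfSurjective hb').symm (b' n) = Submodule.Quotient.mk n :=
      (LinearEquiv.symm_apply_eq _).2 rfl
    rw [this]
    rfl
  refine ⟨g', LinearMap.ext fun m₂ => ?_, fun k hk => LinearMap.ext fun n₂ => ?_⟩
  · obtain ⟨m, rfl⟩ := hb m₂
    change g' (φ₂ (b m)) = ψ (b m)
    rw [← hbφ, hg', hg]
  · obtain ⟨n, rfl⟩ := hb' n₂
    rw [hg']
    refine congrArg (fun g => g n) (IsBaseChangeMap.hom_ext h (g := k ∘ₗ b') fun m => ?_)
    have := congrArg (fun g => g (b m)) hk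
    change k (φ₂ (b m)) = ψ (b m) at this
    rw [LinearMap.comp_apply, hbφ, this, hg]

/-- The universal property is applied to one factor at a time: to `φ₁` for each fixed `m`, and then
to `φ` with values in `Hom(N₁, T)`. -/
lemma IsBaseChangeMap.tensor {f : R →+* S} {φ : M →ₛₗ[f] N} {M₁ N₁ : Type}
    [AddCommGroup M₁] [Module R M₁] [AddCommGroup N₁] [Module S N₁] {φ₁ : M₁ →ₛₗ[f] N₁}
    (h : OModule.IsBaseChangeMap f φ) (h₁ : OModule.IsBaseChangeMap f φ₁) :
    OModule.IsBaseChangeMap f (TensorProduct.map φ φ₁ : M ⊗[R] M₁ →ₛₗ[f] N ⊗[S] N₁) := by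
  intro T _ _ ψ
  choose G hG hGu using fun m : M => h₁ T
    { toFun := fun m₁ => ψ (m ⊗ₜ m₁)
      map_add' := fun a b => by rw [TensorProduct.tmul_add, map_add]
      map_smul' := fun r a => by rw [TensorProduct.tmul_smul, LinearMap.map_smulₛₗ] }
  replace hG (m m₁) : G m (φ₁ m₁) = ψ (m ⊗ₜ m₁) := congrArg (fun g => g m₁) (hG m)
  obtain ⟨H, hH, -⟩ := h (N₁ →ₗ[S] T)
    { toFun := G
      map_add' := fun a b => IsBaseChangeMap.hom_ext h₁ fun m => by
        simp [hG, TensorProduct.add_tmul]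
      map_smul' := fun r a => IsBaseChangeMap.hom_ext h₁ fun m => by
        simp only [hG, LinearMap.smul_apply]
        rw [← TensorProduct.smul_tmul', LinearMap.map_smulₛₗ] }
  replace hH (m) : H (φ m) = G m := congrArg (fun g => g m) hH
  refine ⟨TensorProduct.lift H, ?_, fun k hk => ?_⟩
  · refine LinearMap.ext fun z => ?_
    induction z using TensorProduct.induction_on with
    | zero => simp
    | tmul a b => simp [hH, hG]
    | add a b ha hb => rw [map_add, map_add, ha, hb]
  · refine TensorProduct.ext (IsBaseChangeMap.hom_ext h fun m =>
      IsBaseChangeMap.hom_ext h₁ fun m₁ => ?_)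
    have := congrArg (fun g => g (m ⊗ₜ m₁)) hk
    simpa [hH, hG] using this

/-- Swapping identity and trace one characterise invertible modules among those with a frame. -/
lemma invertible_of_frame {ι : Type} [Fintype ι] (e : ι → M) (α : ι → M →ₗ[R] R)
    (hs : ∀ i m m', α i m • m' = α i m' • m) (h1 : ∑ i, α i (e i) = 1) : Module.Invertible R M := by
  have hm (m : M) : ∑ i, α i m • e i = m := by
    simp_rw [fun i => hs i m (e i), ← Finset.sum_smul, h1, one_smul]
  have hφ (φ : Module.Dual R M) (i m) : α i m • φ = φ m • α i := LinearMap.ext fun m' => by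
    have := congrArg φ (hs i m m')
    simp only [map_smul, smul_eq_mul] at this
    simp [this, mul_comm]
  -- So the contraction `M^∨ ⊗ M → R` is bijective, with inverse `r ↦ r ∑ α_i ⊗ e_i`; this is
  -- invertibility of `M`.
  have key (z : Module.Dual R M ⊗[R] M) : z = contractLeft R M z • ∑ i, α i ⊗ₜ[R] e i := by
    induction z using TensorProduct.induction_on with
    | zero => simp
    | tmul φ m =>
      conv_lhs => rw [← hm m]
      rw [TensorProduct.tmul_sum, Finset.smul_sum]
      refine Finset.sum_congr rfl fun i _ => ?_
      rw [TensorProduct.tmul_smul, TensorProduct.smul_tmul', hφ, contractLeft_apply,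
        TensorProduct.smul_tmul']
    | add a b ha hb => rw [map_add, add_smul, ← ha, ← hb]
  refine ⟨fun z w h => ?_, fun r => ⟨r • ∑ i, α i ⊗ₜ[R] e i, ?_⟩⟩
  · rw [key z, key w, h]
  · simp [h1]

lemma rankAtStalk_of_invertible [Module.Invertible R M] (p : PrimeSpectrum R) :
    Module.rankAtStalk M p = 1 := by
  have : Module.Free (Localization p.asIdeal.primeCompl)
    (LocalizedModule p.asIdeal.primeCompl M) := inferInstance
  exact Module.Invertible.finrank_eq_one _ _

lemma nonempty_equiv_of_rank_one [Module.Finite R M] [Module.Projective R M]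
    (h : ∀ p : PrimeSpectrum R, Module.rankAtStalk M p = 1) (P : Ideal R) [P.IsPrime] :
    Nonempty (LocalizedModule P.primeCompl M ≃ₗ[Localization P.primeCompl]
      Localization P.primeCompl) := by
  have : Module.Free (Localization P.primeCompl) (LocalizedModule P.primeCompl M) := by
    have : IsLocalRing (Localization P.primeCompl) :=
      inferInstanceAs (IsLocalRing (Localization.AtPrime P))
    exact Module.free_of_flat_of_isLocalRing
  exact ⟨LinearEquiv.ofFinrankEq _ _ ((h ⟨P, inferInstance⟩).trans (Module.finrank_self _).symm)⟩

/-- Locally `M` is free on one generator `v`, and for `m = a v`, `m' = b v` both sides equal `a b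
φ(v) v`. -/
lemma swap_of_rank_one [Module.Finite R M] [Module.Projective R M]
    (h : ∀ p : PrimeSpectrum R, Module.rankAtStalk M p = 1) (φ : M →ₗ[R] R) (m m' : M) :
    φ m • m' = φ m' • m := by
  refine Module.eq_of_localization_maximal (fun (P : Ideal R) _ => LocalizedModule P.primeCompl M)
    (fun (P : Ideal R) _ => LocalizedModule.mkLinearMap P.primeCompl M) _ _ fun P hP => ?_
  obtain ⟨E⟩ := nonempty_equiv_of_rank_one h P
  have hv (w) : ∃ c : Localization P.primeCompl, c • E.symm 1 = w :=
    ⟨E w, by rw [← map_smul, smul_eq_mul, mul_one, E.symm_apply_apply]⟩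
  let ψ := IsLocalizedModule.mapExtendScalars P.primeCompl
    (LocalizedModule.mkLinearMap P.primeCompl M)
    (Algebra.linearMap R (Localization P.primeCompl)) (Localization P.primeCompl) φ
  have hψ (m : M) : ψ (LocalizedModule.mkLinearMap P.primeCompl M m) =
      algebraMap R (Localization P.primeCompl) (φ m) :=
    IsLocalizedModule.map_apply _ _ _ _ _
  obtain ⟨a, ha⟩ := hv (LocalizedModule.mkLinearMap P.primeCompl M m)
  obtain ⟨b, hb⟩ := hv (LocalizedModule.mkLinearMap P.primeCompl M m')
  rw [map_smul, map_smul, ← algebraMap_smul (Localization P.primeCompl) (φ m),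
    ← algebraMap_smul (Localization P.primeCompl) (φ m'), ← hψ, ← hψ, ← ha, ← hb, map_smul,
    map_smul, smul_smul, smul_smul, smul_eq_mul, smul_eq_mul]
  congr 1
  ring

/-- Modules of rank one are faithful, since they are locally isomorphic to the ring. This is used to
see that the trace of a projection onto a line is `1`. -/
lemma eq_one_of_rank_one [Module.Finite R M] [Module.Projective R M]
    (h : ∀ p : PrimeSpectrum R, Module.rankAtStalk M p = 1) {c : R} (hc : ∀ m : M, c • m = m) :
    c = 1 := by
  rw [← sub_eq_zero]
  refine eq_zero_of_localization _ fun P hP => ?_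
  obtain ⟨E⟩ := nonempty_equiv_of_rank_one h P
  have h0 (w : LocalizedModule P.primeCompl M) : (c - 1) • w = 0 := by
    induction w using LocalizedModule.induction_on with
    | h m s => rw [LocalizedModule.smul'_mk, sub_smul, hc, one_smul, sub_self, LocalizedModule.zero_mk]
  have := congrArg E (h0 (E.symm 1))
  rw [← algebraMap_smul (Localization P.primeCompl), map_smul, E.apply_symm_apply, map_zero,
    smul_eq_mul, mul_one] at this
  exact this

end Algebra

/-! ### Locally free modules -/

namespace OModule

variable {X Y : Scheme.{0}}

/-- Locally free modules of finite rank (not necessarily of constant rank). -/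
structure IsLocFree (E : OModule X) : Prop where
  baseChange : ∀ {R S : CommRingCat.{0}} (f : R ⟶ S) (x : Spec R ⟶ X) (y : Spec S ⟶ X)
    (h : Spec.map f ≫ x = y), IsBaseChangeMap f.hom (E.map f x y h)
  finite : ∀ {R : CommRingCat.{0}} (x : Spec R ⟶ X), Module.Finite R (E.obj x)
  projective : ∀ {R : CommRingCat.{0}} (x : Spec R ⟶ X), Module.Projective R (E.obj x)

lemma IsVectorBundle.isLocFree {r : ℕ} {E : OModule X} (h : E.IsVectorBundle r) : E.IsLocFree :=
  ⟨h.1, h.2, h.3⟩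

lemma IsLocFree.pullback {E : OModule X} (h : E.IsLocFree) (g : Y ⟶ X) :
    (E.pullback g).IsLocFree :=
  ⟨fun f x y _ => h.1 f (x ≫ g) (y ≫ g) _, fun x => h.2 (x ≫ g), fun x => h.3 (x ≫ g)⟩

lemma IsLocFree.tensor {E F : OModule X} (hE : E.IsLocFree) (hF : F.IsLocFree) :
    (E.tensor F).IsLocFree :=
  ⟨fun f x y h => IsBaseChangeMap.tensor (hE.1 f x y h) (hF.1 f x y h),
    fun {R} x => by
      have := hE.2 x
      have := hF.2 x
      exact inferInstanceAs (Module.Finite R (E.obj x ⊗[R] F.obj x)),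
    fun {R} x => by
      have := hE.3 x
      have := hF.3 x
      exact inferInstanceAs (Module.Projective R (E.obj x ⊗[R] F.obj x))⟩

/-- A module is locally free if it has dual bases that are compatible with base change. -/
lemma IsLocFree.of_frame {E : OModule X}
    (h : ∀ {R : CommRingCat.{0}} (x : Spec R ⟶ X), ∃ (ι : Type) (_ : Fintype ι)
      (e : ι → E.obj x) (α : ι → E.obj x →ₗ[R] R), (∀ m, ∑ i, α i m • e i = m) ∧
      ∀ {S : CommRingCat.{0}} (f : R ⟶ S) (y : Spec S ⟶ X) (h : Spec.map f ≫ x = y),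
        ∃ β : ι → E.obj y →ₗ[S] S, (∀ n, ∑ i, β i n • E.map f x y h (e i) = n) ∧
          ∀ i m, β i (E.map f x y h m) = f.hom (α i m)) : E.IsLocFree := by
  refine ⟨fun f x y hxy => ?_, fun x => ?_, fun x => ?_⟩ <;>
    obtain ⟨ι, _, e, α, hα, hβ⟩ := h x
  · obtain ⟨β, hβ, hαβ⟩ := hβ f y hxy
    exact isBaseChangeMap_of_frame _ e (fun i => α i) β hα hβ hαβ
  · exact (finite_projective_of_frame e (LinearMap.pi α)
      (by simpa [finsum_eq_sum_of_fintype] using hα)).1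
  · exact (finite_projective_of_frame e (LinearMap.pi α)
      (by simpa [finsum_eq_sum_of_fintype] using hα)).2

lemma isLocFree_free (X : Scheme.{0}) (ι : Type) [Finite ι] : (free X ι).IsLocFree := by
  classical
  have := Fintype.ofFinite ι
  have key (R : Type) [CommRing R] (n : ι → R) : ∑ i, n i • (Pi.single i 1 : ι → R) = n := by
    ext j
    simp [Finset.sum_apply, Pi.single_apply]
  refine .of_frame fun {R} x => ⟨ι, inferInstance, fun i => (Pi.single i 1 : ι → R),
    fun i => (LinearMap.proj i : (ι → R) →ₗ[R] R), key R, fun {S} f y h =>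
      ⟨fun i => (LinearMap.proj i : (ι → S) →ₗ[S] S), fun n => ?_, fun i m => rfl⟩⟩
  refine Eq.trans (Finset.sum_congr rfl fun i _ => congrArg ((n i : S) • ·) ?_) (key S n)
  refine funext fun j => ?_
  change f.hom ((Pi.single i (1 : R) : ι → R) j) = (Pi.single i (1 : S) : ι → S) j
  rw [Pi.single_apply, Pi.single_apply, apply_ite f.hom, map_one, map_zero]

end OModule

/-! ### Invertibility of `𝒪(d)`. -/

section Twist

variable {n : ℕ} {R S : CommRingCat.{0}} (x : Spec R ⟶ P n)

lemma pair_mulSec {d d' e e' f f' : ℤ} (h₁ : d + d' = 0) (h₂ : e + e' = 0) (h : d + e = f)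
    (h' : d' + e' = f') (h0 : f + f' = 0) (p : twistSections d x) (q : twistSections d' x)
    (p' : twistSections e x) (q' : twistSections e' x) :
    pair x h0 (mulSec x h p p') (mulSec x h' q q') = pair x h₁ p q * pair x h₂ p' q' :=
  eq_of_algebraMap_eq fun i => by
    rw [algebraMap_pair, map_mul, algebraMap_pair, algebraMap_pair]
    exact mul_mul_mul_comm _ _ _ _

/-- The pairing `𝒪(d) ⊗ 𝒪(-d) → 𝒪` is surjective. -/
lemma exists_pair_eq_one (d : ℤ) : ∃ (ι : Type) (_ : Fintype ι) (p : ι → twistSections d x)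
    (q : ι → twistSections (-d) x), ∑ i, pair x (add_neg_cancel d) (p i) (q i) = 1 := by
  obtain ⟨s, hs⟩ := exists_frame x
  -- The degrees for which the pairing represents `1` are closed under addition, by multiplying two
  -- such sums. It remains to treat `0`, where the constant function `1` serves, and `±1`, where
  -- `exists_frame` does.
  have add (d e : ℤ) (hd : ∃ (ι : Type) (_ : Fintype ι) (p : ι → twistSections d x)
      (q : ι → twistSections (-d) x), ∑ i, pair x (add_neg_cancel d) (p i) (q i) = 1)
      (he : ∃ (ι : Type) (_ : Fintype ι) (p : ι → twistSections e x)
      (q : ι → twistSections (-e) x), ∑ i, pair x (add_neg_cancel e) (p i) (q i) = 1) :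
      ∃ (ι : Type) (_ : Fintype ι) (p : ι → twistSections (d + e) x)
      (q : ι → twistSections (-(d + e)) x),
        ∑ i, pair x (add_neg_cancel (d + e)) (p i) (q i) = 1 := by
    obtain ⟨ι, _, p, q, h⟩ := hd
    obtain ⟨κ, _, p', q', h'⟩ := he
    refine ⟨ι × κ, inferInstance, fun i => mulSec x rfl (p i.1) (p' i.2),
      fun i => mulSec x (neg_add d e).symm (q i.1) (q' i.2), ?_⟩
    simp_rw [pair_mulSec x (add_neg_cancel d) (add_neg_cancel e)]
    rw [Fintype.sum_prod_type]
    exact (Fintype.sum_mul_sum _ _).symm.trans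
      ((congrArg₂ (· * ·) h h').trans (one_mul 1))
  induction d using Int.induction_on with
  | zero =>
    let u : twistSections 0 x := ⟨fun _ => 1, fun i j => by simp⟩
    refine ⟨Unit, inferInstance, fun _ => u, fun _ => u, ?_⟩
    rw [Fintype.sum_unique]
    exact eq_of_algebraMap_eq (x := x) fun i => by
      rw [algebraMap_pair, map_one]
      exact one_mul _
  | succ d hd =>
    refine add d 1 hd ⟨_, inferInstance, coordSec x, s, ?_⟩
    rw [← hs]
    exact Finset.sum_congr rfl fun k _ => by
      rw [tautCoord_eq_pair, pair_comm]
  | pred d hd =>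
    refine add (-d) (-1) hd ⟨_, inferInstance, s, coordSec x, ?_⟩
    rw [← hs]
    exact Finset.sum_congr rfl fun k _ => (tautCoord_eq_pair x _ _).symm

instance (d : ℤ) : Module.Invertible R (twistSections d x) := by
  obtain ⟨ι, _, p, q, h⟩ := exists_pair_eq_one x d
  exact invertible_of_frame p (fun i => (pair x (add_neg_cancel d)).flip (q i))
    (fun i t u => pair_smul' x (add_neg_cancel d) _ _ _) h

/-- Sections `p_i` of `𝒪(d)` and the functionals given by pairing with sections `q_i` of `𝒪(-d)`,
with `∑ p_i q_i = 1`, form a dual basis. The relation survives pull back, so the dual basis is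
compatible with base change. -/
lemma isLocFree_O (n : ℕ) (d : ℤ) : (O n d).IsLocFree := by
  refine .of_frame fun {R} x => ?_
  obtain ⟨ι, _, p, q, h⟩ := exists_pair_eq_one x d
  have key {R : CommRingCat.{0}} (x : Spec R ⟶ P n) (p : ι → twistSections d x)
      (q : ι → twistSections (-d) x) (h : ∑ i, pair x (add_neg_cancel d) (p i) (q i) = 1)
      (m : twistSections d x) : ∑ i, pair x (add_neg_cancel d) m (q i) • p i = m := by
    rw [Finset.sum_congr rfl fun i _ => pair_smul' x _ m (q i) (p i), ← Finset.sum_smul, h,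
      one_smul]
  refine ⟨ι, inferInstance, p, fun i => (pair x (add_neg_cancel d)).flip (q i), key x p q h,
    fun f y hxy => ⟨fun i => (pair y (add_neg_cancel d)).flip (pullTwist (-d) f x y hxy (q i)),
      key y _ _ ?_, fun i m => (map_pair (add_neg_cancel d) f x y hxy m (q i)).symm⟩⟩
  rw [← map_one f.hom, ← h, map_sum]
  exact Finset.sum_congr rfl fun i _ => (map_pair (add_neg_cancel d) f x y hxy _ _).symm

end Twist

end Fano

namespace Fano

/-! ### Exact sequences -/

/-- A row and a column that cross induce an exact column of cokernels. -/
lemma exact_of_cross {R A B C B' D G : Type} [CommRing R] [AddCommGroup A] [AddCommGroup B]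
    [AddCommGroup C] [AddCommGroup B'] [AddCommGroup D] [AddCommGroup G] [Module R A] [Module R B]
    [Module R C] [Module R B'] [Module R D] [Module R G] {a : A →ₗ[R] B} {b : B →ₗ[R] C}
    {c : B →ₗ[R] B'} {d : B' →ₗ[R] D} {p : B' →ₗ[R] G} {i : C →ₗ[R] G} {j : G →ₗ[R] D}
    (hab : Function.Exact a b) (hb : Function.Surjective b) (hc : Function.Injective c)
    (hcd : Function.Exact c d) (hd : Function.Surjective d)
    (hp : Function.Exact (c ∘ₗ a) p) (hp' : Function.Surjective p)
    (hi : ∀ y, p (c y) = i (b y)) (hj : ∀ y, j (p y) = d y) :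
    Function.Injective i ∧ Function.Exact i j ∧ Function.Surjective j := by
  refine ⟨(injective_iff_map_eq_zero i).2 fun z hz => ?_, fun g => ⟨fun hg => ?_, ?_⟩, fun z => ?_⟩
  · obtain ⟨y, rfl⟩ := hb z
    obtain ⟨w, hw⟩ := (hp _).1 ((hi y).trans hz)
    rw [← hc hw, hab.apply_apply_eq_zero]
  · obtain ⟨y, rfl⟩ := hp' g
    obtain ⟨w, rfl⟩ := (hcd _).1 ((hj y).symm.trans hg)
    exact ⟨b w, (hi w).symm⟩
  · rintro ⟨z, rfl⟩
    obtain ⟨y, rfl⟩ := hb z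
    rw [← hi, hj, hcd.apply_apply_eq_zero]
  · obtain ⟨y, rfl⟩ := hd z
    exact ⟨p y, hj y⟩

namespace OModule

variable {X : Scheme.{0}} {E F G H : OModule X}

lemma congr_app {φ ψ : E ⟶ F} (h : φ = ψ) {R : CommRingCat.{0}} (x : Spec R ⟶ X) (m : E.obj x) :
    φ.app x m = ψ.app x m := by rw [h]

lemma hom_ext {φ ψ : E ⟶ F}
    (h : ∀ {R : CommRingCat.{0}} (x : Spec R ⟶ X) (m : E.obj x), φ.app x m = ψ.app x m) : φ = ψ :=
  Hom.ext (funext fun _ => funext fun x => LinearMap.ext fun m => h x m)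

lemma hom_ext_of_surjective {φ : E ⟶ F}
    (hφ : ∀ {R : CommRingCat.{0}} (x : Spec R ⟶ X), Function.Surjective (φ.app x)) {ψ χ : F ⟶ G}
    (h : φ ≫ ψ = φ ≫ χ) : ψ = χ :=
  hom_ext fun x m => by
    obtain ⟨m, rfl⟩ := hφ x m
    exact congr_app h x m

/-- A homomorphism that vanishes on the kernel of a surjection factors through it. -/
def descApp {φ : E ⟶ F} {ψ : F ⟶ G} (h : IsShortExact φ ψ) (χ : F ⟶ H)
    (h0 : ∀ {R : CommRingCat.{0}} (x : Spec R ⟶ X) (m : E.obj x), χ.app x (φ.app x m) = 0)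
    {R : CommRingCat.{0}} (x : Spec R ⟶ X) : G.obj x →ₗ[R] H.obj x :=
  (LinearMap.ker (ψ.app x)).liftQ (χ.app x) (fun m hm => by
      obtain ⟨e, rfl⟩ := ((h x).2.1 m).1 hm
      exact h0 x e) ∘ₗ
    ((ψ.app x).quotKerEquivOfSurjective (h x).2.2).symm.toLinearMap

lemma descApp_apply {φ : E ⟶ F} {ψ : F ⟶ G} (h : IsShortExact φ ψ) (χ : F ⟶ H)
    (h0 : ∀ {R : CommRingCat.{0}} (x : Spec R ⟶ X) (m : E.obj x), χ.app x (φ.app x m) = 0)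
    {R : CommRingCat.{0}} (x : Spec R ⟶ X) (m : F.obj x) :
    descApp h χ h0 x (ψ.app x m) = χ.app x m := by
  have : ((ψ.app x).quotKerEquivOfSurjective (h x).2.2).symm (ψ.app x m) =
      Submodule.Quotient.mk m := (LinearEquiv.symm_apply_eq _).2 rfl
  exact (congrArg (Submodule.liftQ (LinearMap.ker (ψ.app x)) (χ.app x) fun m hm => by
    obtain ⟨e, rfl⟩ := ((h x).2.1 m).1 hm
    exact h0 x e) this :)

/-- The universal property of the cokernel. -/
def desc {φ : E ⟶ F} {ψ : F ⟶ G} (h : IsShortExact φ ψ) (χ : F ⟶ H)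
    (h0 : ∀ {R : CommRingCat.{0}} (x : Spec R ⟶ X) (m : E.obj x), χ.app x (φ.app x m) = 0) :
    G ⟶ H where
  app x := descApp h χ h0 x
  naturality f x y hxy m := by
    obtain ⟨m, rfl⟩ := (h x).2.2 m
    rw [descApp_apply, ψ.naturality, descApp_apply, χ.naturality]

lemma comp_desc {φ : E ⟶ F} {ψ : F ⟶ G} (h : IsShortExact φ ψ) (χ : F ⟶ H)
    (h0 : ∀ {R : CommRingCat.{0}} (x : Spec R ⟶ X) (m : E.obj x), χ.app x (φ.app x m) = 0) :
    ψ ≫ desc h χ h0 = χ :=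
  hom_ext fun x m => descApp_apply h χ h0 x m

lemma IsLocFree.flat (h : E.IsLocFree) {R : CommRingCat.{0}} (x : Spec R ⟶ X) :
    Module.Flat R (E.obj x) :=
  have := h.3 x
  inferInstance

lemma isShortExact_coker {φ : E ⟶ F}
    (h : ∀ {R : CommRingCat.{0}} (x : Spec R ⟶ X), Function.Injective (φ.app x)) :
    IsShortExact φ (cokerπ φ) := fun x =>
  ⟨h x, LinearMap.exact_map_mkQ_range _, Submodule.mkQ_surjective _⟩

lemma IsShortExact.exact_of_cross {A B C B' D G : OModule X} {a : A ⟶ B} {b : B ⟶ C}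
    {c : B ⟶ B'} {d : B' ⟶ D} {p : B' ⟶ G} {i : C ⟶ G} {j : G ⟶ D} (h₁ : IsShortExact a b)
    (h₂ : IsShortExact c d) (h₃ : IsShortExact (a ≫ c) p) (hi : c ≫ p = b ≫ i) (hj : p ≫ j = d) :
    IsShortExact i j := fun x =>
  Fano.exact_of_cross (h₁ x).2.1 (h₁ x).2.2 (h₂ x).1 (h₂ x).2.1 (h₂ x).2.2 (h₃ x).2.1 (h₃ x).2.2
    (fun y => congr_app hi x y) (fun y => congr_app hj x y)

end OModule

lemma lTensor_shortExact {R M A B C : Type} [CommRing R] [AddCommGroup M] [AddCommGroup A]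
    [AddCommGroup B] [AddCommGroup C] [Module R M] [Module R A] [Module R B] [Module R C]
    (hM : Module.Flat R M) {φ : A →ₗ[R] B} {ψ : B →ₗ[R] C}
    (h : Function.Injective φ ∧ Function.Exact φ ψ ∧ Function.Surjective ψ) :
    Function.Injective (φ.lTensor M) ∧ Function.Exact (φ.lTensor M) (ψ.lTensor M) ∧
      Function.Surjective (ψ.lTensor M) :=
  ⟨Module.Flat.lTensor_preserves_injective_linearMap _ h.1, lTensor_exact _ h.2.1 h.2.2,
    LinearMap.lTensor_surjective _ h.2.2⟩

lemma rTensor_shortExact {R M A B C : Type} [CommRing R] [AddCommGroup M] [AddCommGroup A]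
    [AddCommGroup B] [AddCommGroup C] [Module R M] [Module R A] [Module R B] [Module R C]
    (hM : Module.Flat R M) {φ : A →ₗ[R] B} {ψ : B →ₗ[R] C}
    (h : Function.Injective φ ∧ Function.Exact φ ψ ∧ Function.Surjective ψ) :
    Function.Injective (φ.rTensor M) ∧ Function.Exact (φ.rTensor M) (ψ.rTensor M) ∧
      Function.Surjective (ψ.rTensor M) :=
  ⟨Module.Flat.rTensor_preserves_injective_linearMap _ h.1, rTensor_exact _ h.2.1 h.2.2,
    LinearMap.rTensor_surjective _ h.2.2⟩

lemma isShortExact_extMap_left {E : OModule (P 1)} (hE : E.IsLocFree) {F G H : OModule (P 2)}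
    {φ : F ⟶ G} {ψ : G ⟶ H} (h : OModule.IsShortExact φ ψ) :
    OModule.IsShortExact (extMap (𝟙 E) φ) (extMap (𝟙 E) ψ) := fun x =>
  lTensor_shortExact (hE.flat (x ≫ P12.pr₁)) (h (x ≫ P12.pr₂))

lemma isShortExact_extMap_right {E : OModule (P 2)} (hE : E.IsLocFree) {F G H : OModule (P 1)}
    {φ : F ⟶ G} {ψ : G ⟶ H} (h : OModule.IsShortExact φ ψ) :
    OModule.IsShortExact (extMap φ (𝟙 E)) (extMap ψ (𝟙 E)) := fun x =>
  rTensor_shortExact (hE.flat (x ≫ P12.pr₂)) (h (x ≫ P12.pr₁))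

/-! ### Dual bases of `𝒪(-1)` and `𝒪(-2)` made from a frame. -/

section Frames

variable {n : ℕ} {R : CommRingCat.{0}} {x : Spec R ⟶ P n} {s : Fin (n + 1) → twistSections (-1) x}

lemma tautCoord_swap (t u : twistSections (-1) x) (k : Fin (n + 1)) :
    tautCoord x t k • u = tautCoord x u k • t := by
  rw [tautCoord_eq_pair, tautCoord_eq_pair, pair_smul']

lemma sum_tautCoord_smul (hs : ∑ k, tautCoord x (s k) k = 1) (t : twistSections (-1) x) :
    ∑ k, tautCoord x t k • s k = t := by
  rw [Finset.sum_congr rfl fun k _ => tautCoord_swap t (s k) k, ← Finset.sum_smul, hs, one_smul]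

lemma tautCoord_mul_swap (t u : twistSections (-1) x) (k l : Fin (n + 1)) :
    tautCoord x t k * tautCoord x u l = tautCoord x u k * tautCoord x t l := by
  rw [← tautCoord_smul, tautCoord_swap, tautCoord_smul]

lemma taut_injective (n : ℕ) {R : CommRingCat.{0}} (x : Spec R ⟶ P n) :
    Function.Injective ((taut n).app x) := fun (t : twistSections (-1) x)
    (u : twistSections (-1) x) h => by
  obtain ⟨s, hs⟩ := exists_frame x
  have (k : Fin (n + 1)) : tautCoord x t k = tautCoord x u k := congrFun h k
  rw [← sum_tautCoord_smul hs t, ← sum_tautCoord_smul hs u]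
  exact Finset.sum_congr rfl fun k _ => by rw [this]

/-- Multiplication by `X_k` on sections of `𝒪(-2)`. -/
def mulXMap (x : Spec R ⟶ P n) (k : Fin (n + 1)) : twistSections (-2) x →ₗ[R] twistSections (-1) x :=
  (mulX n (by norm_num : (-1 : ℤ) = -2 + 1) k).app x

/-- The product of two sections of `𝒪(-1)`. -/
def mulTaut (x : Spec R ⟶ P n) :
    twistSections (-1) x →ₗ[R] twistSections (-1) x →ₗ[R] twistSections (-2) x :=
  mulSec x (by norm_num)

lemma mulTaut_comm (t u : twistSections (-1) x) : mulTaut x t u = mulTaut x u t :=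
  mulSec_comm x _ _ _ _

lemma mulXMap_mulTaut (t u : twistSections (-1) x) (k : Fin (n + 1)) :
    mulXMap x k (mulTaut x t u) = tautCoord x u k • t :=
  Subtype.ext (funext fun i => by
    change t.1 i * u.1 i * coord x i k = tautCoord x u k • t.1 i
    rw [Algebra.smul_def, algebraMap_tautCoord]
    ring)

/-- Multiply `t` by `∑ s_k X_k = 1`. It follows that products of two sections of `𝒪(-1)` span
`𝒪(-2)`, so that maps out of `𝒪(-2)` can be checked on products. -/
lemma sum_mulTaut_mulXMap (hs : ∑ k, tautCoord x (s k) k = 1) (t : twistSections (-2) x) :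
    ∑ k, mulTaut x (mulXMap x k t) (s k) = t := by
  refine Eq.trans (Finset.sum_congr rfl fun k _ => ?_)
    ((Finset.sum_smul (f := fun k => tautCoord x (s k) k) (x := t)).symm.trans
      (by rw [hs, one_smul]))
  refine Subtype.ext (funext fun i => ?_)
  change t.1 i * coord x i k * (s k).1 i = tautCoord x (s k) k • t.1 i
  rw [Algebra.smul_def, algebraMap_tautCoord]
  ring

lemma mulXMap_ext {t u : twistSections (-2) x} (h : ∀ k, mulXMap x k t = mulXMap x k u) :
    t = u := by
  obtain ⟨s, hs⟩ := exists_frame x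
  rw [← sum_mulTaut_mulXMap hs t, ← sum_mulTaut_mulXMap hs u]
  exact Finset.sum_congr rfl fun k _ => by rw [h]

end Frames

/-- A frame gives explicit preimages. If `v_1 X_0 = v_0 X_1`, then `v` is the image of `∑ v_k s_k`,
because `v_k (s_k X_l) = v_l (s_k X_k)`. A section `u` of `𝒪(1)` is the image of `(-u s_1, u s_0)`,
because `u (s_0 X_0 + s_1 X_1) = u`. -/
theorem isShortExact_euler_line : OModule.IsShortExact (taut 1) toO1 := fun {R} x => by
  obtain ⟨s, hs⟩ := exists_frame x
  refine ⟨taut_injective 1 x, fun v => ⟨fun hv => ?_, ?_⟩,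
    fun (u : twistSections 1 x) => ?_⟩
  · have h (k l : Fin 2) : v k • coordSec x l = v l • coordSec x k := by
      have h01 : v 1 • coordSec x 0 = v 0 • coordSec x 1 := sub_eq_zero.1 hv
      fin_cases k <;> fin_cases l
      · rfl
      · exact h01.symm
      · exact h01
      · rfl
    refine ⟨∑ k, (v k : R) • s k, funext fun l => ?_⟩
    change tautCoord x (∑ k, (v k : R) • s k) l = v l
    have hk (k) : v k * tautCoord x (s k) l = v l * tautCoord x (s k) k := by
      rw [tautCoord_eq_pair, tautCoord_eq_pair, ← smul_eq_mul, ← smul_eq_mul, ← map_smul,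
        ← map_smul, h]
    rw [tautCoord_eq_pair, map_sum, LinearMap.sum_apply]
    simp_rw [map_smul, LinearMap.smul_apply, ← tautCoord_eq_pair, smul_eq_mul, hk]
    rw [← Finset.mul_sum, hs, mul_one]
  · rintro ⟨t : twistSections (-1) x, rfl⟩
    refine Subtype.ext (funext fun i => ?_)
    change tautCoord x t 1 • coord x i 0 - tautCoord x t 0 • coord x i 1 = 0
    rw [Algebra.smul_def, Algebra.smul_def, algebraMap_tautCoord, algebraMap_tautCoord]
    ring
  · refine ⟨![-pair x (by norm_num) u (s 1), pair x (by norm_num) u (s 0)], ?_⟩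
    refine Subtype.ext (funext fun i => ?_)
    change pair x _ u (s 0) • coord x i 0 - (-pair x _ u (s 1)) • coord x i 1 = u.1 i
    have h1 : algebraMap R Γ(Spec R, dom x i) (tautCoord x (s 0) 0 + tautCoord x (s 1) 1) = 1 := by
      rw [← Fin.sum_univ_two (fun k => tautCoord x (s k) k), hs, map_one]
    rw [map_add, algebraMap_tautCoord, algebraMap_tautCoord] at h1
    rw [neg_smul, Algebra.smul_def, Algebra.smul_def, algebraMap_pair, algebraMap_pair]
    linear_combination u.1 i * h1

end Fano

namespace Fano

/-! ### Symmetric squares -/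

section Sym2

open OModule (sym2Rel)

variable {R L M M' : Type} [CommRing R] [AddCommGroup L] [AddCommGroup M] [AddCommGroup M']
  [Module R L] [Module R M] [Module R M']

/-- The product `a · b` in the symmetric square. -/
def symMk (R : Type) {M : Type} [CommRing R] [AddCommGroup M] [Module R M] (a b : M) :
    (M ⊗[R] M) ⧸ sym2Rel R M := (sym2Rel R M).mkQ (a ⊗ₜ b)

lemma symMk_comm (a b : M) : symMk R a b = symMk R b a :=
  (Submodule.Quotient.eq _).2 (Submodule.subset_span ⟨(a, b), rfl⟩)

/-- The universal property of the symmetric square. -/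
def symLift (g : M →ₗ[R] M →ₗ[R] L) (hg : ∀ a b, g a b = g b a) :
    ((M ⊗[R] M) ⧸ sym2Rel R M) →ₗ[R] L :=
  (sym2Rel R M).liftQ (TensorProduct.lift g) (Submodule.span_le.2 (by
    rintro _ ⟨⟨a, b⟩, rfl⟩
    simp [hg a b]))

lemma symLift_mk (g : M →ₗ[R] M →ₗ[R] L) (hg : ∀ a b, g a b = g b a) (a b : M) :
    symLift g hg (symMk R a b) = g a b := rfl

lemma sym_induction {p : ((M ⊗[R] M) ⧸ sym2Rel R M) → Prop} (z : (M ⊗[R] M) ⧸ sym2Rel R M)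
    (h0 : p 0) (hm : ∀ a b, p (symMk R a b)) (ha : ∀ z w, p z → p w → p (z + w)) : p z := by
  obtain ⟨z, rfl⟩ := Submodule.mkQ_surjective _ z
  induction z using TensorProduct.induction_on with
  | zero => simpa using h0
  | tmul a b => exact hm a b
  | add a b h h' => rw [map_add]; exact ha _ _ h h'

/-- `t ⊗ v ↦ ι(t) · v`. -/
def symMulLeft (ι : L →ₗ[R] M) : L ⊗[R] M →ₗ[R] (M ⊗[R] M) ⧸ sym2Rel R M :=
  (sym2Rel R M).mkQ ∘ₗ TensorProduct.map ι LinearMap.id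

lemma symMulLeft_tmul (ι : L →ₗ[R] M) (t : L) (v : M) :
    symMulLeft ι (t ⊗ₜ v) = symMk R (ι t) v := rfl

/-- The kernel of `π ⊗ π` is the sum of the images of `L ⊗ M` and `M ⊗ L`, and these two images
coincide in the symmetric square. -/
lemma exact_symMulLeft {ι : L →ₗ[R] M} {π : M →ₗ[R] M'} (h : Function.Exact ι π)
    (hπ : Function.Surjective π) :
    Function.Exact (symMulLeft ι) (Submodule.mapQ (sym2Rel R M) (sym2Rel R M')
      (TensorProduct.map π π) (OModule.sym2Rel_le π)) := by
  intro z
  constructor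
  · intro hz
    obtain ⟨y, rfl⟩ := Submodule.mkQ_surjective _ z
    have hz' : TensorProduct.map π π y ∈ sym2Rel R M' := (Submodule.Quotient.mk_eq_zero _).1 hz
    -- The relations of `Sym² M'` lift to relations of `Sym² M`. Subtracting such a lift moves the
    -- representative `y` into the kernel of `π ⊗ π`.
    have hle : sym2Rel R M' ≤ (sym2Rel R M).map (TensorProduct.map π π) := by
      refine Submodule.span_le.2 ?_
      rintro _ ⟨⟨a, b⟩, rfl⟩
      obtain ⟨a, rfl⟩ := hπ a
      obtain ⟨b, rfl⟩ := hπ b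
      exact ⟨a ⊗ₜ b - b ⊗ₜ a, Submodule.subset_span ⟨(a, b), rfl⟩, by simp⟩
    obtain ⟨r, hr, hry⟩ := hle hz'
    have hk : y - r ∈ LinearMap.ker (TensorProduct.map π π) := by
      rw [LinearMap.mem_ker, map_sub, hry, sub_self]
    rw [TensorProduct.map_ker h hπ h hπ] at hk
    have hmk : (sym2Rel R M).mkQ y = (sym2Rel R M).mkQ (y - r) := by
      rw [map_sub, show (sym2Rel R M).mkQ r = 0 from (Submodule.Quotient.mk_eq_zero _).2 hr, sub_zero]
    rw [hmk]
    suffices hs : LinearMap.range (LinearMap.lTensor M ι) ⊔ LinearMap.range (LinearMap.rTensor M ι) ≤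
      (LinearMap.range (symMulLeft ι)).comap (sym2Rel R M).mkQ from hs hk
    refine sup_le ?_ ?_
    · rintro _ ⟨w, rfl⟩
      induction w using TensorProduct.induction_on with
      | zero => simp
      | tmul a b => exact ⟨b ⊗ₜ a, symMk_comm _ _⟩
      | add a b ha hb => rw [map_add]; exact add_mem ha hb
    · rintro _ ⟨w, rfl⟩
      exact ⟨w, rfl⟩
  · rintro ⟨w, rfl⟩
    induction w using TensorProduct.induction_on with
    | zero => simp
    | tmul a b =>
      change (sym2Rel R M').mkQ (π (ι a) ⊗ₜ π b) = 0
      rw [h.apply_apply_eq_zero, TensorProduct.zero_tmul, map_zero]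
    | add a b ha hb => rw [map_add, map_add, ha, hb, add_zero]

/-- The polarisation `D : a · b ↦ ρ(a) ⊗ b + ρ(b) ⊗ a` is almost a retraction: by `hs`, its
composite with the multiplication is `1 + B` for the idempotent `B = 1 ⊗ ιρ`. If `u + B u = 0`,
applying `B` gives `2 B u = 0`, hence `u = 0`. -/
lemma symMulLeft_injective {ι : L →ₗ[R] M} {ρ : M →ₗ[R] L} (h : ∀ t, ρ (ι t) = t)
    (hs : ∀ t u, t ⊗ₜ[R] ι u = u ⊗ₜ[R] ι t) (h2 : IsUnit (2 : R)) :
    Function.Injective (symMulLeft ι) := by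
  let D : ((M ⊗[R] M) ⧸ sym2Rel R M) →ₗ[R] L ⊗[R] M :=
    symLift (TensorProduct.mk R L M ∘ₗ ρ + (TensorProduct.mk R L M ∘ₗ ρ).flip)
      fun a b => add_comm (ρ a ⊗ₜ[R] b) (ρ b ⊗ₜ[R] a)
  let B : L ⊗[R] M →ₗ[R] L ⊗[R] M := LinearMap.lTensor L (ι ∘ₗ ρ)
  have hD (u) : D (symMulLeft ι u) = u + B u := by
    induction u using TensorProduct.induction_on with
    | zero => simp
    | tmul t v =>
      rw [symMulLeft_tmul]
      change ρ (ι t) ⊗ₜ v + ρ v ⊗ₜ ι t = t ⊗ₜ v + t ⊗ₜ ι (ρ v)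
      rw [h, hs]
    | add a b ha hb => rw [map_add, map_add, ha, hb, map_add]; abel
  have hB (u) : B (B u) = B u := by
    rw [← LinearMap.comp_apply, ← LinearMap.lTensor_comp]
    congr 2
    ext v
    simp [h]
  refine (injective_iff_map_eq_zero _).2 fun u hu => ?_
  have h1 : u + B u = 0 := by rw [← hD, hu, map_zero]
  have h3 : (2 : R) • B u = 0 := by
    rw [two_smul]
    simpa [hB] using congrArg B h1
  have h4 : B u = 0 := by
    obtain ⟨c, hc⟩ := h2
    rw [← hc] at h3
    exact (smul_eq_zero_iff_eq c).1 h3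
  rwa [h4, add_zero] at h1

/-- The monomials `e_i e_j` of degree two in three variables. -/
def symMonomial (R : Type) [CommRing R] (k : Fin 6) :
    ((Fin 3 → R) ⊗[R] (Fin 3 → R)) ⧸ sym2Rel R (Fin 3 → R) :=
  symMk R (Pi.single (![0, 1, 2, 0, 0, 1] k) 1) (Pi.single (![0, 1, 2, 1, 2, 2] k) 1)

/-- Coordinates on the symmetric square of `R^3`. -/
def symCoord (R : Type) [CommRing R] :
    (((Fin 3 → R) ⊗[R] (Fin 3 → R)) ⧸ sym2Rel R (Fin 3 → R)) →ₗ[R] (Fin 6 → R) :=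
  symLift (LinearMap.mk₂ R (fun v w => ![v 0 * w 0, v 1 * w 1, v 2 * w 2, v 0 * w 1 + v 1 * w 0,
      v 0 * w 2 + v 2 * w 0, v 1 * w 2 + v 2 * w 1])
    (fun a b c => by ext k; fin_cases k <;> simp <;> ring)
    (fun r a b => by ext k; fin_cases k <;> simp <;> ring)
    (fun a b c => by ext k; fin_cases k <;> simp <;> ring)
    (fun r a b => by ext k; fin_cases k <;> simp <;> ring))
    (fun a b => by ext k; fin_cases k <;> simp <;> ring)

lemma symCoord_mk (v w : Fin 3 → R) : symCoord R (symMk R v w) =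
    ![v 0 * w 0, v 1 * w 1, v 2 * w 2, v 0 * w 1 + v 1 * w 0,
      v 0 * w 2 + v 2 * w 0, v 1 * w 2 + v 2 * w 1] := rfl

lemma sum_symCoord_smul (z : ((Fin 3 → R) ⊗[R] (Fin 3 → R)) ⧸ sym2Rel R (Fin 3 → R)) :
    ∑ k, symCoord R z k • symMonomial R k = z := by
  suffices h : (∑ k, (LinearMap.proj k ∘ₗ symCoord R).smulRight (symMonomial R k)) ∘ₗ
      (sym2Rel R (Fin 3 → R)).mkQ = (sym2Rel R (Fin 3 → R)).mkQ by
    obtain ⟨z, rfl⟩ := Submodule.mkQ_surjective _ z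
    simpa using congrArg (fun g => g z) h
  refine TensorProduct.ext ((Pi.basisFun R (Fin 3)).ext fun i => (Pi.basisFun R (Fin 3)).ext
    fun j => ?_)
  change (∑ k, (LinearMap.proj k ∘ₗ symCoord R).smulRight (symMonomial R k))
    (symMk R (Pi.basisFun R (Fin 3) i) (Pi.basisFun R (Fin 3) j)) =
    symMk R (Pi.basisFun R (Fin 3) i) (Pi.basisFun R (Fin 3) j)
  rw [LinearMap.sum_apply, Fin.sum_univ_six]
  simp only [LinearMap.smulRight_apply, LinearMap.comp_apply, LinearMap.proj_apply, symCoord_mk,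
    Pi.basisFun_apply, symMonomial]
  fin_cases i <;> fin_cases j <;> simp [symMk_comm]
  all_goals exact symMk_comm _ _

lemma symCoord_monomial (k l : Fin 6) :
    symCoord R (symMonomial R k) l = (Pi.single k 1 : Fin 6 → R) l := by
  rw [symMonomial, symCoord_mk]
  fin_cases k <;> fin_cases l <;> simp

/-- The symmetric square of `R^3` is `R^6`. -/
def symEquiv (R : Type) [CommRing R] :
    (((Fin 3 → R) ⊗[R] (Fin 3 → R)) ⧸ sym2Rel R (Fin 3 → R)) ≃ₗ[R] (Fin 6 → R) :=
  LinearEquiv.ofLinearMap (symCoord R) (Fintype.linearCombination R (symMonomial R))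
    (LinearMap.ext fun c => funext fun l => by
      simp [Fintype.linearCombination_apply, Finset.sum_apply, symCoord_monomial, Pi.single_apply])
    (LinearMap.ext fun z => by
      simp [Fintype.linearCombination_apply, sum_symCoord_smul])

end Sym2

/-! ### The Euler sequence and the sequence of principal parts -/

/-- A ring with a point of `ℙⁿ` is a `ℂ`-algebra. This supplies the last hypothesis of
`symMulLeft_injective`. -/
lemma isUnit_two {n : ℕ} {R : CommRingCat.{0}} (x : Spec R ⟶ P n) : IsUnit (2 : R) := by
  have := (show IsUnit (2 : ℂ) from (two_ne_zero).isUnit).map (OModule.scalar (P.toC n) x)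
  rwa [map_ofNat] at this

section Frames

variable {n : ℕ} {R : CommRingCat.{0}} {x : Spec R ⟶ P n} {s : Fin (n + 1) → twistSections (-1) x}

/-- The tautological inclusion on sections. -/
def tautMap (x : Spec R ⟶ P n) : twistSections (-1) x →ₗ[R] (Fin (n + 1) → R) := (taut n).app x

lemma tautMap_apply (t : twistSections (-1) x) (k : Fin (n + 1)) :
    tautMap x t k = tautCoord x t k := rfl

lemma linearCombination_tautMap (hs : ∑ k, tautCoord x (s k) k = 1) (t : twistSections (-1) x) :
    Fintype.linearCombination R s (tautMap x t) = t := by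
  rw [Fintype.linearCombination_apply]
  exact sum_tautCoord_smul hs t

lemma tmul_tautMap (t u : twistSections (-1) x) :
    t ⊗ₜ[R] tautMap x u = ∑ k, (tautCoord x u k • t) ⊗ₜ[R] (Pi.single k 1 : Fin (n + 1) → R) := by
  have : tautMap x u = ∑ k, tautCoord x u k • (Pi.single k 1 : Fin (n + 1) → R) := by
    ext j
    simp [Finset.sum_apply, Pi.single_apply, tautMap_apply]
  rw [this, TensorProduct.tmul_sum]
  exact Finset.sum_congr rfl fun k _ => by rw [TensorProduct.tmul_smul, TensorProduct.smul_tmul']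

lemma tmul_tautMap_comm (t u : twistSections (-1) x) :
    t ⊗ₜ[R] tautMap x u = u ⊗ₜ[R] tautMap x t := by
  rw [tmul_tautMap, tmul_tautMap]
  exact Finset.sum_congr rfl fun k _ => by rw [tautCoord_swap]

/-- The map `𝒪(-2) → 𝒪(-1) ⊗ 𝒪^{⊕(n+1)}` on sections. -/
def eulerMap (x : Spec R ⟶ P n) :
    twistSections (-2) x →ₗ[R] twistSections (-1) x ⊗[R] (Fin (n + 1) → R) :=
  ∑ k, ((TensorProduct.mk R (twistSections (-1) x) (Fin (n + 1) → R)).flip (Pi.single k 1)) ∘ₗ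
    mulXMap x k

lemma eulerMap_apply (t : twistSections (-2) x) : eulerMap x t =
    ∑ k, mulXMap x k t ⊗ₜ[R] (Pi.single k 1 : Fin (n + 1) → R) :=
  LinearMap.sum_apply _ _ _

lemma eulerMap_mulTaut (t u : twistSections (-1) x) :
    eulerMap x (mulTaut x t u) = t ⊗ₜ[R] tautMap x u := by
  rw [eulerMap_apply, tmul_tautMap]
  exact Finset.sum_congr rfl fun k _ => by rw [mulXMap_mulTaut]

lemma eulerMap_injective (x : Spec R ⟶ P n) : Function.Injective (eulerMap x) := fun t u h => by
  refine mulXMap_ext fun k => ?_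
  have key (t : twistSections (-2) x) : TensorProduct.rid R _ ((LinearMap.lTensor _
      (LinearMap.proj k : (Fin (n + 1) → R) →ₗ[R] R)) (eulerMap x t)) = mulXMap x k t := by
    rw [eulerMap_apply, map_sum, map_sum, Finset.sum_eq_single k]
    · simp
    · intro j _ hj
      simp [Pi.single_eq_of_ne hj.symm]
    · simp
  rw [← key, ← key, h]

/-- The sections of `𝒪(-2)` are spanned by products `t u`, and `t u` goes to `t ⊗ (u X_k)_k`. So
exactness of the twisted Euler sequence reduces to tensoring `𝒪(-1) → 𝒪^{⊕(n+1)} → 𝒬 → 0` with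
`𝒪(-1)`. -/
lemma range_eulerMap (x : Spec R ⟶ P n) :
    LinearMap.range (eulerMap x) = LinearMap.range ((tautMap x).lTensor (twistSections (-1) x)) := by
  obtain ⟨s, hs⟩ := exists_frame x
  apply le_antisymm
  · rintro _ ⟨t, rfl⟩
    rw [← sum_mulTaut_mulXMap hs t, map_sum]
    exact sum_mem fun k _ => ⟨mulXMap x k t ⊗ₜ s k, (eulerMap_mulTaut _ _).symm⟩
  · rintro _ ⟨w, rfl⟩
    induction w using TensorProduct.induction_on with
    | zero => rw [map_zero]; exact zero_mem _
    | tmul t u => exact ⟨_, eulerMap_mulTaut t u⟩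
    | add a b ha hb => rw [map_add]; exact add_mem ha hb

lemma symMulLeft_tautMap_injective (x : Spec R ⟶ P n) :
    Function.Injective (symMulLeft (tautMap x)) := by
  obtain ⟨s, hs⟩ := exists_frame x
  exact symMulLeft_injective (linearCombination_tautMap hs) tmul_tautMap_comm (isUnit_two x)

end Frames

theorem isShortExact_euler_plane : OModule.IsShortExact eulerIncl eulerProj := fun x => by
  have hQ : Function.Exact (tautMap x) ((toQ 2).app x) := LinearMap.exact_map_mkQ_range _
  have hQ' : Function.Surjective ((toQ 2).app x) := Submodule.mkQ_surjective _
  refine ⟨eulerMap_injective x, LinearMap.exact_iff.2 ?_,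
    LinearMap.lTensor_surjective (twistSections (-1) x) hQ'⟩
  exact (LinearMap.exact_iff.1 (lTensor_exact (twistSections (-1) x) hQ hQ')).trans
    (range_eulerMap x).symm

theorem isShortExact_parts : OModule.IsShortExact partsIncl partsProj := fun x => by
  have hQ : Function.Exact (tautMap x) ((toQ 2).app x) := LinearMap.exact_map_mkQ_range _
  have hQ' : Function.Surjective ((toQ 2).app x) := Submodule.mkQ_surjective _
  refine ⟨symMulLeft_tautMap_injective x, exact_symMulLeft hQ hQ', fun z => ?_⟩
  obtain ⟨z, rfl⟩ := Submodule.mkQ_surjective _ z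
  obtain ⟨y, rfl⟩ := TensorProduct.map_surjective hQ' hQ' z
  exact ⟨Submodule.Quotient.mk y, rfl⟩

/-- The extension of `ψ` from `M ⊗ M` to `N ⊗ N` agrees with its own swap, as this can be tested on
the image of `M ⊗ M`. It therefore descends to the symmetric square. -/
lemma isBaseChangeMap_sym2 {R S M N : Type} [CommRing R] [CommRing S] [AddCommGroup M] [Module R M]
    [AddCommGroup N] [Module S N] {f : R →+* S} {φ : M →ₛₗ[f] N}
    (h : OModule.IsBaseChangeMap f φ) :
    OModule.IsBaseChangeMap f (Submodule.mapQ _ _ (TensorProduct.map φ φ) (OModule.sym2Rel_le φ)) := by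
  intro T _ _ ψ
  have h2 := IsBaseChangeMap.tensor h h
  obtain ⟨g, hg, -⟩ := h2 T (ψ.comp (OModule.sym2Rel R M).mkQ)
  replace hg (z) : g (TensorProduct.map φ φ z) = ψ ((OModule.sym2Rel R M).mkQ z) :=
    congrArg (fun g => g z) hg
  have hsymm (a b : N) : g (a ⊗ₜ b) = g (b ⊗ₜ a) := by
    refine congrArg (fun k => k (a ⊗ₜ b)) (IsBaseChangeMap.hom_ext h2 (g := g)
      (g' := g ∘ₗ (TensorProduct.comm S N N).toLinearMap) fun z => ?_)
    induction z using TensorProduct.induction_on with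
    | zero => simp
    | tmul a b =>
      change g (TensorProduct.map φ φ (a ⊗ₜ b)) = g (TensorProduct.map φ φ (b ⊗ₜ a))
      rw [hg, hg]
      exact congrArg ψ (symMk_comm a b)
    | add a b ha hb => rw [map_add, map_add, map_add, ha, hb]
  let g' : ((N ⊗[S] N) ⧸ OModule.sym2Rel S N) →ₗ[S] T :=
    (OModule.sym2Rel S N).liftQ g (Submodule.span_le.2 (by
      rintro _ ⟨⟨a, b⟩, rfl⟩
      simp [hsymm a b]))
  refine ⟨g', LinearMap.ext fun z => ?_, fun k hk => ?_⟩
  · obtain ⟨z, rfl⟩ := Submodule.mkQ_surjective _ z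
    exact hg z
  · refine LinearMap.ext fun z => ?_
    obtain ⟨z, rfl⟩ := Submodule.mkQ_surjective _ z
    refine congrArg (fun l => l z) (IsBaseChangeMap.hom_ext h2
      (g := k ∘ₗ (OModule.sym2Rel S N).mkQ) (g' := g) fun m => ?_)
    rw [hg]
    exact congrArg (fun l => l ((OModule.sym2Rel R M).mkQ m)) hk

lemma isLocFree_O_6 : O_6.IsLocFree where
  baseChange f x y h := isBaseChangeMap_sym2 ((OModule.isLocFree_free (P 2) (Fin 3)).1 f x y h)
  finite {R} _ := Module.Finite.equiv (symEquiv R).symm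
  projective {R} _ := Module.Projective.of_equiv (symEquiv R).symm

/-! ### Completions of the diagrams -/

lemma isShortExact_veronese : OModule.IsShortExact veronese (OModule.cokerπ veronese) :=
  OModule.isShortExact_coker fun x =>
    Function.Injective.comp (g := partsIncl.app x) (f := eulerIncl.app x) (isShortExact_parts x).1
      (isShortExact_euler_plane x).1

lemma isShortExact_taut_six :
    OModule.IsShortExact (extMap (taut 1) (𝟙 O_6)) (extMap toO1 (𝟙 O_6)) :=
  isShortExact_extMap_right isLocFree_O_6 isShortExact_euler_line

lemma segreVeronese_injective {R : CommRingCat.{0}} (x : Spec R ⟶ P12) :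
    Function.Injective (segreVeronese.app x) :=
  Function.Injective.comp (g := (extMap (taut 1) (𝟙 O_6)).app x)
    (f := (extMap (𝟙 (O 1 (-1))) veronese).app x) (isShortExact_taut_six x).1 (isShortExact_extMap_left (isLocFree_O 1 (-1)) isShortExact_veronese x).1

namespace OModule

variable {X : Scheme.{0}} {A B C B' D G : OModule X} {a : A ⟶ B} {b : B ⟶ C} {c : B ⟶ B'}
  {d : B' ⟶ D} {p : B' ⟶ G}

lemma IsShortExact.comp_eq_zero (h : IsShortExact a b) {R : CommRingCat.{0}} (x : Spec R ⟶ X)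
    (m : A.obj x) : b.app x (a.app x m) = 0 :=
  (h x).2.1.apply_apply_eq_zero m

/-- The map on cokernels `C → G` of a row and a column that cross in `B → B'`. -/
def crossLeft (h₁ : IsShortExact a b) (h₃ : IsShortExact (a ≫ c) p) : C ⟶ G :=
  desc h₁ (c ≫ p) fun x m => h₃.comp_eq_zero x m

/-- The map on cokernels `G → D` of a row and a column that cross in `B → B'`. -/
def crossRight (h₂ : IsShortExact c d) (h₃ : IsShortExact (a ≫ c) p) : G ⟶ D :=
  desc h₃ d fun x m => h₂.comp_eq_zero x (a.app x m)

lemma comp_crossLeft (h₁ : IsShortExact a b) (h₃ : IsShortExact (a ≫ c) p) :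
    c ≫ p = b ≫ crossLeft h₁ h₃ :=
  (comp_desc h₁ (c ≫ p) fun x m => h₃.comp_eq_zero x m).symm

lemma comp_crossRight (h₂ : IsShortExact c d) (h₃ : IsShortExact (a ≫ c) p) :
    p ≫ crossRight h₂ h₃ = d :=
  comp_desc h₃ d fun x m => h₂.comp_eq_zero x (a.app x m)

lemma isShortExact_cross (h₁ : IsShortExact a b) (h₂ : IsShortExact c d)
    (h₃ : IsShortExact (a ≫ c) p) : IsShortExact (crossLeft h₁ h₃) (crossRight h₂ h₃) :=
  IsShortExact.exact_of_cross h₁ h₂ h₃ (comp_crossLeft h₁ h₃) (comp_crossRight h₂ h₃)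

end OModule

lemma isShortExact_segreVeronese :
    OModule.IsShortExact segreVeronese (OModule.cokerπ segreVeronese) :=
  OModule.isShortExact_coker segreVeronese_injective

lemma isShortExact_extMap_veronese :
    OModule.IsShortExact (extMap (𝟙 (O 1 (-1))) veronese)
      (extMap (𝟙 (O 1 (-1))) (OModule.cokerπ veronese)) :=
  isShortExact_extMap_left (isLocFree_O 1 (-1)) isShortExact_veronese

/-- The standard completion, by cokernels. -/
def stdCompletion : Completion where
  Λ := OModule.coker veronese
  p := OModule.cokerπ veronese
  i := OModule.crossLeft isShortExact_euler_plane isShortExact_veronese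
  j := OModule.crossRight isShortExact_parts isShortExact_veronese
  exact_row := isShortExact_veronese
  exact_col := OModule.isShortExact_cross _ isShortExact_parts _
  comm := OModule.comp_crossLeft _ _
  comm_sym2 := OModule.comp_crossRight isShortExact_parts _
  K := OModule.coker segreVeronese
  p' := OModule.cokerπ segreVeronese
  i' := OModule.crossLeft isShortExact_extMap_veronese isShortExact_segreVeronese
  j' := OModule.crossRight isShortExact_taut_six isShortExact_segreVeronese
  exact_row' := isShortExact_segreVeronese
  exact_col' := OModule.isShortExact_cross _ isShortExact_taut_six _
  comm' := OModule.comp_crossLeft _ _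
  comm_O1 := OModule.comp_crossRight isShortExact_taut_six _

namespace OModule

variable {X : Scheme.{0}} {E F G G' : OModule X}

/-- Two cokernels of the same homomorphism are isomorphic. -/
def cokerIso {φ : E ⟶ F} {ψ : F ⟶ G} {ψ' : F ⟶ G'} (h : IsShortExact φ ψ)
    (h' : IsShortExact φ ψ') : G ≅ G' where
  hom := desc h ψ' fun x m => h'.comp_eq_zero x m
  inv := desc h' ψ fun x m => h.comp_eq_zero x m
  hom_inv_id := hom_ext_of_surjective (fun x => (h x).2.2) (by
    rw [← Category.assoc, comp_desc, comp_desc, Category.comp_id])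
  inv_hom_id := hom_ext_of_surjective (fun x => (h' x).2.2) (by
    rw [← Category.assoc, comp_desc, comp_desc, Category.comp_id])

lemma comp_cokerIso {φ : E ⟶ F} {ψ : F ⟶ G} {ψ' : F ⟶ G'} (h : IsShortExact φ ψ)
    (h' : IsShortExact φ ψ') : ψ ≫ (cokerIso h h').hom = ψ' :=
  comp_desc h ψ' fun x m => h'.comp_eq_zero x m

lemma comp_cokerIso_left {B C : OModule X} {φ : E ⟶ F} {ψ : F ⟶ G} {ψ' : F ⟶ G'}
    (h : IsShortExact φ ψ) (h' : IsShortExact φ ψ') {b : B ⟶ C} {c : B ⟶ F} {i : C ⟶ G}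
    {i' : C ⟶ G'} (hb : ∀ {R : CommRingCat.{0}} (x : Spec R ⟶ X), Function.Surjective (b.app x))
    (hi : c ≫ ψ = b ≫ i) (hi' : c ≫ ψ' = b ≫ i') : i ≫ (cokerIso h h').hom = i' :=
  hom_ext_of_surjective hb (by
    rw [← Category.assoc, ← hi, Category.assoc, comp_cokerIso, hi'])

lemma cokerIso_comp_right {D : OModule X} {φ : E ⟶ F} {ψ : F ⟶ G} {ψ' : F ⟶ G'}
    (h : IsShortExact φ ψ) (h' : IsShortExact φ ψ') {d : F ⟶ D} {j : G ⟶ D}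
    {j' : G' ⟶ D} (hj : ψ ≫ j = d) (hj' : ψ' ≫ j' = d) : (cokerIso h h').hom ≫ j' = j :=
  hom_ext_of_surjective (fun x => (h x).2.2) (by
    rw [← Category.assoc, comp_cokerIso, hj, hj'])

end OModule

lemma extMap_comp {E : OModule (P 1)} {F G H : OModule (P 2)} (φ : F ⟶ G) (ψ : G ⟶ H) :
    extMap (𝟙 E) φ ≫ extMap (𝟙 E) ψ = extMap (𝟙 E) (φ ≫ ψ) :=
  OModule.hom_ext fun x m => (TensorProduct.map_map LinearMap.id (ψ.app (x ≫ P12.pr₂))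
    LinearMap.id (φ.app (x ≫ P12.pr₂)) m)

namespace Completion

variable (D D' : Completion)

lemma p_surjective {R : CommRingCat.{0}} (x : Spec R ⟶ P 2) : Function.Surjective (D.p.app x) :=
  (D.exact_row x).2.2

lemma p'_surjective {R : CommRingCat.{0}} (x : Spec R ⟶ P12) : Function.Surjective (D.p'.app x) :=
  (D.exact_row' x).2.2

/-- The isomorphism between two completions. -/
def iso : Completion.Iso D D' where
  isoΛ := OModule.cokerIso D.exact_row D'.exact_row
  isoK := OModule.cokerIso D.exact_row' D'.exact_row'
  p_comp := OModule.comp_cokerIso _ _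
  i_comp := OModule.comp_cokerIso_left _ _ (fun x => (isShortExact_euler_plane x).2.2) D.comm D'.comm
  comp_j := OModule.cokerIso_comp_right _ _ D.comm_sym2 D'.comm_sym2
  p'_comp := OModule.comp_cokerIso _ _
  i'_comp := OModule.comp_cokerIso_left _ _
    (fun x => (isShortExact_extMap_left (isLocFree_O 1 (-1)) D.exact_row x).2.2) D.comm' (by
      rw [← Category.assoc, extMap_comp, OModule.comp_cokerIso]
      exact D'.comm')
  comp_j' := OModule.cokerIso_comp_right _ _ D.comm_O1 D'.comm_O1

/-- Compatibility with `p` and `p'` already determines both isomorphisms, because these maps are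
surjective on every affine point. -/
lemma iso_unique (f : Completion.Iso D D') : f = D.iso D' := by
  obtain ⟨a, b, h₁, -, -, h₂, -, -⟩ := f
  have ha : a = (D.iso D').isoΛ := CategoryTheory.Iso.ext
    (OModule.hom_ext_of_surjective D.p_surjective (h₁.trans (D.iso D').p_comp.symm))
  have hb : b = (D.iso D').isoK := CategoryTheory.Iso.ext
    (OModule.hom_ext_of_surjective D.p'_surjective (h₂.trans (D.iso D').p'_comp.symm))
  subst ha hb
  rfl

end Completion

end Fano

namespace Fano

/-! ### `Λ` and `K` are vector bundles -/

section Algebra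

variable {R A B C H : Type} [CommRing R] [AddCommGroup A] [AddCommGroup B] [AddCommGroup C]
  [AddCommGroup H] [Module R A] [Module R B] [Module R C] [Module R H]

/-- A linear map that vanishes on the kernel of a surjection factors through it. -/
def liftSurj (ψ : B →ₗ[R] C) (hψ : Function.Surjective ψ) (χ : B →ₗ[R] H)
    (h : LinearMap.ker ψ ≤ LinearMap.ker χ) : C →ₗ[R] H :=
  (LinearMap.ker ψ).liftQ χ h ∘ₗ (ψ.quotKerEquivOfSurjective hψ).symm.toLinearMap

lemma liftSurj_apply (ψ : B →ₗ[R] C) (hψ : Function.Surjective ψ) (χ : B →ₗ[R] H)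
    (h : LinearMap.ker ψ ≤ LinearMap.ker χ) (b : B) : liftSurj ψ hψ χ h (ψ b) = χ b := by
  have : (ψ.quotKerEquivOfSurjective hψ).symm (ψ b) = Submodule.Quotient.mk b :=
    (LinearEquiv.symm_apply_eq _).2 rfl
  exact (congrArg ((LinearMap.ker ψ).liftQ χ h) this :)

lemma projective_rank_of_retract {φ : A →ₗ[R] B} {ψ : B →ₗ[R] C} (h : Function.Exact φ ψ)
    (hψ : Function.Surjective ψ) (ρ : B →ₗ[R] A) (hρ : ∀ a, ρ (φ a) = a) [Module.Finite R B]
    [Module.Projective R B] : Module.Finite R C ∧ Module.Projective R C ∧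
      ∀ p : PrimeSpectrum R,
        Module.rankAtStalk B p = Module.rankAtStalk A p + Module.rankAtStalk C p := by
  let e : B ≃ₗ[R] A × C := (h.splitInjectiveEquiv hψ ⟨ρ, LinearMap.ext hρ⟩).1
  have hA : Module.Finite R A := Module.Finite.of_surjective ρ fun a => ⟨φ a, hρ a⟩
  have hC : Module.Finite R C := Module.Finite.of_surjective ψ hψ
  have hA' : Module.Projective R A := Module.Projective.of_split φ ρ (LinearMap.ext hρ)
  have hC' : Module.Projective R C := by
    refine Module.Projective.of_split (e.symm.toLinearMap ∘ₗ LinearMap.inr R A C)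
      (LinearMap.snd R A C ∘ₗ e.toLinearMap) (LinearMap.ext fun c => ?_)
    simp
  refine ⟨hC, hC', fun p => ?_⟩
  rw [Module.rankAtStalk_eq_of_equiv e, Module.rankAtStalk_prod]
  rfl

end Algebra

namespace OModule

variable {X : Scheme.{0}} {E F G : OModule X}

/-- The retractions are needed one affine point at a time, for projectivity and ranks, and need not
commute with base change; the base change property of `G` comes from right exactness alone. -/
lemma IsShortExact.isVectorBundle {φ : E ⟶ F} {ψ : F ⟶ G} (h : IsShortExact φ ψ)
    (hE : E.IsLocFree) (hF : F.IsLocFree)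
    (hret : ∀ {R : CommRingCat.{0}} (x : Spec R ⟶ X), ∃ ρ : F.obj x →ₗ[R] E.obj x,
      ∀ m, ρ (φ.app x m) = m)
    {r s t : ℕ} (hr : ∀ {R : CommRingCat.{0}} (x : Spec R ⟶ X) (p : PrimeSpectrum R),
      Module.rankAtStalk (E.obj x) p = r)
    (ht : ∀ {R : CommRingCat.{0}} (x : Spec R ⟶ X) (p : PrimeSpectrum R),
      Module.rankAtStalk (F.obj x) p = t) (hrs : t = r + s) : IsVectorBundle s G := by
  have key {R : CommRingCat.{0}} (x : Spec R ⟶ X) : Module.Finite R (G.obj x) ∧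
      Module.Projective R (G.obj x) ∧ ∀ p : PrimeSpectrum R, Module.rankAtStalk (F.obj x) p =
        Module.rankAtStalk (E.obj x) p + Module.rankAtStalk (G.obj x) p := by
    obtain ⟨ρ, hρ⟩ := hret x
    have := hF.2 x
    have := hF.3 x
    exact projective_rank_of_retract (h x).2.1 (h x).2.2 ρ hρ
  refine ⟨fun f x y hxy => ?_, fun x => (key x).1, fun x => (key x).2.1, fun x p => ?_⟩
  · exact IsBaseChangeMap.coker (hE.1 f x y hxy) (hF.1 f x y hxy) (φ.app x) (ψ.app x) (φ.app y)
      (ψ.app y) (h x).2.2 (h y).2.2 (h.comp_eq_zero x) (fun n => ((h y).2.1 n).1)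
      (fun m => (φ.naturality f x y hxy m).symm) (fun m => (ψ.naturality f x y hxy m).symm)
  · have := (key x).2.2 p
    rw [hr, ht, hrs] at this
    omega

end OModule

/-- The symmetric square of `R^3`. -/
abbrev Conics (R : Type) [CommRing R] : Type :=
  ((Fin 3 → R) ⊗[R] (Fin 3 → R)) ⧸ OModule.sym2Rel R (Fin 3 → R)

section Maps

variable {R : CommRingCat.{0}} (a : Spec R ⟶ P 1) (b : Spec R ⟶ P 2)

/-- The tautological inclusion on `ℙ¹`, on sections. -/
def lineIncl : twistSections (-1) a →ₗ[R] (Fin 2 → R) := tautMap a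

/-- The tautological inclusion on `ℙ²`, on sections. -/
def planeIncl : twistSections (-1) b →ₗ[R] (Fin 3 → R) := tautMap b

/-- The map `𝒪(-2) → 𝒪^{⊕6}` on sections. -/
def conicIncl : twistSections (-2) b →ₗ[R] Conics R := veronese.app b

lemma conicIncl_mulTaut (t u : twistSections (-1) b) :
    conicIncl b (mulTaut b t u) = symMk R (planeIncl b t) (planeIncl b u) :=
  congrArg (symMulLeft (tautMap b)) (eulerMap_mulTaut t u)

lemma exists_lineIncl_retract : ∃ ρ : (Fin 2 → R) →ₗ[R] twistSections (-1) a,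
    ∀ t, ρ (lineIncl a t) = t := by
  obtain ⟨s, hs⟩ := exists_frame a
  exact ⟨Fintype.linearCombination R s, linearCombination_tautMap hs⟩

lemma exists_planeIncl_retract : ∃ ρ : (Fin 3 → R) →ₗ[R] twistSections (-1) b,
    ∀ t, ρ (planeIncl b t) = t := by
  obtain ⟨s, hs⟩ := exists_frame b
  exact ⟨Fintype.linearCombination R s, linearCombination_tautMap hs⟩

/-- Sections of `𝒪(-2)` are sums of products. -/
lemma mulTaut_induction {n : ℕ} {x : Spec R ⟶ P n} {p : twistSections (-2) x → Prop}
    (t : twistSections (-2) x) (hm : ∀ u v, p (mulTaut x u v)) (h0 : p 0)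
    (ha : ∀ u v, p u → p v → p (u + v)) : p t := by
  classical
  obtain ⟨s, hs⟩ := exists_frame x
  rw [← sum_mulTaut_mulXMap hs t]
  exact Finset.sum_induction _ p ha h0 fun k _ => hm _ _

/-- A retraction `ρ` of the tautological inclusion induces `a · b ↦ ρ(a) ρ(b)` on symmetric squares,
and `conicIncl` sends a product `t u` to the product of the images of `t` and `u`. -/
lemma exists_conicIncl_retract : ∃ ρ : Conics R →ₗ[R] twistSections (-2) b,
    ∀ t, ρ (conicIncl b t) = t := by
  obtain ⟨ρ, hρ⟩ := exists_planeIncl_retract b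
  let β : (Fin 3 → R) →ₗ[R] (Fin 3 → R) →ₗ[R] twistSections (-2) b := ((mulTaut b).compl₂ ρ) ∘ₗ ρ
  have hβ (v w : Fin 3 → R) : β v w = β w v := mulTaut_comm (ρ v) (ρ w)
  refine ⟨symLift β hβ, fun t => ?_⟩
  refine mulTaut_induction (p := fun t => symLift β hβ (conicIncl b t) = t) t (fun u v => ?_) ?_
    fun u v hu hv => ?_
  · refine (congrArg (symLift β hβ) (conicIncl_mulTaut b u v)).trans
      ((symLift_mk β hβ _ _).trans ?_)
    change mulTaut b (ρ (planeIncl b u)) (ρ (planeIncl b v)) = _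
    rw [hρ, hρ]
  · exact (congrArg (symLift β hβ) (map_zero _)).trans (map_zero _)
  · exact (congrArg (symLift β hβ) (map_add _ u v)).trans
      ((map_add _ _ _).trans (congrArg₂ (· + ·) hu hv))

end Maps

section Segre

variable {R : CommRingCat.{0}} (x : Spec R ⟶ P12)

/-- The fibre of `𝒪^{⊕12} = 𝒪^{⊕2} ⊠ Sym² 𝒪^{⊕3}`. -/
abbrev Twelve (R : Type) [CommRing R] : Type := (Fin 2 → R) ⊗[R] Conics R

/-- The map `𝒪(-1,-2) → 𝒪^{⊕12}` on sections. -/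
def segreIncl : twistSections (-1) (x ≫ P12.pr₁) ⊗[R] twistSections (-2) (x ≫ P12.pr₂) →ₗ[R]
    Twelve R := segreVeronese.app x

lemma segreIncl_tmul (t : twistSections (-1) (x ≫ P12.pr₁)) (u : twistSections (-2) (x ≫ P12.pr₂)) :
    segreIncl x (t ⊗ₜ u) = lineIncl (x ≫ P12.pr₁) t ⊗ₜ conicIncl (x ≫ P12.pr₂) u := rfl

lemma exists_segreIncl_retract : ∃ ρ : Twelve R →ₗ[R]
    twistSections (-1) (x ≫ P12.pr₁) ⊗[R] twistSections (-2) (x ≫ P12.pr₂),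
    ∀ t, ρ (segreIncl x t) = t := by
  obtain ⟨ρ, hρ⟩ := exists_lineIncl_retract (x ≫ P12.pr₁)
  obtain ⟨σ, hσ⟩ := exists_conicIncl_retract (x ≫ P12.pr₂)
  refine ⟨TensorProduct.map ρ σ, fun t => ?_⟩
  induction t using TensorProduct.induction_on with
  | zero => rw [map_zero, map_zero]
  | tmul t u => rw [segreIncl_tmul, TensorProduct.map_tmul, hρ, hσ]
  | add a b ha hb => rw [map_add, map_add, ha, hb]

end Segre

lemma rankAtStalk_conics (R : Type) [CommRing R] (p : PrimeSpectrum R) :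
    Module.rankAtStalk (Conics R) p = 6 := by
  have : Nontrivial R := p.nontrivial
  rw [Module.rankAtStalk_eq_of_equiv (symEquiv R), Module.rankAtStalk_eq_finrank_of_free]
  simp

lemma rankAtStalk_twelve (R : Type) [CommRing R] (p : PrimeSpectrum R) :
    Module.rankAtStalk (Twelve R) p = 12 := by
  have : Nontrivial R := p.nontrivial
  rw [Module.rankAtStalk_eq_of_equiv (TensorProduct.congr (LinearEquiv.refl R (Fin 2 → R))
    (symEquiv R)), Module.rankAtStalk_eq_finrank_of_free]
  simp

lemma isLocFree_O_12 : O_12.IsLocFree :=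
  ((OModule.isLocFree_free (P 1) (Fin 2)).pullback _).tensor (isLocFree_O_6.pullback _)

lemma isLocFree_segre : (O 1 (-1) ⊠ O 2 (-2)).IsLocFree :=
  ((isLocFree_O 1 (-1)).pullback _).tensor ((isLocFree_O 2 (-2)).pullback _)

instance invertible_segre {R : CommRingCat.{0}} (x : Spec R ⟶ P12) :
    Module.Invertible R
      (twistSections (-1) (x ≫ P12.pr₁) ⊗[R] twistSections (-2) (x ≫ P12.pr₂)) := inferInstance

lemma rankAtStalk_segre {R : CommRingCat.{0}} (x : Spec R ⟶ P12) (p : PrimeSpectrum R) :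
    Module.rankAtStalk
      (twistSections (-1) (x ≫ P12.pr₁) ⊗[R] twistSections (-2) (x ≫ P12.pr₂)) p = 1 :=
  rankAtStalk_of_invertible p

namespace Completion

variable (D : Completion)

theorem isVectorBundle_Λ : OModule.IsVectorBundle 5 D.Λ :=
  OModule.IsShortExact.isVectorBundle D.exact_row (isLocFree_O 2 (-2)) isLocFree_O_6
    (fun x => exists_conicIncl_retract x) (r := 1) (t := 6)
    (fun x p => rankAtStalk_of_invertible (M := twistSections (-2) x) p)
    (fun {R} _ p => rankAtStalk_conics R p) rfl

theorem isVectorBundle_K : OModule.IsVectorBundle 11 D.K :=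
  OModule.IsShortExact.isVectorBundle D.exact_row' isLocFree_segre isLocFree_O_12
    (fun x => exists_segreIncl_retract x) (r := 1) (t := 12)
    (fun x p => rankAtStalk_segre x p)
    (fun {R} _ p => rankAtStalk_twelve R p) rfl

end Completion

end Fano

namespace Fano

/-! ### `K` is homogeneous -/

section TwelveMap

variable {R : Type} [CommRing R]

/-- The action of a pair of matrices on `R^2 ⊗ Sym² R^3`. -/
def twelveMap (A : Matrix (Fin 2) (Fin 2) R) (B : Matrix (Fin 3) (Fin 3) R) :
    Twelve R →ₗ[R] Twelve R :=
  TensorProduct.map (Matrix.toLin' A) (Submodule.mapQ _ _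
    (TensorProduct.map (Matrix.toLin' B) (Matrix.toLin' B)) (OModule.sym2Rel_le (Matrix.toLin' B)))

lemma twelveMap_tmul (A : Matrix (Fin 2) (Fin 2) R) (B : Matrix (Fin 3) (Fin 3) R)
    (a : Fin 2 → R) (v w : Fin 3 → R) : twelveMap A B (a ⊗ₜ symMk R v w) =
      A.mulVec a ⊗ₜ symMk R (B.mulVec v) (B.mulVec w) := rfl

lemma twelve_induction {p : Twelve R → Prop} (z : Twelve R) (h0 : p 0)
    (hm : ∀ a v w, p (a ⊗ₜ symMk R v w)) (ha : ∀ z w, p z → p w → p (z + w)) : p z := by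
  induction z using TensorProduct.induction_on with
  | zero => exact h0
  | tmul a z =>
    refine sym_induction (p := fun z => p (a ⊗ₜ z)) z ?_ (hm a) fun z w hz hw => ?_
    · rwa [TensorProduct.tmul_zero]
    · rw [TensorProduct.tmul_add]
      exact ha _ _ hz hw
  | add z w hz hw => exact ha _ _ hz hw

lemma twelveMap_one (z : Twelve R) : twelveMap 1 1 z = z := by
  refine twelve_induction (p := fun z => twelveMap 1 1 z = z) z (map_zero _) (fun a v w => ?_)
    fun z w hz hw => ?_
  · rw [twelveMap_tmul, Matrix.one_mulVec, Matrix.one_mulVec, Matrix.one_mulVec]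
  · rw [map_add, hz, hw]

lemma twelveMap_mul (A A' : Matrix (Fin 2) (Fin 2) R) (B B' : Matrix (Fin 3) (Fin 3) R)
    (z : Twelve R) : twelveMap (A' * A) (B' * B) z = twelveMap A' B' (twelveMap A B z) := by
  refine twelve_induction (p := fun z => twelveMap (A' * A) (B' * B) z =
    twelveMap A' B' (twelveMap A B z)) z ?_ (fun a v w => ?_) fun z w hz hw => ?_
  · rw [map_zero, map_zero, map_zero]
  · simp only [twelveMap_tmul, Matrix.mulVec_mulVec]
  · rw [map_add, map_add, map_add, hz, hw]

end TwelveMap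

section Act

variable {R S : CommRingCat.{0}}

lemma twelveMap_baseChange (f : R ⟶ S) (x : Spec R ⟶ P12) (y : Spec S ⟶ P12)
    (h : Spec.map f ≫ x = y) (A : Matrix (Fin 2) (Fin 2) R) (B : Matrix (Fin 3) (Fin 3) R)
    (z : Twelve R) : O_12.map f x y h (twelveMap A B z) =
      twelveMap (A.map f.hom) (B.map f.hom) (O_12.map f x y h z) := by
  refine twelve_induction (p := fun z => O_12.map f x y h (twelveMap A B z) =
    twelveMap (A.map f.hom) (B.map f.hom) (O_12.map f x y h z)) z ?_ (fun a v w => ?_)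
    fun z w hz hw => ?_
  · erw [map_zero]
  · change _ = twelveMap (A.map f.hom) (B.map f.hom) ((fun i => f.hom (a i)) ⊗ₜ[S]
      symMk S (fun i => f.hom (v i)) (fun i => f.hom (w i)))
    change (fun i => f.hom (A.mulVec a i)) ⊗ₜ[S] symMk S (fun i => f.hom (B.mulVec v i))
      (fun i => f.hom (B.mulVec w i)) = _
    rw [twelveMap_tmul]
    congr 2
    · exact funext fun i => RingHom.map_mulVec f.hom A a i
    · exact funext fun i => RingHom.map_mulVec f.hom B v i
    · exact funext fun i => RingHom.map_mulVec f.hom B w i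
  · have h₁ := congrArg (O_12.map f x y h) (map_add (twelveMap A B) z w)
    refine h₁.trans ((map_add _ _ _).trans ((congrArg₂ (· + ·) hz hw).trans ?_))
    exact ((congrArg _ (map_add (O_12.map f x y h) z w)).trans (map_add _ _ _)).symm

variable {n : ℕ} {x y : Spec R ⟶ P n} {g : Matrix.SpecialLinearGroup (Fin (n + 1)) R}

lemma IsTranslate.exists_eq (h : IsTranslate g x y) (t : twistSections (-1) x) :
    ∃ u : twistSections (-1) y, tautMap y u = g.1.mulVec (tautMap x t) := by
  have : g.1.mulVec (tautMap x t) ∈ tautLine y := h.2 ▸ ⟨tautMap x t, ⟨t, rfl⟩, rfl⟩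
  exact this

lemma IsTranslate.inv (h : IsTranslate g x y) : IsTranslate g⁻¹ y x := by
  refine ⟨h.1.symm, ?_⟩
  rw [h.2, ← Submodule.map_comp, ← Matrix.toLin'_mul, ← Matrix.SpecialLinearGroup.coe_mul,
    inv_mul_cancel, Matrix.SpecialLinearGroup.coe_one, Matrix.toLin'_one, Submodule.map_id]

variable {x y : Spec R ⟶ P12}
  {g : Matrix.SpecialLinearGroup (Fin 2) R × Matrix.SpecialLinearGroup (Fin 3) R}

/-- It suffices to treat `t ⊗ v w`, whose image is the tensor of a vector on the line in `R^2` with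
the product of two vectors on the line in `R^3`. By definition `g` carries the lines of `x` to those
of `y`. -/
lemma IsTranslate₁₂.mem_range (h : IsTranslate₁₂ g x y)
    (t : twistSections (-1) (x ≫ P12.pr₁) ⊗[R] twistSections (-2) (x ≫ P12.pr₂)) :
    twelveMap g.1.1 g.2.1 (segreIncl x t) ∈ LinearMap.range (segreIncl y) := by
  induction t using TensorProduct.induction_on with
  | zero => rw [map_zero, map_zero]; exact zero_mem _
  | add a b ha hb => rw [map_add, map_add]; exact add_mem ha hb
  | tmul t u =>
    refine mulTaut_induction (p := fun u => twelveMap g.1.1 g.2.1 (segreIncl x (t ⊗ₜ u)) ∈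
      LinearMap.range (segreIncl y)) u (fun v w => ?_) ?_ fun v w hv hw => ?_
    · obtain ⟨t', ht⟩ := IsTranslate.exists_eq h.1 t
      obtain ⟨v', hv⟩ := IsTranslate.exists_eq h.2 v
      obtain ⟨w', hw⟩ := IsTranslate.exists_eq h.2 w
      refine ⟨t' ⊗ₜ mulTaut _ v' w', ?_⟩
      rw [segreIncl_tmul, segreIncl_tmul, conicIncl_mulTaut, conicIncl_mulTaut, twelveMap_tmul]
      exact congrArg₂ (· ⊗ₜ[R] ·) ht (congrArg₂ (symMk R) hv hw)
    · rw [TensorProduct.tmul_zero, map_zero, map_zero]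
      exact zero_mem _
    · rw [TensorProduct.tmul_add, map_add, map_add]
      exact add_mem hv hw

end Act

namespace Completion

variable (D : Completion) {R : CommRingCat.{0}}

/-- The projection `𝒪^{⊕12} → K` on sections. -/
def proj (x : Spec R ⟶ P12) : Twelve R →ₗ[R] D.K.obj x := D.p'.app x

lemma proj_surjective (x : Spec R ⟶ P12) : Function.Surjective (D.proj x) := D.p'_surjective x

lemma proj_eq_zero_iff (x : Spec R ⟶ P12) (z : Twelve R) :
    D.proj x z = 0 ↔ z ∈ LinearMap.range (segreIncl x) := (D.exact_row' x).2.1 z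

variable {x y : Spec R ⟶ P12}
  {g : Matrix.SpecialLinearGroup (Fin 2) R × Matrix.SpecialLinearGroup (Fin 3) R}

/-- The action on `K`, as a linear map. -/
def actMap (h : IsTranslate₁₂ g x y) : D.K.obj x →ₗ[R] D.K.obj y :=
  liftSurj (D.proj x) (D.proj_surjective x) (D.proj y ∘ₗ twelveMap g.1.1 g.2.1) fun z hz => by
    obtain ⟨t, rfl⟩ := (D.proj_eq_zero_iff x z).1 hz
    exact (D.proj_eq_zero_iff y _).2 (h.mem_range t)

lemma actMap_proj (h : IsTranslate₁₂ g x y) (z : Twelve R) :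
    D.actMap h (D.proj x z) = D.proj y (twelveMap g.1.1 g.2.1 z) := liftSurj_apply _ _ _ _ _

lemma actMap_one (h : IsTranslate₁₂ 1 x x) (m : D.K.obj x) : D.actMap h m = m := by
  obtain ⟨z, rfl⟩ := D.proj_surjective x m
  exact (D.actMap_proj h z).trans (congrArg _ (twelveMap_one z))

lemma actMap_mul {z : Spec R ⟶ P12}
    {g' : Matrix.SpecialLinearGroup (Fin 2) R × Matrix.SpecialLinearGroup (Fin 3) R}
    (h : IsTranslate₁₂ g x y) (h' : IsTranslate₁₂ g' y z) (h'' : IsTranslate₁₂ (g' * g) x z)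
    (m : D.K.obj x) : D.actMap h'' m = D.actMap h' (D.actMap h m) := by
  obtain ⟨w, rfl⟩ := D.proj_surjective x m
  rw [actMap_proj, actMap_proj, actMap_proj]
  exact congrArg (D.proj z) (twelveMap_mul g.1.1 g'.1.1 g.2.1 g'.2.1 w)

lemma actMap_actMap_inv {g' : Matrix.SpecialLinearGroup (Fin 2) R × Matrix.SpecialLinearGroup (Fin 3) R}
    (e : g' * g = 1) (h : IsTranslate₁₂ g x y) (h' : IsTranslate₁₂ g' y x) (m : D.K.obj x) :
    D.actMap h' (D.actMap h m) = m := by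
  have h₁ : IsTranslate₁₂ (g' * g) x x := by
    rw [e]
    exact ⟨⟨rfl, by simp⟩, ⟨rfl, by simp⟩⟩
  rw [← D.actMap_mul h h' h₁]
  -- The product becomes a variable, so that `e` can be substituted in the type of `h₁`.
  generalize g' * g = k at e h₁
  subst e
  exact D.actMap_one h₁ m

/-- `K` is the quotient of a trivial bundle with linear action by an invariant subbundle. Every
axiom is checked on `R^2 ⊗ Sym² R^3`, which surjects onto the fibres of `K`. -/
theorem isHomogeneous_K : IsHomogeneous D.K := by
  have inv {R : CommRingCat.{0}} {x y : Spec R ⟶ P12}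
      {g : Matrix.SpecialLinearGroup (Fin 2) R × Matrix.SpecialLinearGroup (Fin 3) R}
      (h : IsTranslate₁₂ g x y) : IsTranslate₁₂ g⁻¹ y x :=
    ⟨IsTranslate.inv h.1, IsTranslate.inv h.2⟩
  refine ⟨{ act := fun g x y h => LinearEquiv.ofLinearMap (D.actMap h) (D.actMap (inv h))
              (LinearMap.ext fun m => ?_) (LinearMap.ext fun m => ?_)
            act_one := fun x h m => D.actMap_one h m
            act_mul := fun g g' x y z h h' h'' m => D.actMap_mul h h' h'' m
            act_map := fun f g x y x' y' hx hy h h' m => ?_ }⟩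
  · exact D.actMap_actMap_inv (mul_inv_cancel g) (inv h) h m
  · exact D.actMap_actMap_inv (inv_mul_cancel g) h (inv h) m
  · obtain ⟨w, rfl⟩ := D.proj_surjective x m
    change D.K.map f y y' hy (D.actMap h (D.proj x w)) = D.actMap h' (D.K.map f x x' hx (D.proj x w))
    rw [actMap_proj]
    refine (D.p'.naturality f y y' hy _).trans ?_
    refine Eq.trans ?_ (congrArg (D.actMap h') (D.p'.naturality f x x' hx w)).symm
    refine Eq.trans ?_ (D.actMap_proj h' _).symm
    refine congrArg (D.proj y') ?_
    exact twelveMap_baseChange f y y' hy g.1.1 g.2.1 w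

end Completion

end Fano

namespace Fano

/-! ### The functor of points of `ℙⁿ` -/

section Cover

variable {X : Scheme.{0}} {R : CommRingCat.{0}} {ι : Type} (g : ι → R)

/-- The localization map `R ⟶ R[1/r]`. -/
def awayMap (r : R) : R ⟶ CommRingCat.of (Localization.Away r) := CommRingCat.ofHom (algebraMap _ _)

lemma isUnit_awayMap (r : R) : IsUnit ((awayMap r).hom r) :=
  IsLocalization.Away.algebraMap_isUnit r

lemma hom_ext_of_span (hg : Ideal.span (Set.range g) = ⊤) {x x' : Spec R ⟶ X}
    (h : ∀ i, Spec.map (awayMap (g i)) ≫ x = Spec.map (awayMap (g i)) ≫ x') : x = x' :=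
  (Scheme.affineOpenCoverOfSpanRangeEqTop g hg).openCover.hom_ext _ _ h

/-- The fibre product of affine schemes is affine, so agreement on it is an instance of agreement
over all rings `T`. -/
lemma fst_comp_eq_snd_comp {A B : CommRingCat.{0}} (u : R ⟶ A) (v : R ⟶ B) (f : Spec A ⟶ X)
    (f' : Spec B ⟶ X) (h : ∀ (T : CommRingCat.{0}) (a : A ⟶ T) (b : B ⟶ T), u ≫ a = v ≫ b →
      Spec.map a ≫ f = Spec.map b ≫ f') :
    pullback.fst (Spec.map u) (Spec.map v) ≫ f = pullback.snd (Spec.map u) (Spec.map v) ≫ f' := by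
  rw [← cancel_epi (Scheme.isoSpec (pullback (Spec.map u) (Spec.map v))).inv]
  obtain ⟨a, ha⟩ := Spec.map_surjective ((Scheme.isoSpec (pullback (Spec.map u) (Spec.map v))).inv ≫
    pullback.fst (Spec.map u) (Spec.map v))
  obtain ⟨b, hb⟩ := Spec.map_surjective ((Scheme.isoSpec (pullback (Spec.map u) (Spec.map v))).inv ≫
    pullback.snd (Spec.map u) (Spec.map v))
  rw [← Category.assoc, ← Category.assoc, ← ha, ← hb]
  refine h _ a b (Spec.map_injective ?_)
  rw [Spec.map_comp, Spec.map_comp, ha, hb, Category.assoc, Category.assoc, pullback.condition]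

lemma exists_hom_of_span (hg : Ideal.span (Set.range g) = ⊤)
    (f : ∀ i, Spec (CommRingCat.of (Localization.Away (g i))) ⟶ X)
    (hf : ∀ (i j) (T : CommRingCat.{0}) (a : CommRingCat.of (Localization.Away (g i)) ⟶ T)
      (b : CommRingCat.of (Localization.Away (g j)) ⟶ T), awayMap (g i) ≫ a = awayMap (g j) ≫ b →
      Spec.map a ≫ f i = Spec.map b ≫ f j) :
    ∃ x : Spec R ⟶ X, ∀ i, Spec.map (awayMap (g i)) ≫ x = f i := by
  let 𝒰 := (Scheme.affineOpenCoverOfSpanRangeEqTop g hg).openCover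
  have h (i j : ι) : pullback.fst (𝒰.f i) (𝒰.f j) ≫ f i = pullback.snd (𝒰.f i) (𝒰.f j) ≫ f j :=
    fst_comp_eq_snd_comp (awayMap (g i)) (awayMap (g j)) (f i) (f j) (hf i j)
  exact ⟨𝒰.glueMorphisms f h, fun i => 𝒰.ι_glueMorphisms f h i⟩

lemma eq_of_awayMap (hg : Ideal.span (Set.range g) = ⊤) {r r' : R}
    (h : ∀ i, (awayMap (g i)).hom r = (awayMap (g i)).hom r') : r = r' := by
  rw [← sub_eq_zero]
  refine (Submodule.mem_bot R).1 ?_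
  have h' (i) : ∃ m : ℕ, (g i) ^ m * (r - r') = 0 := by
    obtain ⟨⟨_, m, rfl⟩, hm⟩ := (IsLocalization.eq_iff_exists (Submonoid.powers (g i))
      (Localization.Away (g i))).1 (h i)
    exact ⟨m, by rw [mul_sub]; exact sub_eq_zero.2 hm⟩
  refine Submodule.mem_of_span_eq_top_of_smul_pow_mem _ _ hg _ fun ⟨_, i, rfl⟩ => ?_
  obtain ⟨m, hm⟩ := h' i
  exact ⟨m, by simpa using hm⟩

end Cover

/-- A degree zero fraction, regarded as a function on `D₊(f)` and restricted along the embedding of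
the affine chart, is the fraction itself. This links `ratio` with `frac`. -/
lemma awayι_appLE {σ A : Type} [CommRing A] [SetLike σ A] [AddSubgroupClass σ A] (𝒜 : ℕ → σ)
    [GradedRing 𝒜] {f : A} {m : ℕ} (hf : f ∈ 𝒜 m) (hm : 0 < m)
    (e : ⊤ ≤ Proj.awayι 𝒜 f hf hm ⁻¹ᵁ Proj.basicOpen 𝒜 f) :
    Proj.awayToSection 𝒜 f ≫ (Proj.awayι 𝒜 f hf hm).appLE (Proj.basicOpen 𝒜 f) ⊤ e =
      (Scheme.ΓSpecIso _).inv := by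
  have h₁ := Proj.basicOpenToSpec_app_top 𝒜 f
  have h₂ : (Proj.awayι 𝒜 f hf hm).appLE (Proj.basicOpen 𝒜 f) ⊤ e =
      (Proj.basicOpen 𝒜 f).topIso.inv ≫ (Proj.basicOpenIsoSpec 𝒜 f hf hm).inv.appTop := by
    have := Scheme.Hom.appLE_comp_appLE (Proj.basicOpenIsoSpec 𝒜 f hf hm).inv
      (Proj.basicOpen 𝒜 f).ι (Proj.basicOpen 𝒜 f) ⊤ ⊤ (by simp) le_top
    refine this.symm.trans ?_
    congr 1
  have h₃ : Proj.awayToSection 𝒜 f ≫ (Proj.basicOpen 𝒜 f).topIso.inv =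
      (Scheme.ΓSpecIso _).inv ≫ (Proj.basicOpenIsoSpec 𝒜 f hf hm).hom.appTop := by
    rw [Proj.basicOpenIsoSpec_hom]
    exact (Iso.inv_hom_id_assoc _ _).symm.trans (congrArg (_ ≫ ·) h₁.symm)
  rw [h₂, ← Category.assoc, h₃, Category.assoc, ← Scheme.Hom.comp_appTop, Iso.inv_hom_id,
    Scheme.Hom.id_appTop, Category.comp_id]

/-! ### Standard charts of `ℙⁿ` and their coordinate rings. -/

section Chart

variable {n : ℕ}

/-- The standard chart as an affine scheme. -/
abbrev Coords (n : ℕ) (k : Fin (n + 1)) : CommRingCat.{0} :=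
  CommRingCat.of (HomogeneousLocalization.Away (grading n) (MvPolynomial.X k))

/-- The embedding of the standard chart. -/
def chartι (n : ℕ) (k : Fin (n + 1)) : Spec (Coords n k) ⟶ P n :=
  Proj.awayι (grading n) (MvPolynomial.X k) (X_mem n k) one_pos

instance (k : Fin (n + 1)) : IsOpenImmersion (chartι n k) :=
  inferInstanceAs (IsOpenImmersion (Proj.awayι ..))

/-- The coordinate `X_j / X_k`. -/
def frac (n : ℕ) (k j : Fin (n + 1)) : Coords n k :=
  HomogeneousLocalization.Away.mk (grading n) (X_mem n k) 1 (MvPolynomial.X j)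
    (by simpa using X_mem n j)

/-- Constants on the chart. -/
def const (n : ℕ) (k : Fin (n + 1)) : ℂ →+* Coords n k :=
  (HomogeneousLocalization.fromZeroRingHom (grading n) _).comp (algebraMap ℂ (grading n 0))

lemma chartι_toC (k : Fin (n + 1)) :
    chartι n k ≫ P.toC n = Spec.map (CommRingCat.ofHom (const n k)) := by
  refine (Proj.awayι_toSpecZero_assoc (grading n) (MvPolynomial.X k) (X_mem n k) one_pos _).trans ?_
  rw [← Spec.map_comp]
  rfl

lemma opensRange_chartι (k : Fin (n + 1)) : (chartι n k).opensRange = chart n k :=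
  Proj.opensRange_awayι _ _ _ _

lemma exists_chart {R : CommRingCat.{0}} {x : Spec R ⟶ P n} {k : Fin (n + 1)} (h : dom x k = ⊤) :
    ∃ ψ : Coords n k ⟶ R, Spec.map ψ ≫ chartι n k = x := by
  have hr : Set.range x ⊆ Set.range (chartι n k) := by
    rintro _ ⟨p, rfl⟩
    have hp : p ∈ dom x k := by rw [h]; trivial
    have : x p ∈ (chartι n k).opensRange := by rw [opensRange_chartι]; exact hp
    exact this
  refine ⟨Spec.preimage (IsOpenImmersion.lift (chartι n k) x hr), ?_⟩
  rw [Spec.map_preimage, IsOpenImmersion.lift_fac]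

lemma chartι_preimage (k j : Fin (n + 1)) :
    chartι n k ⁻¹ᵁ chart n j = PrimeSpectrum.basicOpen (frac n k j) := by
  refine (Proj.awayι_preimage_basicOpen (grading n) (X_mem n k) one_pos (X_mem n j) one_pos).trans ?_
  congr 1
  apply HomogeneousLocalization.val_injective
  rw [frac, HomogeneousLocalization.Away.val_mk, HomogeneousLocalization.Away.val_mk]
  simp

lemma top_le_chartι (k : Fin (n + 1)) : ⊤ ≤ chartι n k ⁻¹ᵁ chart n k := by
  rw [← opensRange_chartι]
  simp

lemma chartι_appLE (k : Fin (n + 1)) :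
    Proj.awayToSection (grading n) (MvPolynomial.X k) ≫
      (chartι n k).appLE (chart n k) ⊤ (top_le_chartι k) = (Scheme.ΓSpecIso _).inv :=
  awayι_appLE (grading n) (X_mem n k) one_pos (top_le_chartι k)

section

variable {R S : CommRingCat.{0}} {k : Fin (n + 1)} {x : Spec R ⟶ P n} {ψ : Coords n k ⟶ R}

lemma dom_chart (h : Spec.map ψ ≫ chartι n k = x) (j : Fin (n + 1)) :
    dom x j = basic (ψ.hom (frac n k j)) := by
  subst h
  change Spec.map ψ ⁻¹ᵁ (chartι n k ⁻¹ᵁ chart n j) = _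
  rw [chartι_preimage]
  rfl

lemma dom_chart_self (h : Spec.map ψ ≫ chartι n k = x) : dom x k = ⊤ := by
  subst h
  exact top_le_iff.1 fun p _ => top_le_chartι k (x := Spec.map ψ p) trivial

lemma algebraMap_frac (h : Spec.map ψ ≫ chartι n k = x) (j : Fin (n + 1)) :
    algebraMap R Γ(Spec R, dom x k) (ψ.hom (frac n k j)) = coord x k j := by
  have htop : ⊤ ≤ dom x k := (dom_chart_self h).ge
  have inj : Function.Injective (res htop) := by
    intro s t hst
    have := congrArg (res (le_top : dom x k ≤ ⊤)) hst
    rw [res_res, res_res] at this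
    have hid (s : Γ(Spec R, dom x k)) : res (le_refl (dom x k)) s = s :=
      congrArg (fun φ => φ.hom s) ((Spec R).presheaf.map_id _)
    exact (hid s).symm.trans (this.trans (hid t))
  refine inj ?_
  rw [res_algebraMap]
  subst h
  have h₁ := Scheme.Hom.appLE_comp_appLE (Spec.map ψ) (chartι n k) (chart n k) ⊤ ⊤
    (top_le_chartι k) le_top
  have h₂ := congrArg (fun φ => φ.hom (frac n k j)) (chartι_appLE (n := n) k)
  have h₃ := congrArg (fun φ => φ.hom (ratio n k j)) h₁
  have h₄ : (Spec.map ψ).appLE ⊤ ⊤ le_top = (Spec.map ψ).appTop := Scheme.Hom.appLE_eq_app _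
  have h₅ := congrArg (fun φ => φ.hom (frac n k j)) (Scheme.ΓSpecIso_inv_naturality ψ)
  refine h₅.trans (Eq.trans ?_ h₃)
  refine Eq.trans ?_ (congrArg (((Spec.map ψ).appLE ⊤ ⊤ le_top).hom) h₂.symm)
  rw [h₄]
  rfl

lemma tautCoord_chart (h : Spec.map ψ ≫ chartι n k = x) (t : twistSections (-1) x)
    (j : Fin (n + 1)) : tautCoord x t j = ψ.hom (frac n k j) * tautCoord x t k := by
  refine eq_of_algebraMap_eq (x := x) fun i => ?_
  have hle : dom x i ≤ dom x k := (dom_chart_self h).symm ▸ le_top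
  rw [← res_algebraMap hle, ← res_algebraMap hle]
  congr 1
  rw [map_mul, algebraMap_tautCoord, algebraMap_tautCoord, algebraMap_frac h, coord_self]
  ring

lemma exists_tautCoord_eq_one {k : Fin (n + 1)} (h : dom x k = ⊤) :
    ∃ t : twistSections (-1) x, tautCoord x t k = 1 := by
  obtain ⟨m, t, ht⟩ := exists_tautCoord_eq_pow (x := x) (g := (1 : R)) (i := k)
    (h.symm ▸ le_top)
  exact ⟨t, ht.trans (one_pow m)⟩

lemma tautLine_chart (h : Spec.map ψ ≫ chartι n k = x) :
    tautLine x = Submodule.span R {fun j => ψ.hom (frac n k j)} := by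
  refine le_antisymm ?_ ?_
  · rintro _ ⟨t, rfl⟩
    refine Submodule.mem_span_singleton.2 ⟨tautCoord x t k, funext fun j => ?_⟩
    exact (mul_comm _ _).trans (tautCoord_chart h t j).symm
  · obtain ⟨t, ht⟩ := exists_tautCoord_eq_one (dom_chart_self h)
    refine (Submodule.span_singleton_le_iff_mem _ _).2 ⟨t, funext fun j => ?_⟩
    refine (tautCoord_chart h t j).trans ?_
    rw [ht, mul_one]

/-- Near a point of the chart `X_i ≠ 0` one has `t X_k = (X_k / X_i) (t X_i)`, so `X_k / X_i` is a
unit there. -/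
lemma dom_eq_top_of_isUnit {k : Fin (n + 1)} {t : twistSections (-1) x}
    (h : IsUnit (tautCoord x t k)) : dom x k = ⊤ := by
  refine top_le_iff.1 fun p _ => ?_
  have hp : x.base p ∈ ⨆ i, chart n i := by
    rw [iSup_chart]
    trivial
  obtain ⟨i, hi⟩ := TopologicalSpace.Opens.mem_iSup.1 hp
  obtain ⟨_, ⟨⟨_, ⟨g, rfl⟩, rfl⟩, hpg, hg⟩⟩ :=
    TopologicalSpace.IsTopologicalBasis.exists_subset_of_mem_open
      (PrimeSpectrum.isBasis_basic_opens (R := R))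
      (show p ∈ ((dom x i).1 : Set (PrimeSpectrum R)) from hi) (dom x i).2
  have hrange := PrimeSpectrum.localization_away_comap_range (Localization.Away g) g
  obtain ⟨q, rfl⟩ : p ∈ Set.range (Spec.map (awayMap g)) := by
    refine Eq.mpr (congrArg (p ∈ ·) hrange) hpg
  have hy : dom (Spec.map (awayMap g) ≫ x) i = ⊤ := by
    refine top_le_iff.1 fun q' _ => ?_
    have : Spec.map (awayMap g) q' ∈ (PrimeSpectrum.basicOpen g : Set (PrimeSpectrum R)) := by
      rw [← hrange]
      exact ⟨q', rfl⟩
    exact hg this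
  obtain ⟨ψ, hψ⟩ := exists_chart hy
  have hu := h.map (awayMap g).hom
  rw [tautCoord_pull (awayMap g) x _ rfl, tautCoord_chart hψ] at hu
  have : q ∈ dom (Spec.map (awayMap g) ≫ x) k := by
    rw [dom_chart hψ]
    exact fun hq => q.2.ne_top (Ideal.eq_top_of_isUnit_mem _ hq (isUnit_of_mul_isUnit_left hu))
  exact this

end

/-- The coordinate ring of a chart is generated by the fractions `X_j / X_k` over the polynomials of
degree zero, and the latter are the constants. -/
lemma coords_hom_ext {R : CommRingCat.{0}} {k : Fin (n + 1)} {ψ ψ' : Coords n k ⟶ R}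
    (h₀ : ψ.hom.comp (const n k) = ψ'.hom.comp (const n k))
    (h : ∀ j, ψ.hom (frac n k j) = ψ'.hom (frac n k j)) : ψ = ψ' := by
  have hadj : Algebra.adjoin (grading n 0)
      (Set.range (MvPolynomial.X : Fin (n + 1) → MvPolynomial (Fin (n + 1)) ℂ)) = ⊤ := by
    refine eq_top_iff.2 fun p _ => ?_
    induction p using MvPolynomial.induction_on with
    | C a =>
      exact (Algebra.adjoin (grading n 0) (Set.range MvPolynomial.X)).algebraMap_mem
        ⟨MvPolynomial.C a, MvPolynomial.isHomogeneous_C _ a⟩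
    | add p q hp hq => exact add_mem (hp trivial) (hq trivial)
    | mul_X p i hp => exact mul_mem (hp trivial) (Algebra.subset_adjoin ⟨i, rfl⟩)
  have htop := HomogeneousLocalization.Away.adjoin_mk_prod_pow_eq_top (𝒜 := grading n)
    (X_mem n k) (Fin (n + 1)) MvPolynomial.X hadj (fun _ => 1) (X_mem n)
  refine CommRingCat.hom_ext (RingHom.ext fun z => ?_)
  have hz : z ∈ Algebra.adjoin (grading n 0) _ := htop.ge trivial
  induction hz using Algebra.adjoin_induction with
  | mem z hz =>
    obtain ⟨a, ai, hai, -, rfl⟩ := hz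
    have : HomogeneousLocalization.Away.mk (grading n) (X_mem n k) a (∏ i, MvPolynomial.X i ^ ai i)
        (hai ▸ SetLike.prod_pow_mem_graded _ _ _ _ fun i _ ↦ X_mem n i) =
        ∏ i, frac n k i ^ ai i := by
      apply (show Function.Injective (algebraMap (HomogeneousLocalization.Away (grading n)
        (MvPolynomial.X k)) (Localization.Away (MvPolynomial.X k : MvPolynomial _ ℂ)))
        from HomogeneousLocalization.val_injective _)
      simp only [map_prod, map_pow, HomogeneousLocalization.algebraMap_apply, frac,
        HomogeneousLocalization.Away.val_mk, Localization.mk_pow, Localization.mk_prod]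
      congr 1
      apply Subtype.ext
      simp only [smul_eq_mul, mul_one] at hai
      simp [Finset.prod_pow_eq_pow_sum, hai]
    rw [this]
    simp only [map_prod, map_pow, h]
  | algebraMap c =>
    obtain ⟨p, hp⟩ := c
    have hp' : p = MvPolynomial.C (MvPolynomial.coeff 0 p) :=
      MvPolynomial.totalDegree_eq_zero_iff_eq_C.1
        ((MvPolynomial.totalDegree_zero_iff_isHomogeneous _).2 hp)
    have := congrArg (fun f => f (MvPolynomial.coeff 0 p)) h₀
    have e : (⟨p, hp⟩ : grading n 0) = algebraMap ℂ (grading n 0) (MvPolynomial.coeff 0 p) :=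
      Subtype.ext hp'
    rw [e]
    exact this
  | add x y _ _ hx hy => rw [map_add, map_add, hx, hy]
  | mul x y _ _ hx hy => rw [map_mul, map_mul, hx, hy]

section

variable {R : CommRingCat.{0}}

/-- The ring homomorphism that belongs to the point `[a_0 : … : a_n]` with `a_k` invertible. -/
def coordsHom (φ : ℂ →+* R) (a : Fin (n + 1) → R) (k : Fin (n + 1)) (hk : IsUnit (a k)) :
    Coords n k ⟶ R :=
  CommRingCat.ofHom ((IsLocalization.Away.lift (S := Localization.Away (MvPolynomial.X k))
    (g := MvPolynomial.eval₂Hom φ a) (MvPolynomial.X k) (by simpa using hk)).comp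
      (algebraMap (HomogeneousLocalization.Away (grading n) (MvPolynomial.X k))
        (Localization.Away (MvPolynomial.X k : MvPolynomial (Fin (n + 1)) ℂ))))

lemma coordsHom_const (φ : ℂ →+* R) (a : Fin (n + 1) → R) (k : Fin (n + 1)) (hk : IsUnit (a k))
    (c : ℂ) : (coordsHom φ a k hk).hom (const n k c) = φ c := by
  have : algebraMap (HomogeneousLocalization.Away (grading n) (MvPolynomial.X k))
      (Localization.Away (MvPolynomial.X k : MvPolynomial (Fin (n + 1)) ℂ)) (const n k c) =
      algebraMap _ _ (MvPolynomial.C c) := Localization.mk_one_eq_algebraMap _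
  have hu : IsUnit (MvPolynomial.eval₂Hom φ a (MvPolynomial.X k)) := by simpa using hk
  have h₂ := congrArg (IsLocalization.Away.lift (S := Localization.Away (MvPolynomial.X k))
    (g := MvPolynomial.eval₂Hom φ a) (MvPolynomial.X k) hu) this
  rw [IsLocalization.Away.lift_eq] at h₂
  refine h₂.trans ?_
  simp

lemma algebraMap_frac_mul (k j : Fin (n + 1)) :
    algebraMap (HomogeneousLocalization.Away (grading n) (MvPolynomial.X k))
      (Localization.Away (MvPolynomial.X k : MvPolynomial (Fin (n + 1)) ℂ)) (frac n k j) *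
        algebraMap (MvPolynomial (Fin (n + 1)) ℂ) _ (MvPolynomial.X k) =
      algebraMap (MvPolynomial (Fin (n + 1)) ℂ) _ (MvPolynomial.X j) := by
  have h := IsLocalization.mk'_spec (Localization.Away (MvPolynomial.X k : MvPolynomial (Fin (n + 1)) ℂ))
    (MvPolynomial.X j) (⟨MvPolynomial.X k ^ 1, 1, rfl⟩ :
      Submonoid.powers (MvPolynomial.X k : MvPolynomial (Fin (n + 1)) ℂ))
  rw [HomogeneousLocalization.algebraMap_apply, frac, HomogeneousLocalization.Away.val_mk,
    Localization.mk_eq_mk']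
  simpa only [pow_one] using h

lemma coordsHom_frac (φ : ℂ →+* R) (a : Fin (n + 1) → R) (k : Fin (n + 1)) (hk : IsUnit (a k))
    (j : Fin (n + 1)) : (coordsHom φ a k hk).hom (frac n k j) * a k = a j := by
  have hu : IsUnit (MvPolynomial.eval₂Hom φ a (MvPolynomial.X k)) := by simpa using hk
  have h₂ := congrArg (IsLocalization.Away.lift (S := Localization.Away (MvPolynomial.X k))
    (g := MvPolynomial.eval₂Hom φ a) (MvPolynomial.X k) hu) (algebraMap_frac_mul k j)
  rw [map_mul, IsLocalization.Away.lift_eq, IsLocalization.Away.lift_eq, MvPolynomial.eval₂Hom_X',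
    MvPolynomial.eval₂Hom_X'] at h₂
  exact h₂

end

end Chart

end Fano

namespace Fano

/-! ### Points of `ℙⁿ` and lines -/

variable {n : ℕ} {R S : CommRingCat.{0}}

section Lines

/-- `s` is a dual frame of a submodule `L` of `R^{n+1}` of rank one. -/
structure IsFrame {R : Type} [CommRing R] (L : Submodule R (Fin (n + 1) → R))
    (s : Fin (n + 1) → (Fin (n + 1) → R)) : Prop where
  mem : ∀ k, s k ∈ L
  sum_eq_one : ∑ k, s k k = 1
  swap : ∀ u ∈ L, ∀ v ∈ L, ∀ k l, u k * v l = u l * v k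

variable {A : Type} [CommRing A] {L L' : Submodule A (Fin (n + 1) → A)}
  {s : Fin (n + 1) → (Fin (n + 1) → A)}

/-- Vanishing of the minors against the frame, with `∑ s_k k = 1`, gives `v = ∑ v_k s_k`. Membership
in a line thus becomes a system of equations, which can be tested locally. -/
lemma IsFrame.mem_of_cross (h : IsFrame L s) {v : Fin (n + 1) → A}
    (hv : ∀ k m l, s k m * v l = s k l * v m) : v ∈ L := by
  have : v = ∑ k, v k • s k := by
    funext l
    rw [Finset.sum_apply]
    calc v l = ∑ k, s k k * v l := by rw [← Finset.sum_mul, h.sum_eq_one, one_mul]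
      _ = _ := Finset.sum_congr rfl fun k _ => by
        rw [hv k k l, Pi.smul_apply, smul_eq_mul, mul_comm]
  rw [this]
  exact Submodule.sum_mem _ fun k _ => L.smul_mem _ (h.mem k)

lemma IsFrame.span_eq_top (h : IsFrame L s) : Ideal.span (Set.range fun k => s k k) = ⊤ := by
  rw [Ideal.eq_top_iff_one, ← h.sum_eq_one]
  exact sum_mem fun k _ => Ideal.subset_span ⟨k, rfl⟩

lemma exists_isFrame_tautLine (x : Spec R ⟶ P n) : ∃ s, IsFrame (tautLine x) s := by
  obtain ⟨s, hs⟩ := exists_frame x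
  refine ⟨fun k => tautMap x (s k), fun k => ⟨s k, rfl⟩, hs, ?_⟩
  rintro _ ⟨t, rfl⟩ _ ⟨u, rfl⟩ k l
  exact (tautCoord_mul_swap t u k l).trans (mul_comm _ _)

/-- A line subbundle is a direct summand, and `s_k` is the projection of the `k`-th unit vector to
it. The sum of the diagonal entries is the trace of a projection of rank one. -/
lemma exists_isFrame (h : OModule.IsLineSubbundle L) : ∃ s, IsFrame L s := by
  obtain ⟨hp, hr⟩ := h
  obtain ⟨σ, hσ⟩ := Module.projective_lifting_property L.mkQ LinearMap.id L.mkQ_surjective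
  have hσ' (v : Fin (n + 1) → A) : v - σ (L.mkQ v) ∈ L := by
    refine (Submodule.Quotient.mk_eq_zero L).1 ?_
    change L.mkQ (v - σ (L.mkQ v)) = 0
    rw [map_sub, sub_eq_zero]
    exact (congrArg (fun f => f (L.mkQ v)) hσ).symm
  let π : (Fin (n + 1) → A) →ₗ[A] L :=
    LinearMap.codRestrict L (LinearMap.id - σ ∘ₗ L.mkQ) hσ'
  have hπ (v : L) : π v = v := Subtype.ext (by
    have : L.mkQ v = 0 := (Submodule.Quotient.mk_eq_zero _).2 v.2
    change (v : Fin (n + 1) → A) - σ (L.mkQ v) = v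
    rw [this, map_zero, sub_zero])
  have : Module.Finite A L := Module.Finite.of_surjective π fun v => ⟨v, hπ v⟩
  have : Module.Projective A L := Module.Projective.of_split L.subtype π (LinearMap.ext hπ)
  have swap (u v : L) (k : Fin (n + 1)) : u.1 k • v = v.1 k • u :=
    swap_of_rank_one hr (LinearMap.proj k ∘ₗ L.subtype) u v
  have hsum (v : L) : v = ∑ k, v.1 k • π (Pi.single k 1) := by
    conv_lhs => rw [← hπ v, pi_eq_sum_univ' v.1]
    rw [map_sum]
    refine Finset.sum_congr rfl fun k _ => ?_
    rw [map_smul]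
  refine ⟨fun k => (π (Pi.single k 1)).1, fun k => (π (Pi.single k 1)).2, ?_, ?_⟩
  -- The trace acts as the identity on the line: swapping turns `(∑ s_k k) v` into `∑ v_k s_k = v`.
  · refine eq_one_of_rank_one hr fun v => ?_
    conv_rhs => rw [hsum v]
    rw [Finset.sum_smul]
    exact Finset.sum_congr rfl fun k _ => swap _ _ _
  · intro u hu v hv k l
    exact congrArg (fun w : L => w.1 l) (swap ⟨u, hu⟩ ⟨v, hv⟩ k) |>.trans (mul_comm _ _)

end Lines

lemma map_mem_tautLine {f : R ⟶ S} {x : Spec R ⟶ P n} {y : Spec S ⟶ P n}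
    (h : Spec.map f ≫ x = y) {v : Fin (n + 1) → R} (hv : v ∈ tautLine x) :
    (fun k => f.hom (v k)) ∈ tautLine y := by
  obtain ⟨t, rfl⟩ := hv
  exact ⟨pullTwist (-1) f x y h t, ((taut n).naturality f x y h t).symm⟩

/-- Both points lie in the chart `X_k ≠ 0`, where their coordinates `X_j / X_k` are the quotients
`v_j / v_k`; the hypothesis on structure morphisms takes care of the constants. -/
lemma eq_of_isUnit_coord {x x' : Spec R ⟶ P n} (hC : x ≫ P.toC n = x' ≫ P.toC n)
    {v : Fin (n + 1) → R} (hv : v ∈ tautLine x) (hv' : v ∈ tautLine x') {k : Fin (n + 1)}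
    (hk : IsUnit (v k)) : x = x' := by
  obtain ⟨t, rfl⟩ := hv
  obtain ⟨t', ht⟩ := hv'
  have ht' (j) : tautCoord x' t' j = tautCoord x t j := congrFun ht j
  have hk' : IsUnit (tautCoord x t k) := hk
  obtain ⟨ψ, rfl⟩ := exists_chart (dom_eq_top_of_isUnit hk')
  obtain ⟨ψ', rfl⟩ := exists_chart (dom_eq_top_of_isUnit (x := x') (t := t') (k := k)
    (by rw [ht' k]; exact hk'))
  congr 2
  refine coords_hom_ext ?_ fun j => ?_
  · rw [Category.assoc, Category.assoc, chartι_toC, ← Spec.map_comp, ← Spec.map_comp] at hC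
    exact congrArg CommRingCat.Hom.hom (Spec.map_injective hC)
  · refine hk'.mul_right_cancel ?_
    exact (tautCoord_chart rfl t j).symm.trans ((ht' j).symm.trans
      ((tautCoord_chart rfl t' j).trans (congrArg (_ * ·) (ht' k))))

/-- A point of `ℙⁿ` is determined by its line and its structure morphism. -/
theorem eq_of_tautLine {x x' : Spec R ⟶ P n} (hC : x ≫ P.toC n = x' ≫ P.toC n)
    (hL : tautLine x ≤ tautLine x') : x = x' := by
  obtain ⟨s, hs⟩ := exists_isFrame_tautLine x
  refine hom_ext_of_span _ hs.span_eq_top fun k => ?_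
  refine eq_of_isUnit_coord (v := fun l => (awayMap (s k k)).hom (s k l)) (k := k) ?_
    (map_mem_tautLine rfl (hs.mem k)) (map_mem_tautLine rfl (hL (hs.mem k))) (isUnit_awayMap _)
  rw [Category.assoc, Category.assoc, hC]

/-- The point `[a_0 : … : a_n]`, with `a_k` invertible. -/
def pt (φ : ℂ →+* R) (a : Fin (n + 1) → R) (k : Fin (n + 1)) (hk : IsUnit (a k)) : Spec R ⟶ P n :=
  Spec.map (coordsHom φ a k hk) ≫ chartι n k

lemma pt_toC (φ : ℂ →+* R) (a : Fin (n + 1) → R) (k : Fin (n + 1)) (hk : IsUnit (a k)) :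
    pt φ a k hk ≫ P.toC n = Spec.map (CommRingCat.ofHom φ) := by
  rw [pt, Category.assoc, chartι_toC, ← Spec.map_comp]
  congr 1
  exact CommRingCat.hom_ext (RingHom.ext fun c => coordsHom_const φ a k hk c)

lemma tautLine_pt (φ : ℂ →+* R) (a : Fin (n + 1) → R) (k : Fin (n + 1)) (hk : IsUnit (a k)) :
    tautLine (pt φ a k hk) = Submodule.span R {a} := by
  rw [tautLine_chart (x := pt φ a k hk) (ψ := coordsHom φ a k hk) rfl]
  have : a = a k • fun j => (coordsHom φ a k hk).hom (frac n k j) :=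
    funext fun j => (coordsHom_frac φ a k hk j).symm.trans (mul_comm _ _)
  conv_rhs => rw [this]
  exact (Submodule.span_singleton_smul_eq hk _).symm

/-- Every line subbundle of `R^{n+1}` is the line of a point of `ℙⁿ`. -/
theorem exists_point (φ : ℂ →+* R) {L : Submodule R (Fin (n + 1) → R)}
    (hL : OModule.IsLineSubbundle L) :
    ∃ x : Spec R ⟶ P n, x ≫ P.toC n = Spec.map (CommRingCat.ofHom φ) ∧ tautLine x = L := by
  obtain ⟨s, hs⟩ := exists_isFrame hL
  -- Where `s_k k` is invertible, the line is generated by `s_k` and defines a point of the `k`-th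
  -- chart.
  let f (k : Fin (n + 1)) : Spec (CommRingCat.of (Localization.Away (s k k))) ⟶ P n :=
    pt ((awayMap (s k k)).hom.comp φ) (fun l => (awayMap (s k k)).hom (s k l)) k (isUnit_awayMap _)
  have mem (k : Fin (n + 1)) (v : Fin (n + 1) → R) (hv : v ∈ L) :
      (fun l => (awayMap (s k k)).hom (v l)) ∈ tautLine (f k) := by
    rw [tautLine_pt]
    obtain ⟨u, hu⟩ := isUnit_awayMap (s k k)
    refine Submodule.mem_span_singleton.2 ⟨↑u⁻¹ * (awayMap (s k k)).hom (v k), funext fun l => ?_⟩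
    have := congrArg (awayMap (s k k)).hom (hs.swap _ (hs.mem k) v hv k l)
    rw [map_mul, map_mul, ← hu] at this
    change ↑u⁻¹ * (awayMap (s k k)).hom (v k) * (awayMap (s k k)).hom (s k l) = _
    rw [mul_assoc, mul_comm ((awayMap (s k k)).hom (v k)), ← this, Units.inv_mul_cancel_left]
  -- Over a common algebra the `i`-th and the `j`-th point agree, because the lines of both contain
  -- the image of `s_i`, whose `i`-th coordinate is invertible.
  obtain ⟨x, hx⟩ := exists_hom_of_span _ hs.span_eq_top f fun i j T a b hab => by
    refine eq_of_isUnit_coord (v := fun l => a.hom ((awayMap (s i i)).hom (s i l))) (k := i) ?_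
      (map_mem_tautLine rfl (mem i _ (hs.mem i))) ?_ ((isUnit_awayMap _).map a.hom)
    · rw [Category.assoc, Category.assoc, pt_toC, pt_toC, ← Spec.map_comp, ← Spec.map_comp]
      exact congrArg (fun g => Spec.map (CommRingCat.ofHom φ ≫ g)) hab
    · have e (r : R) : a.hom ((awayMap (s i i)).hom r) = b.hom ((awayMap (s j j)).hom r) :=
        congrArg (fun g => g.hom r) hab
      simp only [e]
      exact map_mem_tautLine rfl (mem j _ (hs.mem i))
  refine ⟨x, ?_, ?_⟩
  · refine hom_ext_of_span _ hs.span_eq_top fun k => ?_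
    rw [← Category.assoc, hx k, pt_toC, ← Spec.map_comp]
    rfl
  -- Locally vectors of both lines lie in the line of `f k`, so all minors vanish. As each line has
  -- a frame, each contains the other.
  have cross (u v : Fin (n + 1) → R) (hu : u ∈ tautLine x) (hv : v ∈ L) (m l : Fin (n + 1)) :
      u m * v l = u l * v m := by
    refine eq_of_awayMap _ hs.span_eq_top fun k => ?_
    obtain ⟨r, hr⟩ := exists_isFrame_tautLine (f k)
    rw [map_mul, map_mul]
    exact hr.swap _ (map_mem_tautLine (hx k) hu) _ (mem k v hv) m l
  refine le_antisymm (fun u hu => hs.mem_of_cross fun k m l => ?_) fun v hv => ?_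
  · have := cross u _ hu (hs.mem k) l m
    linear_combination this
  · obtain ⟨r, hr⟩ := exists_isFrame_tautLine x
    exact hr.mem_of_cross fun k m l => cross _ v (hr.mem k) hv m l

end Fano

namespace Fano

/-! ### Zero loci of sections of locally free modules -/

section Content

variable {R S M N : Type} [CommRing R] [CommRing S] [AddCommGroup M] [Module R M]
  [AddCommGroup N] [Module S N]

/-- The ideal of the values of all functionals on an element. -/
def content (R : Type) {M : Type} [CommRing R] [AddCommGroup M] [Module R M] (m : M) : Ideal R :=
  LinearMap.range (Module.Dual.eval R M m)

lemma apply_mem_content (α : M →ₗ[R] R) (m : M) : α m ∈ content R m := ⟨α, rfl⟩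

lemma exists_dual_basis [Module.Finite R M] [Module.Projective R M] : ∃ (n : ℕ) (e : Fin n → M)
    (α : Fin n → M →ₗ[R] R), ∀ m, ∑ i, α i m • e i = m := by
  obtain ⟨n, f, g, -, -, h⟩ := Module.Finite.exists_comp_eq_id_of_projective R M
  refine ⟨n, fun i => f (Pi.single i 1), fun i => LinearMap.proj i ∘ₗ g, fun m => ?_⟩
  have := congrArg (fun k => k m) h
  conv_rhs => rw [← show f (g m) = m from this, pi_eq_sum_univ' (g m), map_sum]
  simp

lemma content_eq_bot [Module.Finite R M] [Module.Projective R M] {m : M} :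
    content R m = ⊥ ↔ m = 0 := by
  constructor
  · intro h
    obtain ⟨n, e, α, hα⟩ := exists_dual_basis (R := R) (M := M)
    rw [← hα m]
    refine Finset.sum_eq_zero fun i _ => ?_
    have : α i m ∈ (⊥ : Ideal R) := h ▸ apply_mem_content (α i) m
    rw [(Submodule.mem_bot R).1 this, zero_smul]
  · rintro rfl
    rw [content, map_zero, LinearMap.range_zero]

/-- Functionals on `M` extend to `N`, and conversely a dual basis of `M` writes the value of a
functional on `φ m` as a combination of values `f (α_i m)`. This compatibility makes the content of
a section an ideal sheaf. -/
lemma map_content [Module.Finite R M] [Module.Projective R M] {f : R →+* S} {φ : M →ₛₗ[f] N}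
    (h : OModule.IsBaseChangeMap f φ) (m : M) : (content R m).map f = content S (φ m) := by
  refine le_antisymm (Ideal.map_le_iff_le_comap.2 ?_) ?_
  · rintro _ ⟨α, rfl⟩
    obtain ⟨β, hβ⟩ := IsBaseChangeMap.exists_functional h α
    exact ⟨β, hβ m⟩
  · rintro _ ⟨β, rfl⟩
    obtain ⟨n, e, α, hα⟩ := exists_dual_basis (R := R) (M := M)
    have e : β (φ m) = ∑ i, f (α i m) * β (φ (e i)) := by
      conv_lhs => rw [← hα m]
      simp
    change β (φ m) ∈ _
    rw [e]
    refine sum_mem fun i _ => ?_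
    exact Ideal.mul_mem_right _ _ (Ideal.mem_map_of_mem f (apply_mem_content (α i) m))

end Content

section Affine

variable {R : CommRingCat.{0}}

/-- The ring homomorphism of the restriction to `D(g)`. -/
def resMap (g : R) : R ⟶ Γ(Spec R, basic g) :=
  (Scheme.ΓSpecIso R).inv ≫ (Spec R).presheaf.map (homOfLE le_top).op

lemma isAffineOpen_basic (g : R) : IsAffineOpen (basic g) := by
  rw [basic, ← basicOpen_eq_of_affine]
  exact (isAffineOpen_top (Spec R)).basicOpen _

lemma fromSpec_basic (g : R) : (isAffineOpen_basic g).fromSpec = Spec.map (resMap g) := by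
  rw [← IsAffineOpen.map_fromSpec (isAffineOpen_top (Spec R)) (isAffineOpen_basic g)
    (homOfLE le_top).op, IsAffineOpen.fromSpec_top, Scheme.isoSpec_Spec_inv, ← Spec.map_comp]
  rfl

lemma exists_basic_le {V : (Spec R).Opens} {p : Spec R} (hp : p ∈ V) :
    ∃ g : R, p ∈ basic g ∧ basic g ≤ V := by
  obtain ⟨_, ⟨⟨_, ⟨g, rfl⟩, rfl⟩, hpg, hg⟩⟩ :=
    TopologicalSpace.IsTopologicalBasis.exists_subset_of_mem_open
      (PrimeSpectrum.isBasis_basic_opens (R := R)) (show p ∈ (V.1 : Set (PrimeSpectrum R)) from hp)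
      V.2
  exact ⟨g, hpg, hg⟩

lemma eq_zero_of_res {V : (Spec R).Opens} {z : Γ(Spec R, V)}
    (h : ∀ p ∈ V, ∃ g : R, p ∈ basic g ∧ ∃ hg : basic g ≤ V, res hg z = 0) : z = 0 := by
  choose g hp hg hz using h
  refine TopCat.Sheaf.eq_of_locally_eq' (Spec R).sheaf (fun p : V => basic (g p.1 p.2)) V
    (fun p => homOfLE (hg p.1 p.2)) (fun p hpV => TopologicalSpace.Opens.mem_iSup.2
      ⟨⟨p, hpV⟩, hp p hpV⟩) z 0 fun p => ?_
  exact (hz p.1 p.2).trans (map_zero (res (hg p.1 p.2))).symm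

end Affine

namespace OModule

variable {X : Scheme.{0}} {q : X ⟶ Spec (.of ℂ)} {E : OModule X}

/-- Elements of a locally free module that vanish locally are zero. -/
lemma IsLocFree.eq_zero_of_cover (hE : E.IsLocFree) {R : CommRingCat.{0}} {x : Spec R ⟶ X}
    {ι : Type} {g : ι → R} (hg : Ideal.span (Set.range g) = ⊤) {m : E.obj x}
    (h : ∀ i, E.map (awayMap (g i)) x (Spec.map (awayMap (g i)) ≫ x) rfl m = 0) : m = 0 := by
  have := hE.2 x
  have := hE.3 x
  refine (content_eq_bot (R := R)).1 ((Submodule.eq_bot_iff _).2 ?_)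
  rintro _ ⟨α, rfl⟩
  refine eq_of_awayMap g hg fun i => ?_
  obtain ⟨β, hβ⟩ := IsBaseChangeMap.exists_functional (hE.1 (awayMap (g i)) x _ rfl) α
  refine (hβ m).symm.trans ?_
  rw [h i, map_zero, map_zero]

lemma map_content_section (hE : E.IsLocFree) (s : E.H0 q) {R S : CommRingCat.{0}} (f : R ⟶ S)
    (x : Spec R ⟶ X) (y : Spec S ⟶ X) (h : Spec.map f ≫ x = y) :
    (content R (s.1 R x)).map f.hom = content S (s.1 S y) := by
  have := hE.2 x
  have := hE.3 x
  rw [map_content (hE.1 f x y h), s.2 R S f x y h]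

/-- The ideal sheaf of the zero locus of a section. -/
def zeroIdeal (hE : E.IsLocFree) (s : E.H0 q) : X.IdealSheafData where
  ideal U := content Γ(X, U.1) (s.1 _ U.2.fromSpec)
  map_ideal_basicOpen U f := map_content_section hE s _ _ _
    (IsAffineOpen.map_fromSpec U.2 (X.affineBasicOpen f).2 _)

/-- Both sides are the content of the section pulled back to `D(g)`, computed once through the
affine open `U` and once through `Spec R`. -/
lemma map_zeroIdeal (hE : E.IsLocFree) (s : E.H0 q) {R : CommRingCat.{0}} (x : Spec R ⟶ X)
    (U : X.affineOpens) (g : R) (hg : basic g ≤ x ⁻¹ᵁ U.1) :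
    ((zeroIdeal hE s).ideal U).map (x.appLE U.1 (basic g) hg).hom =
      (content R (s.1 R x)).map (algebraMap R Γ(Spec R, basic g)) := by
  refine (map_content_section hE s (x.appLE U.1 (basic g) hg) U.2.fromSpec
    (Spec.map (resMap g) ≫ x) ?_).trans (map_content_section hE s (resMap g) x _ rfl).symm
  rw [IsAffineOpen.SpecMap_appLE_fromSpec x U.2 (isAffineOpen_basic g), fromSpec_basic]

lemma appLE_eq_res {R : CommRingCat.{0}} (x : Spec R ⟶ X) {U : X.Opens} {V : (Spec R).Opens}
    (h : V ≤ x ⁻¹ᵁ U) (a : Γ(X, U)) : (x.appLE U V h).hom a = res h ((x.app U).hom a) := rfl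

/-- A point factors through the closed subscheme exactly when the ideals pull back to zero. On small
`D(g)` they pull back to the content of the section at the point, and an element of a projective
module with zero content is zero. -/
theorem isZeroLocus_zeroIdeal (hE : E.IsLocFree) (s : E.H0 q) :
    IsZeroLocus s (zeroIdeal hE s).subschemeι := by
  refine ⟨inferInstance, fun {R} x => ⟨?_, fun h => ?_⟩⟩
  · rintro ⟨y, rfl⟩
    have := hE.2 (y ≫ (zeroIdeal hE s).subschemeι)
    have := hE.3 (y ≫ (zeroIdeal hE s).subschemeι)
    refine (content_eq_bot (R := R)).1 ((Submodule.eq_bot_iff _).2 fun a ha => ?_)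
    set x := y ≫ (zeroIdeal hE s).subschemeι with hx
    have key : algebraMap R Γ(Spec R, ⊤) a = 0 := by
      refine eq_zero_of_res fun p _ => ?_
      obtain ⟨_, ⟨U, hU, rfl⟩, hpU, -⟩ :=
        X.isBasis_affineOpens.exists_subset_of_mem_open (Set.mem_univ (x p)) isOpen_univ
      obtain ⟨g, hpg, hg⟩ := exists_basic_le (V := x ⁻¹ᵁ U) hpU
      refine ⟨g, hpg, le_top, ?_⟩
      rw [res_algebraMap]
      have hmem := Ideal.mem_map_of_mem (algebraMap R Γ(Spec R, basic g)) ha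
      rw [← map_zeroIdeal hE s x ⟨U, hU⟩ g hg] at hmem
      refine (Submodule.mem_bot _).1 ((Ideal.map_le_iff_le_comap.2 fun b hb => ?_) hmem)
      have hb' : ((zeroIdeal hE s).subschemeι.app U).hom b = 0 := by
        have := Scheme.IdealSheafData.ker_subschemeι_app (zeroIdeal hE s) ⟨U, hU⟩
        exact this.ge hb
      change (x.appLE U (basic g) hg).hom b = 0
      have hx' : (x.app U).hom b = 0 := by
        have e := congrArg (fun φ => φ.hom b)
          (Scheme.Hom.comp_app y (zeroIdeal hE s).subschemeι U)
        exact e.trans ((congrArg (y.app ((zeroIdeal hE s).subschemeι ⁻¹ᵁ U)).hom hb').trans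
          (map_zero _))
      rw [appLE_eq_res, hx', map_zero]
    exact (Scheme.ΓSpecIso R).symm.commRingCatIsoToRingEquiv.injective (key.trans (map_zero _).symm)
  · refine ⟨IsClosedImmersion.lift (zeroIdeal hE s).subschemeι x ?_, IsClosedImmersion.lift_fac _ _ _⟩
    rw [Scheme.IdealSheafData.ker_subschemeι]
    refine Scheme.IdealSheafData.le_ofIdeals_iff.2 fun U a ha => ?_
    refine eq_zero_of_res fun p hp => ?_
    obtain ⟨g, hpg, hg⟩ := exists_basic_le hp
    refine ⟨g, hpg, hg, ?_⟩
    have hmem := Ideal.mem_map_of_mem (x.appLE U.1 (basic g) hg).hom ha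
    have := hE.2 x
    have := hE.3 x
    rw [map_zeroIdeal hE s x U g hg, content_eq_bot.2 h, Ideal.map_bot] at hmem
    exact (Submodule.mem_bot _).1 hmem

end OModule

end Fano

namespace Fano

/-! ### Homogeneous functions of the homogeneous coordinates -/

open Polynomial LaurentPolynomial in
-- Multiplying `p(T) = T^d q(1/T)` by `T^e`, with `e = deg q`, turns it into `X^e p = X^d q.reverse`
-- between polynomials, whose coefficients are compared.
lemma eq_of_toLaurent_eq {A : Type} [CommRing A] {p q : A[X]} {d : ℕ}
    (h : toLaurent p = T d * invert (toLaurent q)) :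
    (∀ m, d < m → p.coeff m = 0) ∧ p.coeff d = q.coeff 0 := by
  have h₁ : Polynomial.X ^ q.natDegree * p = Polynomial.X ^ d * q.reverse := by
    refine toLaurent_injective ?_
    rw [map_mul, map_mul, toLaurent_reverse, h, toLaurent_X_pow, toLaurent_X_pow]
    ring
  have h₂ (m : ℕ) : p.coeff m = (Polynomial.X ^ d * q.reverse).coeff (m + q.natDegree) := by
    rw [← h₁, coeff_X_pow_mul]
  refine ⟨fun m hm => ?_, ?_⟩
  · rw [h₂, show m + q.natDegree = (m - d + q.natDegree) + d by omega, coeff_X_pow_mul,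
      coeff_eq_zero_of_natDegree_lt]
    exact (reverse_natDegree_le q).trans_lt (by omega)
  · rw [h₂, add_comm, coeff_X_pow_mul, coeff_reverse, revAt_le le_rfl, Nat.sub_self]

/-- A function of the homogeneous coordinates of a point, over the algebras over a ring. -/
structure CoordFun (R : CommRingCat.{0}) (n : ℕ) where
  val : ∀ {S : CommRingCat.{0}} (_ : R ⟶ S) (a : Fin (n + 1) → S), (∃ k, IsUnit (a k)) → S
  nat : ∀ {S S' : CommRingCat.{0}} (f : R ⟶ S) (g : S ⟶ S') (f' : R ⟶ S') (_ : f ≫ g = f')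
    (a : Fin (n + 1) → S) (a' : Fin (n + 1) → S') (_ : ∀ k, g.hom (a k) = a' k)
    (h : ∃ k, IsUnit (a k)) (h' : ∃ k, IsUnit (a' k)), g.hom (val f a h) = val f' a' h'

lemma isUnit_single (S : Type) [CommRing S] {n : ℕ} (j : Fin (n + 1)) :
    ∃ k, IsUnit ((Pi.single j 1 : Fin (n + 1) → S) k) :=
  ⟨j, by simp⟩

namespace CoordFun

variable {R : CommRingCat.{0}} {n : ℕ} (F : CoordFun R n)

/-- Homogeneity of degree `d`. -/
def IsHomog (d : ℕ) : Prop := ∀ {S : CommRingCat.{0}} (f : R ⟶ S) (c : S) (_ : IsUnit c)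
  (a : Fin (n + 1) → S) (h : ∃ k, IsUnit (a k)) (h' : ∃ k, IsUnit ((c • a) k)),
  F.val f (c • a) h' = c ^ d * F.val f a h

lemma val_congr {S : CommRingCat.{0}} {f : R ⟶ S} {a a' : Fin (n + 1) → S} (e : a = a')
    (h : ∃ k, IsUnit (a k)) (h' : ∃ k, IsUnit (a' k)) : F.val f a h = F.val f a' h' := by
  subst e
  rfl

/-- The value at the `j`-th unit vector. -/
def unitVal (j : Fin (n + 1)) : R := F.val (𝟙 R) (Pi.single j 1) (isUnit_single R j)

open Polynomial LaurentPolynomial in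
-- Naturality makes the restriction of `F` to the line `a + c e_j` a polynomial `p`: it is the value
-- at `a + X e_j` over `R[X]`. Let `q` be the value at `X a + e_j`. Over Laurent polynomials `a + T
-- e_j = T (T⁻¹ a + e_j)`, and homogeneity gives `p(T) = T^d q(T⁻¹)`; the top coefficient of `p` is
-- `q(0)`, the value at `e_j`.
lemma exists_polynomial {d : ℕ} (hF : F.IsHomog d) (a : Fin (n + 1) → R)
    {k j : Fin (n + 1)} (hk : IsUnit (a k)) (hj : a j = 0) : ∃ p : R[X],
      (∀ (c : R) (h : ∃ k, IsUnit ((a + c • (Pi.single j 1 : Fin (n + 1) → R)) k)),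
        p.eval c = F.val (𝟙 R) (a + c • (Pi.single j 1 : Fin (n + 1) → R)) h) ∧
      (∀ m, d < m → p.coeff m = 0) ∧ p.coeff d = F.unitVal j := by
  obtain hR | hR := subsingleton_or_nontrivial R
  · exact ⟨0, fun _ _ => Subsingleton.elim _ _, fun _ _ => Subsingleton.elim _ _,
      Subsingleton.elim _ _⟩
  -- This is where `R` has to be nontrivial: the unit `a k` cannot be the zero coordinate `a j`.
  have hkj : k ≠ j := by
    rintro rfl
    rw [hj] at hk
    exact not_isUnit_zero hk
  let ι : R ⟶ CommRingCat.of R[X] := CommRingCat.ofHom Polynomial.C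
  let tl : CommRingCat.of R[X] ⟶ CommRingCat.of R[T;T⁻¹] := CommRingCat.ofHom toLaurent
  let inv : CommRingCat.of R[T;T⁻¹] ⟶ CommRingCat.of R[T;T⁻¹] :=
    CommRingCat.ofHom (invert (R := R)).toRingEquiv.toRingHom
  let b : Fin (n + 1) → R[X] := fun i => Polynomial.C (a i) + Polynomial.X * (Pi.single j 1 : Fin (n + 1) → R[X]) i
  let b' : Fin (n + 1) → R[X] := fun i => Polynomial.X * Polynomial.C (a i) + (Pi.single j 1 : Fin (n + 1) → R[X]) i
  have hb : ∃ k, IsUnit (b k) := ⟨k, by simpa [b, hkj] using hk⟩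
  have hb' : ∃ k, IsUnit (b' k) := ⟨j, by simp [b', hj]⟩
  let p : R[X] := F.val ι b hb
  let q : R[X] := F.val ι b' hb'
  let a₁ : Fin (n + 1) → R[T;T⁻¹] := fun i => toLaurent (b i)
  let a₂ : Fin (n + 1) → R[T;T⁻¹] := fun i => invert (toLaurent (b' i))
  have h₁ : ∃ k, IsUnit (a₁ k) := hb.imp fun k hk => hk.map toLaurent
  have h₂ : ∃ k, IsUnit (a₂ k) := hb'.imp fun k hk => (hk.map toLaurent).map (invert (R := R))
  have ea : a₁ = (T 1 : R[T;T⁻¹]) • a₂ := by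
    funext i
    have : (T 1 : R[T;T⁻¹]) * T (-1) = 1 := by rw [← T_add]; simp
    by_cases hi : i = j
    · subst hi
      simp [a₁, a₂, b, b', hj]
    · simp [a₁, a₂, b, b', hi, ← mul_assoc]
  have hpq : toLaurent p = T d * invert (toLaurent q) := by
    have e₁ : toLaurent p = F.val (S := .of R[T;T⁻¹]) (ι ≫ tl) a₁ h₁ :=
      F.nat ι tl _ rfl b a₁ (fun _ => rfl) hb h₁
    have e₂ : invert (toLaurent q) = F.val (S := .of R[T;T⁻¹]) (ι ≫ tl) a₂ h₂ :=
      F.nat ι (tl ≫ inv) (ι ≫ tl) (CommRingCat.hom_ext (RingHom.ext fun r => by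
        change invert (toLaurent (Polynomial.C r)) = toLaurent (Polynomial.C r)
        simp)) b' a₂ (fun _ => rfl) hb' h₂
    have h₁' : ∃ k, IsUnit (((T 1 : R[T;T⁻¹]) • a₂) k) := ea ▸ h₁
    rw [e₁, e₂, F.val_congr (S := .of R[T;T⁻¹]) ea h₁ h₁']
    refine (hF (S := .of R[T;T⁻¹]) (ι ≫ tl) (T 1) (isUnit_T 1) a₂ h₂ h₁').trans ?_
    congr 1
    change (T 1 : R[T;T⁻¹]) ^ d = T d
    rw [T_pow]
    simp
  obtain ⟨H₁, H₂⟩ := eq_of_toLaurent_eq hpq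
  refine ⟨p, fun c h => ?_, H₁, H₂.trans ?_⟩
  · refine F.nat ι (CommRingCat.ofHom (Polynomial.evalRingHom c)) (𝟙 R)
      (CommRingCat.hom_ext (RingHom.ext fun r => by
        change Polynomial.eval c (Polynomial.C r) = r
        simp)) b _ (fun i => ?_) hb h
    change Polynomial.eval c (b i) = _
    by_cases hi : i = j
    · subst hi
      simp [b]
    · simp [b, hi]
  · rw [Polynomial.coeff_zero_eq_eval_zero]
    refine F.nat ι (CommRingCat.ofHom (Polynomial.evalRingHom 0)) (𝟙 R)
      (CommRingCat.hom_ext (RingHom.ext fun r => by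
        change Polynomial.eval 0 (Polynomial.C r) = r
        simp)) b' _ (fun i => ?_) hb' _
    change Polynomial.eval 0 (b' i) = _
    by_cases hi : i = j
    · subst hi
      simp [b', hj]
    · simp [b', hi]

/-- As a function of its `j`-th coordinate, `F` is a polynomial of degree `0`, equal to its
coefficient `F(e_j)`. The condition `k ≠ j` keeps a coordinate invertible when the `j`-th one is set
to zero. -/
lemma val_of_homog_zero_aux (hF : F.IsHomog 0) (a : Fin (n + 1) → R) {k j : Fin (n + 1)}
    (hkj : k ≠ j) (hk : IsUnit (a k)) (h : ∃ k, IsUnit (a k)) :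
    F.val (𝟙 R) a h = F.unitVal j := by
  have hk' : IsUnit (Function.update a j 0 k) := by rwa [Function.update_of_ne hkj]
  obtain ⟨p, hp, hm, hd⟩ := F.exists_polynomial hF (Function.update a j 0) hk' (j := j) (by simp)
  have e : Function.update a j 0 + a j • (Pi.single j 1 : Fin (n + 1) → R) = a := by
    ext i
    by_cases hi : i = j
    · subst hi
      simp
    · simp [hi]
  rw [← hd, ← F.val_congr e (e.symm ▸ h) h, ← hp (a j) (e.symm ▸ h),
    Polynomial.eq_C_of_natDegree_le_zero (Polynomial.natDegree_le_iff_coeff_eq_zero.2 hm)]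
  simp

/-- Functions that are homogeneous of degree `0` are constant. -/
lemma val_of_homog_zero (hn : n ≠ 0) (hF : F.IsHomog 0) (a : Fin (n + 1) → R)
    (h : ∃ k, IsUnit (a k)) (j : Fin (n + 1)) : F.val (𝟙 R) a h = F.unitVal j := by
  have : Nontrivial (Fin (n + 1)) := Fin.nontrivial_iff_two_le.2 (by omega)
  obtain ⟨k, hk⟩ := h
  -- The given index may be `k` itself. The value at `a` is therefore compared with `F(e_i)` for
  -- some other `i`, and then `F(e_i)` with `F(e_j)`.
  obtain ⟨i, hi⟩ := exists_ne k
  rw [F.val_of_homog_zero_aux hF a hi.symm hk]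
  by_cases hij : i = j
  · rw [hij]
  · exact (F.val_of_homog_zero_aux hF (Pi.single i 1) hij (by simp) _ :)

/-- Functions that are homogeneous of degree `1` are linear. -/
lemma val_of_homog_one (hF : F.IsHomog 1) (a : Fin (n + 1) → R) (h : ∃ k, IsUnit (a k)) :
    F.val (𝟙 R) a h = ∑ j, a j * F.unitVal j := by
  classical
  obtain ⟨k, hk⟩ := id h
  -- The coordinates other than the invertible `a_k` are switched on one by one. In the new
  -- coordinate `F` is a polynomial of degree at most `1` with leading coefficient `F(e_j)`, so each
  -- step adds `a_j F(e_j)`.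
  have key (s : Finset (Fin (n + 1))) (hs : k ∉ s)
      (h : ∃ l, IsUnit ((fun i => if i ∈ insert k s then a i else 0) l)) :
      F.val (𝟙 R) (fun i => if i ∈ insert k s then a i else 0) h =
        ∑ j ∈ insert k s, a j * F.unitVal j := by
    induction s using Finset.induction_on with
    | empty =>
      have e : (fun i => if i ∈ insert k (∅ : Finset (Fin (n + 1))) then a i else 0) =
          a k • (Pi.single k 1 : Fin (n + 1) → R) := by
        ext i
        by_cases hi : i = k
        · subst hi
          simp
        · simp [hi]
      rw [F.val_congr e h (e ▸ h), hF (𝟙 R) (a k) hk _ (isUnit_single R k)]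
      simp [unitVal]
    | insert j s hj ih =>
      have hks : k ∉ s := fun h => hs (Finset.mem_insert_of_mem h)
      have hkj : j ≠ k := by
        rintro rfl
        exact hs (Finset.mem_insert_self _ _)
      have hj' : j ∉ insert k s := by simp [hkj, hj]
      have h' : ∃ l, IsUnit ((fun i => if i ∈ insert k s then a i else 0) l) := ⟨k, by simpa using hk⟩
      obtain ⟨p, hp, hm, hd⟩ := F.exists_polynomial hF (fun i => if i ∈ insert k s then a i else 0)
        (k := k) (j := j) (by simpa using hk) (by simp [hj, hkj])
      have e : (fun i => if i ∈ insert k s then a i else 0) +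
          a j • (Pi.single j 1 : Fin (n + 1) → R) =
          fun i => if i ∈ insert k (insert j s) then a i else 0 := by
        ext i
        by_cases hi : i = j
        · subst hi
          simp [hj, hkj]
        · simp [hi]
      have e₀ : (fun i => if i ∈ insert k s then a i else 0) +
          (0 : R) • (Pi.single j 1 : Fin (n + 1) → R) =
          fun i => if i ∈ insert k s then a i else 0 := by simp
      have hsum : ∑ i ∈ insert k (insert j s), a i * F.unitVal i =
          a j * F.unitVal j + ∑ i ∈ insert k s, a i * F.unitVal i := by
        rw [Finset.insert_comm, Finset.sum_insert hj']
      rw [hsum, ← ih hks h', ← F.val_congr e (e.symm ▸ h) h,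
        ← F.val_congr e₀ (e₀.symm ▸ h') h', ← hp _ (e.symm ▸ h), ← hp _ (e₀.symm ▸ h'), ← hd,
        Polynomial.eq_X_add_C_of_natDegree_le_one (Polynomial.natDegree_le_iff_coeff_eq_zero.2 hm)]
      simp
      ring
  have hk' : insert k (Finset.univ.erase k) = Finset.univ := Finset.insert_erase (Finset.mem_univ k)
  have e : (fun i => if i ∈ insert k (Finset.univ.erase k) then a i else 0) = a := by simp
  have h' : ∃ l, IsUnit ((fun i => if i ∈ insert k (Finset.univ.erase k) then a i else 0) l) :=
    ⟨k, by simpa using hk⟩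
  refine (F.val_congr e h' h).symm.trans ((key _ (by simp) h').trans ?_)
  rw [hk']

end CoordFun

end Fano

namespace Fano

/-! ### Homogeneous families of elements of a locally free module -/

lemma OModule.map_map {X : Scheme.{0}} (E : OModule X) {R S T : CommRingCat.{0}} {f : R ⟶ S}
    {g : S ⟶ T} {k : R ⟶ T} (hk : f ≫ g = k) {x : Spec R ⟶ X} {y : Spec S ⟶ X} {z : Spec T ⟶ X}
    (hxy : Spec.map f ≫ x = y) (hyz : Spec.map g ≫ y = z) (hxz : Spec.map k ≫ x = z)
    (m : E.obj x) : E.map g y z hyz (E.map f x y hxy m) = E.map k x z hxz m := by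
  subst hk
  exact (E.map_comp f g x y z hxy hyz hxz m).symm

section Dual

variable {R S M N : Type} [CommRing R] [CommRing S] [AddCommGroup M] [Module R M]
  [AddCommGroup N] [Module S N]

lemma eq_of_dual [Module.Finite R M] [Module.Projective R M] {m m' : M}
    (h : ∀ α : M →ₗ[R] R, α m = α m') : m = m' := by
  refine sub_eq_zero.1 ((content_eq_bot (R := R)).1 ((Submodule.eq_bot_iff _).2 ?_))
  rintro _ ⟨α, rfl⟩
  exact (map_sub α m m').trans (sub_eq_zero.2 (h α))

lemma IsBaseChangeMap.span_eq_top {f : R →+* S} {φ : M →ₛₗ[f] N}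
    (h : OModule.IsBaseChangeMap f φ) : Submodule.span S (Set.range φ) = ⊤ := by
  refine (Submodule.ker_mkQ _).symm.trans (LinearMap.ker_eq_top.2 ?_)
  exact IsBaseChangeMap.hom_ext h fun m =>
    (Submodule.Quotient.mk_eq_zero _).2 (Submodule.subset_span ⟨m, rfl⟩)

end Dual

variable {Y : Scheme.{0}}

/-- A compatible family of elements of `E`, depending on the homogeneous coordinates of a point of
`ℙⁿ`. -/
structure CoordFamily (E : OModule Y) (n : ℕ) where
  val : ∀ {S : CommRingCat.{0}} (y : Spec S ⟶ Y) (a : Fin (n + 1) → S), (∃ k, IsUnit (a k)) →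
    E.obj y
  nat : ∀ {S S' : CommRingCat.{0}} (g : S ⟶ S') (y : Spec S ⟶ Y) (y' : Spec S' ⟶ Y)
    (hy : Spec.map g ≫ y = y') (a : Fin (n + 1) → S) (a' : Fin (n + 1) → S')
    (_ : ∀ k, g.hom (a k) = a' k) (h : ∃ k, IsUnit (a k)) (h' : ∃ k, IsUnit (a' k)),
    E.map g y y' hy (val y a h) = val y' a' h'

namespace CoordFamily

variable {E : OModule Y} {n : ℕ} (F : CoordFamily E n)

/-- Homogeneity of degree `d`. -/
def IsHomog (d : ℕ) : Prop := ∀ {S : CommRingCat.{0}} (y : Spec S ⟶ Y) (c : S) (_ : IsUnit c)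
  (a : Fin (n + 1) → S) (h : ∃ k, IsUnit (a k)) (h' : ∃ k, IsUnit ((c • a) k)),
  F.val y (c • a) h' = c ^ d • F.val y a h

/-- The section of the values at a unit vector. -/
def unitVal {R : CommRingCat.{0}} (y : Spec R ⟶ Y) (j : Fin (n + 1)) : E.obj y :=
  F.val y (Pi.single j 1) (isUnit_single R j)

lemma map_unitVal {R S : CommRingCat.{0}} (f : R ⟶ S) (x : Spec R ⟶ Y) (y : Spec S ⟶ Y)
    (h : Spec.map f ≫ x = y) (j : Fin (n + 1)) :
    E.map f x y h (F.unitVal x j) = F.unitVal y j :=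
  F.nat f x y h _ _ (fun k => by rw [Pi.single_apply, Pi.single_apply, apply_ite f.hom, map_one,
    map_zero]) _ _

variable {R : CommRingCat.{0}} {y : Spec R ⟶ Y} (hE : E.IsLocFree) (α : E.obj y →ₗ[R] R)

include hE in
-- A functional at `y` extends uniquely to all base changes, hence compatibly, and composing with it
-- reduces families in `E` to ring-valued functions. Compatibility of the extensions is checked on
-- the generators that come from `E(y)`.
lemma exists_coordFun : ∃ G : CoordFun R n, (∀ a h, G.val (𝟙 R) a h = α (F.val y a h)) ∧
    ∀ d, F.IsHomog d → G.IsHomog d := by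
  choose β hβ using fun {S : CommRingCat.{0}} (f : R ⟶ S) =>
    IsBaseChangeMap.exists_functional (hE.1 f y _ rfl) α
  have key {S S' : CommRingCat.{0}} (f : R ⟶ S) (g : S ⟶ S')
      (e : Spec.map g ≫ Spec.map f ≫ y = Spec.map (f ≫ g) ≫ y) (v : E.obj (Spec.map f ≫ y)) :
      g.hom (β f v) = β (f ≫ g) (E.map g _ _ e v) := by
    have hv : v ∈ Submodule.span S (Set.range (E.map f y _ rfl)) := by
      rw [IsBaseChangeMap.span_eq_top (hE.1 f y _ rfl)]
      trivial
    induction hv using Submodule.span_induction with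
    | mem v hv =>
      obtain ⟨m, rfl⟩ := hv
      refine (congrArg g.hom (hβ f m)).trans ?_
      refine ((hβ (f ≫ g) m).symm.trans ?_)
      exact congrArg (β (f ≫ g)) (E.map_map rfl rfl e rfl m).symm
    | zero => rw [map_zero, map_zero, map_zero, map_zero]
    | add v w _ _ hv hw => rw [map_add, map_add, map_add, map_add, hv, hw]
    | smul r v _ hv =>
      rw [map_smul, smul_eq_mul, map_mul, hv, LinearMap.map_smulₛₗ, map_smul, smul_eq_mul]
  refine ⟨⟨fun f a h => β f (F.val _ a h), ?_⟩, fun a h => ?_, fun d hd => ?_⟩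
  · rintro S S' f g _ rfl a a' ha h h'
    have e : Spec.map g ≫ Spec.map f ≫ y = Spec.map (f ≫ g) ≫ y := by
      rw [← Category.assoc, ← Spec.map_comp]
    exact (key f g e _).trans (congrArg (β (f ≫ g)) (F.nat g _ _ e a a' ha h h'))
  · have e := hβ (𝟙 R) (F.val y a h)
    rw [F.nat (𝟙 R) y _ rfl a a (fun _ => rfl) h h] at e
    exact e
  · intro S f c hc a h h'
    exact (congrArg (β f) (hd (Spec.map f ≫ y) c hc a h h')).trans (map_smul _ _ _)

include hE in
/-- Families that are homogeneous of degree `0` are constant. -/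
theorem val_of_homog_zero (hn : n ≠ 0) (hF : F.IsHomog 0) (a : Fin (n + 1) → R)
    (h : ∃ k, IsUnit (a k)) (j : Fin (n + 1)) : F.val y a h = F.unitVal y j := by
  have := hE.2 y
  have := hE.3 y
  refine eq_of_dual (R := R) fun α => ?_
  obtain ⟨G, hG, hG'⟩ := F.exists_coordFun hE α
  rw [← hG, G.val_of_homog_zero hn (hG' 0 hF) a h j]
  exact hG _ _

include hE in
/-- Families that are homogeneous of degree `1` are linear. -/
theorem val_of_homog_one (hF : F.IsHomog 1) (a : Fin (n + 1) → R) (h : ∃ k, IsUnit (a k)) :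
    F.val y a h = ∑ j, a j • F.unitVal y j := by
  have := hE.2 y
  have := hE.3 y
  refine eq_of_dual (R := R) fun α => ?_
  obtain ⟨G, hG, hG'⟩ := F.exists_coordFun hE α
  rw [← hG, G.val_of_homog_one (hG' 1 hF) a h, map_sum]
  exact Finset.sum_congr rfl fun j _ => by
    rw [map_smul, smul_eq_mul]
    exact congrArg (a j * ·) (hG _ _)

end CoordFamily

/-! ### Points of products with a projective space -/

section Points

variable {n : ℕ} {R S : CommRingCat.{0}}

/-- The point with the given homogeneous coordinates. -/
def coordPt (φ : ℂ →+* R) (a : Fin (n + 1) → R) (h : ∃ k, IsUnit (a k)) : Spec R ⟶ P n :=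
  pt φ a h.choose h.choose_spec

lemma mem_tautLine_coordPt (φ : ℂ →+* R) (a : Fin (n + 1) → R) (h : ∃ k, IsUnit (a k)) :
    a ∈ tautLine (coordPt φ a h) := by
  rw [coordPt, tautLine_pt]
  exact Submodule.mem_span_singleton_self a

lemma coordPt_toC (φ : ℂ →+* R) (a : Fin (n + 1) → R) (h : ∃ k, IsUnit (a k)) :
    coordPt φ a h ≫ P.toC n = Spec.map (CommRingCat.ofHom φ) := pt_toC _ _ _ _

/-- With an invertible coordinate, `u` generates the line: `t = (t X_k / u X_k) u`. -/
lemma eq_sum_of_isUnit_coord {x : Spec R ⟶ P n} {M : Type} [AddCommGroup M] [Module R M]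
    (L : twistSections (-1) x →ₗ[R] M) (m : Fin (n + 1) → M) {u : twistSections (-1) x}
    {k : Fin (n + 1)} (hu : IsUnit (tautCoord x u k)) (h : L u = ∑ j, tautCoord x u j • m j)
    (t : twistSections (-1) x) : L t = ∑ j, tautCoord x t j • m j := by
  obtain ⟨v, hv⟩ := hu
  obtain ⟨c, rfl⟩ : ∃ c : R, c • u = t := by
    refine ⟨↑v⁻¹ * tautCoord x t k, ?_⟩
    rw [mul_smul, tautCoord_swap, ← hv, smul_smul, Units.inv_mul, one_smul]
  rw [map_smul, h, Finset.smul_sum]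
  exact Finset.sum_congr rfl fun j _ => by rw [tautCoord_smul, smul_smul]

variable {X : Scheme.{0}} {q : X ⟶ Y} {p : X ⟶ P n} {qY : Y ⟶ Spec (.of ℂ)}

lemma map_scalar (y : Spec R ⟶ Y) : Spec.map (CommRingCat.ofHom (OModule.scalar qY y)) = y ≫ qY :=
  Spec.map_preimage _

variable (H : IsPullback q p qY (P.toC n))

include H in
lemma eq_of_coord {z z' : Spec R ⟶ X} (hq : z ≫ q = z' ≫ q) {a : Fin (n + 1) → R}
    (ha : a ∈ tautLine (z ≫ p)) (ha' : a ∈ tautLine (z' ≫ p)) (h : ∃ k, IsUnit (a k)) : z = z' := by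
  obtain ⟨k, hk⟩ := h
  refine H.hom_ext hq (eq_of_isUnit_coord ?_ ha ha' hk)
  rw [Category.assoc, Category.assoc, ← H.w, ← Category.assoc, ← Category.assoc, hq]

/-- The point over `y` with the given homogeneous coordinates. -/
def liftPt (y : Spec R ⟶ Y) (a : Fin (n + 1) → R) (h : ∃ k, IsUnit (a k)) : Spec R ⟶ X :=
  H.lift y (coordPt (OModule.scalar qY y) a h) (by rw [coordPt_toC, map_scalar])

lemma liftPt_fst (y : Spec R ⟶ Y) (a : Fin (n + 1) → R) (h : ∃ k, IsUnit (a k)) :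
    liftPt H y a h ≫ q = y := H.lift_fst _ _ _

lemma mem_tautLine_liftPt (y : Spec R ⟶ Y) (a : Fin (n + 1) → R) (h : ∃ k, IsUnit (a k)) :
    a ∈ tautLine (liftPt H y a h ≫ p) := by
  rw [liftPt, H.lift_snd]
  exact mem_tautLine_coordPt _ a h

lemma map_liftPt (g : R ⟶ S) {y : Spec R ⟶ Y} {y' : Spec S ⟶ Y} (hy : Spec.map g ≫ y = y')
    {a : Fin (n + 1) → R} {a' : Fin (n + 1) → S} (ha : ∀ k, g.hom (a k) = a' k)
    (h : ∃ k, IsUnit (a k)) (h' : ∃ k, IsUnit (a' k)) :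
    Spec.map g ≫ liftPt H y a h = liftPt H y' a' h' := by
  obtain rfl : (fun k => g.hom (a k)) = a' := funext ha
  refine eq_of_coord H ?_ (map_mem_tautLine (by rw [Category.assoc]) (mem_tautLine_liftPt H y a h))
    (mem_tautLine_liftPt H y' _ h') h'
  rw [Category.assoc, liftPt_fst, liftPt_fst, hy]

/-- The section of `𝒪(-1)` with the given coordinates. -/
def liftTaut (y : Spec R ⟶ Y) (a : Fin (n + 1) → R) (h : ∃ k, IsUnit (a k)) :
    twistSections (-1) (liftPt H y a h ≫ p) := (mem_tautLine_liftPt H y a h).choose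

lemma tautMap_liftTaut (y : Spec R ⟶ Y) (a : Fin (n + 1) → R) (h : ∃ k, IsUnit (a k)) :
    tautMap _ (liftTaut H y a h) = a := (mem_tautLine_liftPt H y a h).choose_spec

end Points

section Families

variable {n : ℕ} {X : Scheme.{0}} {q : X ⟶ Y} {p : X ⟶ P n} {qY : Y ⟶ Spec (.of ℂ)}
  (H : IsPullback q p qY (P.toC n)) {E : OModule Y}

/-- The value of `A : p^* 𝒪(-1) → q^* E` at a point with given homogeneous coordinates. -/
def homFamily (A : (O n (-1)).pullback p ⟶ E.pullback q) : CoordFamily E n where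
  val {S} y a h := E.map (𝟙 S) _ y (by rw [Spec.map_id, Category.id_comp, liftPt_fst])
    (A.app (liftPt H y a h) (liftTaut H y a h))
  nat {S S'} g y y' hy a a' ha h h' := by
    have e : pullTwist (-1) g (liftPt H y a h ≫ p) (liftPt H y' a' h' ≫ p)
        (by rw [← map_liftPt H g hy ha h h', Category.assoc]) (liftTaut H y a h) =
        liftTaut H y' a' h' := by
      refine taut_injective n _ (funext fun k => ?_)
      refine (tautCoord_pull g _ _ _ _ k).symm.trans ?_
      exact (congrArg g.hom (congrFun (tautMap_liftTaut H y a h) k)).trans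
        ((ha k).trans (congrFun (tautMap_liftTaut H y' a' h') k).symm)
    have e₂ := (A.naturality g (liftPt H y a h) (liftPt H y' a' h') (map_liftPt H g hy ha h h')
      (liftTaut H y a h)).trans (congrArg (A.app (liftPt H y' a' h')) e)
    rw [← e₂]
    refine (E.map_map (Category.id_comp g) _ _ ?_ _).trans (E.map_map (Category.comp_id g) _ _ ?_ _).symm
    all_goals rw [liftPt_fst, hy]

lemma homFamily_val (A : (O n (-1)).pullback p ⟶ E.pullback q) {R : CommRingCat.{0}}
    (z : Spec R ⟶ X) (t : twistSections (-1) (z ≫ p)) {a : Fin (n + 1) → R}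
    (ha : tautMap _ t = a) (h : ∃ k, IsUnit (a k)) {y : Spec R ⟶ Y} (hy : z ≫ q = y) :
    (homFamily H A).val y a h =
      E.map (𝟙 R) (z ≫ q) y (by rw [Spec.map_id, Category.id_comp, hy]) (A.app z t) := by
  obtain rfl : z = liftPt H y a h := eq_of_coord H (by rw [hy, liftPt_fst]) ⟨t, ha⟩
    (mem_tautLine_liftPt H y a h) h
  obtain rfl : t = liftTaut H y a h :=
    taut_injective n _ (ha.trans (tautMap_liftTaut H y a h).symm)
  rfl

/-- The coordinates `a` and `c a` define the same point; only the section of `𝒪(-1)` is multiplied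
by `c`. -/
lemma homFamily_homog (A : (O n (-1)).pullback p ⟶ E.pullback q) :
    (homFamily H A).IsHomog 1 := fun {R} y c _ a h h' => by
  rw [homFamily_val H A (liftPt H y a h) (c • liftTaut H y a h)
    ((map_smul _ _ _).trans (congrArg (c • ·) (tautMap_liftTaut H y a h))) h' (liftPt_fst H y a h)]
  refine (congrArg _ (map_smul (A.app (liftPt H y a h)) c (liftTaut H y a h))).trans ?_
  refine (LinearMap.map_smulₛₗ _ _ _).trans ?_
  rw [pow_one]
  rfl

/-- The value of a section of `q^* E` at a point with given homogeneous coordinates. -/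
def sectionFamily (s : (E.pullback q).sections) : CoordFamily E n where
  val {S} y a h := E.map (𝟙 S) _ y (by rw [Spec.map_id, Category.id_comp, liftPt_fst])
    (s.1 S (liftPt H y a h))
  nat {S S'} g y y' hy a a' ha h h' := by
    rw [← s.2 S S' g (liftPt H y a h) (liftPt H y' a' h') (map_liftPt H g hy ha h h')]
    refine (E.map_map (Category.id_comp g) _ _ ?_ _).trans (E.map_map (Category.comp_id g) _ _ ?_ _).symm
    all_goals rw [liftPt_fst, hy]

lemma sectionFamily_val (s : (E.pullback q).sections) {R : CommRingCat.{0}}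
    (z : Spec R ⟶ X) {a : Fin (n + 1) → R} (ha : a ∈ tautLine (z ≫ p)) (h : ∃ k, IsUnit (a k))
    {y : Spec R ⟶ Y} (hy : z ≫ q = y) : (sectionFamily H s).val y a h =
      E.map (𝟙 R) (z ≫ q) y (by rw [Spec.map_id, Category.id_comp, hy]) (s.1 R z) := by
  obtain rfl : z = liftPt H y a h := eq_of_coord H (by rw [hy, liftPt_fst]) ha
    (mem_tautLine_liftPt H y a h) h
  rfl

lemma sectionFamily_homog (s : (E.pullback q).sections) :
    (sectionFamily H s).IsHomog 0 := fun {R} y c _ a h h' => by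
  rw [sectionFamily_val H s (liftPt H y a h) (Submodule.smul_mem _ c (mem_tautLine_liftPt H y a h))
    h' (liftPt_fst H y a h), pow_zero, one_smul]
  rfl

variable (hE : E.IsLocFree)

include hE in
-- On the cover by the loci where `s_k X_k` is invertible, homogeneous coordinates exist, and
-- linearity of `homFamily` applies to the generator `s_k`. This shows that the sections of `E ⊠
-- 𝒪(1)` are the linear forms with coefficients in the sections of `E`.
theorem hom_app_eq (A : (O n (-1)).pullback p ⟶ E.pullback q) {R : CommRingCat.{0}}
    (z : Spec R ⟶ X) (t : twistSections (-1) (z ≫ p)) :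
    A.app z t = ∑ j, tautCoord _ t j • (homFamily H A).unitVal (z ≫ q) j := by
  obtain ⟨s, hs⟩ := exists_frame (z ≫ p)
  have hg : Ideal.span (Set.range fun k => tautCoord (z ≫ p) (s k) k) = ⊤ := by
    rw [Ideal.eq_top_iff_one, ← hs]
    exact sum_mem fun k _ => Ideal.subset_span ⟨k, rfl⟩
  refine sub_eq_zero.1 ((hE.pullback q).eq_zero_of_cover hg fun k => ?_)
  set f := awayMap (tautCoord (z ≫ p) (s k) k)
  set z' := Spec.map f ≫ z
  have hz : Spec.map f ≫ z ≫ p = z' ≫ p := (Category.assoc _ _ _).symm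
  have hz' : Spec.map f ≫ z ≫ q = z' ≫ q := (Category.assoc _ _ _).symm
  let t' := pullTwist (-1) f (z ≫ p) (z' ≫ p) hz t
  let u := pullTwist (-1) f (z ≫ p) (z' ≫ p) hz (s k)
  have hu : IsUnit (tautCoord (z' ≫ p) u k) := by
    have := isUnit_awayMap (tautCoord (z ≫ p) (s k) k)
    rwa [tautCoord_pull f _ _ hz] at this
  have hA : A.app z' u = ∑ j, tautCoord _ u j • (homFamily H A).unitVal (z' ≫ q) j := by
    refine Eq.trans ?_ ((homFamily H A).val_of_homog_one hE (homFamily_homog H A)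
      (tautMap _ u) ⟨k, hu⟩)
    rw [homFamily_val H A z' u rfl ⟨k, hu⟩ rfl]
    exact (E.map_id _ _ _).symm
  have hA' : A.app z' t' = ∑ j, tautCoord _ t' j • (homFamily H A).unitVal (z' ≫ q) j :=
    eq_sum_of_isUnit_coord (A.app z') _ hu hA t'
  refine (map_sub _ _ _).trans (sub_eq_zero.2 ?_)
  refine (A.naturality f z z' rfl t).trans (hA'.trans ?_)
  refine Eq.trans ?_ (map_sum _ _ _).symm
  refine Finset.sum_congr rfl fun j _ => ?_
  refine Eq.trans ?_ (LinearMap.map_smulₛₗ _ _ _).symm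
  exact congrArg₂ (· • ·) (tautCoord_pull f _ _ hz t j).symm
    ((homFamily H A).map_unitVal f _ _ hz' j).symm

include hE in
-- The value depends only on the point, so in homogeneous coordinates it is a family of degree `0`,
-- which is constant. Thus sections of `q^* E` come from `E`; their value is read off at any unit
-- vector.
theorem section_eq (hn : n ≠ 0) (s : (E.pullback q).sections) {R : CommRingCat.{0}}
    (z : Spec R ⟶ X) (j : Fin (n + 1)) : s.1 R z = (sectionFamily H s).unitVal (z ≫ q) j := by
  obtain ⟨r, hr⟩ := exists_isFrame_tautLine (z ≫ p)
  refine sub_eq_zero.1 ((hE.pullback q).eq_zero_of_cover hr.span_eq_top fun k => ?_)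
  set f := awayMap (r k k)
  set z' := Spec.map f ≫ z
  have hz : Spec.map f ≫ z ≫ p = z' ≫ p := (Category.assoc _ _ _).symm
  have hz' : Spec.map f ≫ z ≫ q = z' ≫ q := (Category.assoc _ _ _).symm
  have hu : IsUnit (f.hom (r k k)) := isUnit_awayMap _
  refine (map_sub _ _ _).trans (sub_eq_zero.2 ?_)
  refine (s.2 _ _ f z z' rfl).trans (Eq.trans ?_ ((sectionFamily H s).map_unitVal f _ _ hz' j).symm)
  refine Eq.trans ?_ ((sectionFamily H s).val_of_homog_zero hE hn (sectionFamily_homog H s)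
      (fun l => f.hom (r k l)) ⟨k, hu⟩ j)
  rw [sectionFamily_val H s z' (map_mem_tautLine hz (hr.mem k)) ⟨k, hu⟩ rfl]
  exact (E.map_id _ _ _).symm

end Families

end Fano

namespace Fano

/-! ### Contraction of sections with sections of line bundles -/

section Contract

variable {n : ℕ} {R S : CommRingCat.{0}} {x : Spec R ⟶ P n} {d e : ℤ} (h : d + e = 0)
  {M N : Type} [AddCommGroup M] [Module R M]

/-- The contraction `t ⊗ m ↦ ⟨t, w⟩ m`. -/
def contract (w : twistSections e x) : twistSections d x ⊗[R] M →ₗ[R] M :=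
  TensorProduct.lift ((LinearMap.lsmul R M) ∘ₗ (pair x h).flip w)

lemma contract_tmul (w : twistSections e x) (t : twistSections d x) (m : M) :
    contract h w (t ⊗ₜ m) = pair x h t w • m := rfl

lemma contract_add (w w' : twistSections e x) (z : twistSections d x ⊗[R] M) :
    contract h (w + w') z = contract h w z + contract h w' z := by
  induction z using TensorProduct.induction_on with
  | zero => simp
  | tmul t m => rw [contract_tmul, contract_tmul, contract_tmul, map_add, add_smul]
  | add a b ha hb =>
    rw [map_add, map_add, map_add, ha, hb]
    abel

lemma contract_smul (r : R) (w : twistSections e x) (z : twistSections d x ⊗[R] M) :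
    contract h (r • w) z = r • contract h w z := by
  induction z using TensorProduct.induction_on with
  | zero => simp
  | tmul t m => rw [contract_tmul, contract_tmul, map_smul, smul_eq_mul, mul_smul]
  | add a b ha hb => rw [map_add, map_add, ha, hb, smul_add]

lemma map_contract [AddCommGroup N] [Module S N] {f : R ⟶ S} {y : Spec S ⟶ P n}
    (hf : Spec.map f ≫ x = y) (φ : M →ₛₗ[f.hom] N) (w : twistSections e x)
    (z : twistSections d x ⊗[R] M) : φ (contract h w z) =
      contract h (pullTwist e f x y hf w) (TensorProduct.map (pullTwist d f x y hf) φ z) := by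
  induction z using TensorProduct.induction_on with
  | zero => rw [map_zero, map_zero, map_zero, map_zero]
  | tmul t m => rw [TensorProduct.map_tmul, contract_tmul, contract_tmul, LinearMap.map_smulₛₗ,
      map_pair h f x y hf]
  | add a b ha hb => rw [map_add, map_add, map_add, map_add, ha, hb]

/-- An element is recovered from its contractions, as `z = ∑ p_i ⊗ ⟨q_i, z⟩`. -/
lemma eq_zero_of_contract {ι : Type} [Fintype ι] {p : ι → twistSections d x}
    {q : ι → twistSections e x} (hpq : ∑ i, pair x h (p i) (q i) = 1)
    {z : twistSections d x ⊗[R] M} (hz : ∀ i, contract h (q i) z = 0) : z = 0 := by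
  have key : ∑ i, p i ⊗ₜ[R] contract h (q i) z = z := by
    clear hz
    induction z using TensorProduct.induction_on with
    | zero => simp
    | tmul t m =>
      have (i : ι) : p i ⊗ₜ[R] contract h (q i) (t ⊗ₜ[R] m) = pair x h (p i) (q i) • t ⊗ₜ[R] m := by
        rw [contract_tmul, TensorProduct.tmul_smul, TensorProduct.smul_tmul', ← pair_smul',
          TensorProduct.smul_tmul']
      rw [Finset.sum_congr rfl fun i _ => this i, ← Finset.sum_smul, hpq, one_smul]
    | add a b ha hb =>
      simp only [map_add, TensorProduct.tmul_add, Finset.sum_add_distrib, ha, hb]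
  rw [← key]
  exact Finset.sum_eq_zero fun i _ => by rw [hz, TensorProduct.tmul_zero]

lemma contract_coordSec_swap (t : twistSections (-1) x) (z : twistSections (-1) x ⊗[R] M)
    (k l : Fin (n + 1)) : tautCoord x t k • contract (neg_add_cancel 1) (coordSec x l) z =
      tautCoord x t l • contract (neg_add_cancel 1) (coordSec x k) z := by
  induction z using TensorProduct.induction_on with
  | zero => simp
  | tmul u m =>
    rw [contract_tmul, contract_tmul, ← tautCoord_eq_pair, ← tautCoord_eq_pair, smul_smul,
      smul_smul, tautCoord_mul_swap, mul_comm]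
  | add a b ha hb => rw [map_add, map_add, smul_add, smul_add, ha, hb]

lemma contract_coordSec_eq_zero {t : twistSections (-1) x} {k l : Fin (n + 1)}
    (hk : tautCoord x t k = 1) (hl : tautCoord x t l = 0) (z : twistSections (-1) x ⊗[R] M) :
    contract (neg_add_cancel 1) (coordSec x l) z = 0 := by
  have := contract_coordSec_swap t z k l
  rwa [hk, hl, one_smul, zero_smul] at this

end Contract

namespace OModule

variable {X : Scheme.{0}} {E F : OModule X}

/-- The image of a section. -/
def mapSec (φ : E ⟶ F) (s : E.sections) : F.sections :=
  ⟨fun R x => φ.app x (s.1 R x), fun R S f x y h =>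
    (φ.naturality f x y h _).trans (congrArg (φ.app y) (s.2 R S f x y h))⟩

/-- The symmetry of the tensor product, on sections. -/
def commSec (s : (E.tensor F).sections) : (F.tensor E).sections :=
  ⟨fun R x => TensorProduct.comm R (E.obj x) (F.obj x) (s.1 R x), fun R S f x y h => by
    have key (z : E.obj x ⊗[R] F.obj x) :
        TensorProduct.map (F.map f x y h) (E.map f x y h) (TensorProduct.comm R _ _ z) =
        TensorProduct.comm S _ _ (TensorProduct.map (E.map f x y h) (F.map f x y h) z) := by
      induction z using TensorProduct.induction_on with
      | zero => rw [map_zero, map_zero, map_zero, map_zero]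
      | tmul a b => rfl
      | add a b ha hb => rw [map_add, map_add, map_add, map_add, ha, hb]
    exact (key _).trans (congrArg (TensorProduct.comm S _ _) (s.2 R S f x y h))⟩

variable {n : ℕ} {p : X ⟶ P n}

/-- The homomorphism `𝒪(-1) → E` that belongs to a section of `𝒪(1) ⊗ E`. -/
def contrHom (s : (((O n 1).pullback p).tensor E).sections) : (O n (-1)).pullback p ⟶ E where
  app {R} x :=
    { toFun := fun t => contract (M := E.obj x) (x := x ≫ p) (add_neg_cancel 1) t (s.1 R x)
      map_add' := fun t u => contract_add _ t u _
      map_smul' := fun r t => contract_smul _ r t _ }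
  naturality {R S} f x y h t := by
    refine (map_contract (x := x ≫ p) (y := y ≫ p) (add_neg_cancel 1)
      (by rw [← h, Category.assoc]) (E.map f x y h) t (s.1 R x)).trans ?_
    exact congrArg (contract (M := E.obj y) (x := y ≫ p) (add_neg_cancel 1) _) (s.2 R S f x y h)

/-- The contraction of a section of `𝒪(-1) ⊗ E` with a homogeneous coordinate. -/
def coordContr (k : Fin (n + 1)) (s : (((O n (-1)).pullback p).tensor E).sections) : E.sections :=
  ⟨fun R x => contract (M := E.obj x) (x := x ≫ p) (neg_add_cancel 1) (coordSec _ k) (s.1 R x),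
  fun R S f x y h => by
    refine (map_contract (x := x ≫ p) (y := y ≫ p) (neg_add_cancel 1)
      (by rw [← h, Category.assoc]) (E.map f x y h) (coordSec _ k) (s.1 R x)).trans ?_
    exact congrArg₂ (fun w z => contract (M := E.obj y) (x := y ≫ p) (neg_add_cancel 1) w z)
      (pullTwist_coordSec _ _ _ _ _) (s.2 R S f x y h)⟩

end OModule

/-- `q^* E ⊗ p^* 𝒪(-1)` has no sections. -/
theorem section_eq_zero {n : ℕ} (hn : n ≠ 0) {X Y : Scheme.{0}} {q : X ⟶ Y} {p : X ⟶ P n}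
    {qY : Y ⟶ Spec (.of ℂ)} (H : IsPullback q p qY (P.toC n)) {E : OModule Y} (hE : E.IsLocFree)
    (u : (((O n (-1)).pullback p).tensor (E.pullback q)).sections) {R : CommRingCat.{0}}
    (z : Spec R ⟶ X) : u.1 R z = 0 := by
  obtain ⟨s, hs⟩ := exists_frame (z ≫ p)
  refine eq_zero_of_contract (M := E.obj (z ≫ q)) (x := z ≫ p) (neg_add_cancel 1) (p := s)
    (q := fun k => coordSec _ k) ?_ fun k => ?_
  · rw [← hs]
    exact Finset.sum_congr rfl fun k _ => (tautCoord_eq_pair _ _ _).symm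
  have : Nontrivial (Fin (n + 1)) := Fin.nontrivial_iff_two_le.2 (by omega)
  obtain ⟨j, hj⟩ := exists_ne k
  -- The contraction with `X_k` is a section of `q^* E`, so it is constant along the fibres and may
  -- be evaluated at the unit vector `e_j` with `j ≠ k`, where `X_k` vanishes.
  refine (section_eq H hE hn (OModule.coordContr k u) z j).trans ?_
  set y := z ≫ q
  set a : Fin (n + 1) → R := Pi.single j 1
  have ha : ∃ k, IsUnit (a k) := isUnit_single R j
  have h0 : contract (M := E.obj (liftPt H y a ha ≫ q)) (x := liftPt H y a ha ≫ p)
      (neg_add_cancel 1) (coordSec _ k) (u.1 R (liftPt H y a ha)) = 0 := by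
    exact contract_coordSec_eq_zero
      ((congrFun (tautMap_liftTaut H y a ha) j).trans (by simp [a]))
      ((congrFun (tautMap_liftTaut H y a ha) k).trans (by simp [a, hj.symm])) _
  exact (congrArg (E.map (𝟙 R) (liftPt H y a ha ≫ q) y
    (by rw [Spec.map_id, Category.id_comp, liftPt_fst])) h0).trans (map_zero _)

end Fano

namespace Fano

/-! ### The sections of `K` -/

namespace OModule

variable {X : Scheme.{0}} {q : X ⟶ Spec (.of ℂ)} {E : OModule X}

/-- The value of a section. -/
def evalSec (q : X ⟶ Spec (.of ℂ)) (E : OModule X) {R : CommRingCat.{0}} (x : Spec R ⟶ X) :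
    E.H0 q →+ E.obj x where
  toFun s := s.1 R x
  map_zero' := rfl
  map_add' _ _ := rfl

lemma sum_smul_apply {ι : Type} [Fintype ι] (c : ι → ℂ) (v : ι → E.H0 q) {R : CommRingCat.{0}}
    (x : Spec R ⟶ X) : (∑ i, c i • v i : E.H0 q).1 R x = ∑ i, scalar q x (c i) • (v i).1 R x :=
  map_sum (evalSec q E x) _ _

lemma sub_apply (s t : E.H0 q) {R : CommRingCat.{0}} (x : Spec R ⟶ X) :
    (s - t : E.H0 q).1 R x = s.1 R x - t.1 R x := rfl

end OModule

variable {R S : CommRingCat.{0}}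

lemma isPullback_P2 : IsPullback P12.pr₂ P12.pr₁ (P.toC 2) (P.toC 1) :=
  (IsPullback.of_hasPullback (P.toC 1) (P.toC 2)).flip

lemma isPullback_ambient : IsPullback Ambient.pr₁₂ Ambient.pr₃ P12.toC (P.toC 12) :=
  IsPullback.of_hasPullback P12.toC (P.toC 12)

lemma pr₂_toC : P12.pr₂ ≫ P.toC 2 = P12.toC := isPullback_P2.w

lemma scalar_comp {X Y : Scheme.{0}} {q : X ⟶ Y} {qY : Y ⟶ Spec (.of ℂ)} {qX : X ⟶ Spec (.of ℂ)}
    (h : q ≫ qY = qX) (z : Spec R ⟶ X) : OModule.scalar qY (z ≫ q) = OModule.scalar qX z := by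
  subst h
  rw [OModule.scalar, OModule.scalar, Category.assoc]

lemma symCoord_map (f : R ⟶ S) (x : Spec R ⟶ P 2) (y : Spec S ⟶ P 2) (h : Spec.map f ≫ x = y)
    (z : Conics R) (k : Fin 6) : f.hom (symCoord R z k) = symCoord S (O_6.map f x y h z) k := by
  refine sym_induction (p := fun z => f.hom (symCoord R z k) = symCoord S (O_6.map f x y h z) k) z
    ?_ (fun a b => ?_) fun z w hz hw => ?_
  · have e : symCoord S (O_6.map f x y h 0) = 0 :=
      (congrArg (symCoord S) (map_zero (O_6.map f x y h))).trans (map_zero _)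
    rw [map_zero]
    exact (map_zero f.hom).trans (congrFun e k).symm
  · change f.hom (symCoord R (symMk R a b) k) =
      symCoord S (symMk S (fun i => f.hom (a i)) (fun i => f.hom (b i))) k
    rw [symCoord_mk, symCoord_mk]
    fin_cases k <;> simp
  · have e : symCoord S (O_6.map f x y h (z + w)) =
        symCoord S (O_6.map f x y h z) + symCoord S (O_6.map f x y h w) :=
      (congrArg (symCoord S) (map_add (O_6.map f x y h) z w)).trans (map_add _ _ _)
    rw [map_add]
    exact (map_add f.hom _ _).trans ((congrArg₂ (· + ·) hz hw).trans (congrFun e k).symm)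

/-- The coordinates of a section of `𝒪^{⊕6}`. -/
def coordSections (s : O_6.sections) :
    ((OModule.free (Spec (.of ℂ)) (Fin 6)).pullback (P.toC 2)).sections :=
  ⟨fun R x => symCoord R (s.1 R x), fun R S f x y h => funext fun k =>
    (symCoord_map f x y h _ k).trans (congrArg (fun z => symCoord S z k) (s.2 R S f x y h))⟩

/-- The sections of `𝒪^{⊕6}` are constant. -/
theorem exists_section_O_6 (s : O_6.sections) : ∃ c : Fin 6 → ℂ,
    ∀ {R : CommRingCat.{0}} (x : Spec R ⟶ P 2),
      s.1 R x = ∑ k, OModule.scalar (P.toC 2) x (c k) • symMonomial R k := by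
  -- Here `ℙ²` is regarded as the projective space over the base `Spec ℂ`. The constants are the
  -- coordinates over the identity point of `Spec ℂ`.
  let F := sectionFamily IsPullback.of_id_snd (coordSections s)
  refine ⟨F.unitVal (𝟙 _) 0, fun {R} x => ?_⟩
  have h := section_eq IsPullback.of_id_snd (OModule.isLocFree_free _ _) two_ne_zero
    (coordSections s) x 0
  have h' := F.map_unitVal (Spec.preimage (x ≫ P.toC 2)) (𝟙 _) (x ≫ P.toC 2)
    (by rw [Spec.map_preimage, Category.comp_id]) 0
  refine (sum_symCoord_smul _).symm.trans (Finset.sum_congr rfl fun k _ => ?_)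
  exact congrArg (· • symMonomial R k) (congrFun (h.trans h'.symm) k)

/-- The standard basis of `R^2 ⊗ Sym² R^3`. -/
def twelveBasis (R : Type) [CommRing R] (β : Fin 2 × Fin 6) : Twelve R :=
  (Pi.single β.1 1 : Fin 2 → R) ⊗ₜ symMonomial R β.2

lemma single_map {ι : Type} [DecidableEq ι] (f : R ⟶ S) (i : ι) :
    (fun j => f.hom ((Pi.single i (1 : R) : ι → R) j)) = (Pi.single i 1 : ι → S) :=
  funext fun j => by rw [Pi.single_apply, Pi.single_apply, apply_ite f.hom, map_one, map_zero]

lemma map_twelveBasis (f : R ⟶ S) (x : Spec R ⟶ P12) (y : Spec S ⟶ P12)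
    (h : Spec.map f ≫ x = y) (β : Fin 2 × Fin 6) :
    O_12.map f x y h (twelveBasis R β) = twelveBasis S β := by
  have e : symMk S (fun i => f.hom ((Pi.single (![0, 1, 2, 0, 0, 1] β.2) (1 : R) : Fin 3 → R) i))
      (fun i => f.hom ((Pi.single (![0, 1, 2, 1, 2, 2] β.2) (1 : R) : Fin 3 → R) i)) =
      symMonomial S β.2 := by
    rw [single_map, single_map]
    rfl
  exact congrArg₂ (· ⊗ₜ[S] ·) (single_map f β.1) e

lemma pair_toO1_zero (x : Spec R ⟶ P 1) (t : twistSections (-1) x) :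
    pair x (add_neg_cancel 1) (toO1.app x (Pi.single 0 1 : Fin 2 → R)) t = -tautCoord x t 1 := by
  have e : toO1.app x (Pi.single 0 1 : Fin 2 → R) = (-coordSec x 1 : twistSections 1 x) :=
    Subtype.ext (funext fun i => by
      change (Pi.single 0 1 : Fin 2 → R) 1 • coord x i 0 - (Pi.single 0 1 : Fin 2 → R) 0 • coord x i 1 =
        -coord x i 1
      simp)
  rw [tautCoord_eq_pair]
  exact (pair_comm x _ (neg_add_cancel 1) _ _).trans
    ((congrArg (pair x (neg_add_cancel 1) t) e).trans (map_neg _ _))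

lemma pair_toO1_one (x : Spec R ⟶ P 1) (t : twistSections (-1) x) :
    pair x (add_neg_cancel 1) (toO1.app x (Pi.single 1 1 : Fin 2 → R)) t = tautCoord x t 0 := by
  have e : toO1.app x (Pi.single 1 1 : Fin 2 → R) = (coordSec x 0 : twistSections 1 x) :=
    Subtype.ext (funext fun i => by
      change (Pi.single 1 1 : Fin 2 → R) 1 • coord x i 0 - (Pi.single 1 1 : Fin 2 → R) 0 • coord x i 1 =
        coord x i 0
      simp)
  rw [tautCoord_eq_pair]
  exact (pair_comm x _ (neg_add_cancel 1) _ _).trans (congrArg (pair x (neg_add_cancel 1) t) e)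

namespace Completion

variable (D : Completion)

/-- The sections of `K` that come from the standard basis of `𝒪^{⊕12}`. -/
def basisSec (β : Fin 2 × Fin 6) : D.K.H0 P12.toC :=
  ⟨fun R x => D.proj x (twelveBasis R β), fun R _ f x y h =>
    (D.p'.naturality f x y h (twelveBasis R β)).trans
      (congrArg (D.proj y) (map_twelveBasis f x y h β))⟩

lemma contract_proj (x : Spec R ⟶ P12) (t : twistSections (-1) (x ≫ P12.pr₁)) (β : Fin 2 × Fin 6) :
    contract (M := Conics R) (x := x ≫ P12.pr₁) (add_neg_cancel 1) t
      (D.j'.app x (D.proj x (twelveBasis R β))) =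
      (![-tautCoord _ t 1, tautCoord _ t 0] β.1 : R) • symMonomial R β.2 := by
  have e : D.j'.app x (D.proj x (twelveBasis R β)) =
      (toO1.app (x ≫ P12.pr₁) (Pi.single β.1 1 : Fin 2 → R)) ⊗ₜ[R] symMonomial R β.2 :=
    OModule.congr_app D.comm_O1 x (twelveBasis R β)
  refine (congrArg (contract (M := Conics R) (x := x ≫ P12.pr₁) (add_neg_cancel 1) t) e).trans ?_
  refine (contract_tmul _ t _ _).trans (congrArg (· • symMonomial R β.2) ?_)
  obtain ⟨i, k⟩ := β
  fin_cases i
  · exact pair_toO1_zero _ t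
  · exact pair_toO1_one _ t

/-- A section of `K` is determined by its image in `𝒪(1,0)^{⊕6}`. -/
lemma section_eq_zero_of_app_eq_zero (s : D.K.sections)
    (hs : ∀ (R : CommRingCat.{0}) (x : Spec R ⟶ P12), D.j'.app x (s.1 R x) = 0)
    (x : Spec R ⟶ P12) : s.1 R x = 0 := by
  -- By exactness `s` lifts to `𝒪(-1) ⊠ Λ`. Injectivity of `i'` makes the lift a section, and
  -- `section_eq_zero` applies over the base `ℙ²`.
  choose u hu using fun (R : CommRingCat.{0}) (x : Spec R ⟶ P12) =>
    ((D.exact_col' x).2.1 (s.1 R x)).1 (hs R x)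
  have hn : u ∈ (O 1 (-1) ⊠ D.Λ).sections := fun R S f x y h => by
    refine (D.exact_col' y).1 ((D.i'.naturality f x y h _).symm.trans ?_)
    rw [hu S y, ← s.2 R S f x y h, hu R x]
  have h0 : u R x = 0 :=
    section_eq_zero one_ne_zero isPullback_P2 D.isVectorBundle_Λ.isLocFree ⟨u, hn⟩ x
  rw [← hu R x, h0, map_zero]

/-- The sections of `K` come from `𝒪^{⊕12}`. -/
theorem exists_section_K (s : D.K.H0 P12.toC) : ∃ c : Fin 2 × Fin 6 → ℂ,
    s = ∑ β, c β • D.basisSec β := by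
  -- The image of `s` in `𝒪(1,0)^6` is a homomorphism from `𝒪(-1)` to `𝒪^6`. It is linear in the
  -- coordinates of `ℙ¹`, with coefficients that are constant vectors `c 0` and `c 1`.
  let A : (O 1 (-1)).pullback P12.pr₁ ⟶ O_6.pullback P12.pr₂ :=
    OModule.contrHom (OModule.mapSec D.j' s)
  let F := homFamily isPullback_P2 A
  choose c hc using fun i : Fin 2 => exists_section_O_6
    ⟨fun R x => F.unitVal x i, fun R S f x y h => F.map_unitVal f x y h i⟩
  -- The map `toO1` sends `e_0` to `-X_1` and `e_1` to `X_0`, which accounts for the exchange and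
  -- the sign.
  let c' : Fin 2 × Fin 6 → ℂ := fun β => ![-c 1 β.2, c 0 β.2] β.1
  refine ⟨c', sub_eq_zero.1 (Subtype.ext (funext fun R => funext fun x =>
    D.section_eq_zero_of_app_eq_zero _ (fun R x => ?_) x))⟩
  obtain ⟨a, ha⟩ := exists_frame (x ≫ P12.pr₁)
  refine eq_zero_of_contract (M := Conics R) (x := x ≫ P12.pr₁) (add_neg_cancel 1)
    (p := fun k => coordSec _ k) (q := a) ?_ fun k => ?_
  · rw [← ha]
    exact Finset.sum_congr rfl fun k _ => by
      rw [tautCoord_eq_pair, pair_comm _ _ (neg_add_cancel 1)]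
  let L : D.K.obj x →ₗ[R] Conics R :=
    contract (M := Conics R) (x := x ≫ P12.pr₁) (add_neg_cancel 1) (a k) ∘ₗ D.j'.app x
  have h₁ : L (s.1 R x) = ∑ i : Fin 2, tautCoord (x ≫ P12.pr₁) (a k) i •
      ∑ l, OModule.scalar P12.toC x (c i l) • symMonomial R l := by
    refine (hom_app_eq isPullback_P2 isLocFree_O_6 A x (a k)).trans ?_
    refine Finset.sum_congr rfl fun i _ => congrArg (tautCoord (x ≫ P12.pr₁) (a k) i • ·) ?_
    refine (hc i (x ≫ P12.pr₂)).trans (Finset.sum_congr rfl fun l _ => ?_)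
    rw [scalar_comp pr₂_toC]
  have h₂ : L (∑ β, OModule.scalar P12.toC x (c' β) • D.proj x (twelveBasis R β)) =
      ∑ β : Fin 2 × Fin 6, OModule.scalar P12.toC x (c' β) •
        (![-tautCoord (x ≫ P12.pr₁) (a k) 1, tautCoord (x ≫ P12.pr₁) (a k) 0] β.1 : R) •
          symMonomial R β.2 := by
    rw [map_sum]
    refine Finset.sum_congr rfl fun β _ => ?_
    rw [map_smul]
    exact congrArg (OModule.scalar P12.toC x (c' β) • ·) (D.contract_proj x (a k) β)
  change L _ = 0
  rw [OModule.sub_apply, OModule.sum_smul_apply, map_sub, h₁]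
  refine sub_eq_zero.2 (Eq.trans ?_ h₂.symm)
  rw [Fintype.sum_prod_type, Fin.sum_univ_two, Fin.sum_univ_two, Finset.smul_sum, Finset.smul_sum,
    add_comm]
  refine congrArg₂ (· + ·) (Finset.sum_congr rfl fun l _ => ?_) (Finset.sum_congr rfl fun l _ => ?_)
  · simp [c', smul_smul, mul_comm]
  · simp [c', smul_smul, mul_comm]

end Completion

end Fano

namespace Fano

/-! ### The sections of `K(0,0,1)` -/

/-- Coordinates on `R^2 ⊗ Sym² R^3`. -/
def twelveB (R : Type) [CommRing R] : Module.Basis (Fin 2 × Fin 6) R (Twelve R) :=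
  (Pi.basisFun R (Fin 2)).tensorProduct (Module.Basis.ofEquivFun (symEquiv R))

lemma twelveB_apply (R : Type) [CommRing R] (β : Fin 2 × Fin 6) :
    twelveB R β = twelveBasis R β := by
  rw [twelveB, Module.Basis.tensorProduct_apply', Pi.basisFun_apply, Module.Basis.coe_ofEquivFun]
  refine congrArg ((Pi.single β.1 1 : Fin 2 → R) ⊗ₜ[R] ·) ?_
  refine (symEquiv R).symm_apply_eq.2 (funext fun l => ?_)
  exact (symCoord_monomial β.2 l).symm

lemma twelveB_repr_tmul {R : Type} [CommRing R] (a : Fin 2 → R) (z : Conics R)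
    (β : Fin 2 × Fin 6) : (twelveB R).repr (a ⊗ₜ z) β = symCoord R z β.2 * a β.1 := by
  rw [twelveB]
  exact Module.Basis.tensorProduct_repr_tmul_apply _ _ a z β.1 β.2

variable {R S : CommRingCat.{0}}

/-- Over a point whose first component is `e_j`, the line in `R^2 ⊗ Sym² R^3` is contained in
`e_j ⊗ Sym² R^3`. -/
lemma repr_segreIncl_eq_zero {x : Spec R ⟶ P12} {u : twistSections (-1) (x ≫ P12.pr₁)}
    {β : Fin 2 × Fin 6} {j : Fin 2} (hj : tautCoord (x ≫ P12.pr₁) u j = 1)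
    (hβ : tautCoord (x ≫ P12.pr₁) u β.1 = 0)
    (t : twistSections (-1) (x ≫ P12.pr₁) ⊗[R] twistSections (-2) (x ≫ P12.pr₂)) :
    (twelveB R).repr (segreIncl x t) β = 0 := by
  induction t using TensorProduct.induction_on with
  | zero => simp
  | tmul t v =>
    have : tautCoord (x ≫ P12.pr₁) t β.1 = 0 := by
      have := tautCoord_mul_swap t u β.1 j
      rwa [hj, hβ, zero_mul, mul_one] at this
    rw [segreIncl_tmul, twelveB_repr_tmul]
    exact (congrArg (_ * ·) this).trans (mul_zero _)
  | add a b ha hb => rw [map_add, map_add, Finsupp.add_apply, ha, hb, add_zero]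

namespace Completion

variable (D : Completion)

/-- The section `e_β ⊗ X_m` of `K(0,0,1)`. -/
def genSec (γ : (Fin 2 × Fin 6) × Fin 13) : (twist001 D.K).H0 Ambient.toC :=
  ⟨fun R z => (D.basisSec γ.1).1 R (z ≫ Ambient.pr₁₂) ⊗ₜ[R] coordSec (z ≫ Ambient.pr₃) γ.2,
    fun R S f x y h => congrArg₂ (· ⊗ₜ[S] ·)
      ((D.basisSec γ.1).2 R S f (x ≫ Ambient.pr₁₂) (y ≫ Ambient.pr₁₂) (by rw [← h, Category.assoc]))
      (pullTwist_coordSec f (x ≫ Ambient.pr₃) (y ≫ Ambient.pr₃) (by rw [← h, Category.assoc]) γ.2)⟩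

/-- The contraction of an element of `K(0,0,1)` with a section of `𝒪(0,0,-1)`. -/
def contr (z : Spec R ⟶ Ambient) (t : twistSections (-1) (z ≫ Ambient.pr₃)) :
    (twist001 D.K).obj z →ₗ[R] D.K.obj (z ≫ Ambient.pr₁₂) :=
  contract (M := D.K.obj (z ≫ Ambient.pr₁₂)) (x := z ≫ Ambient.pr₃) (add_neg_cancel 1) t ∘ₗ
    (TensorProduct.comm R (D.K.obj (z ≫ Ambient.pr₁₂))
      (twistSections 1 (z ≫ Ambient.pr₃))).toLinearMap

lemma contr_genSec (z : Spec R ⟶ Ambient) (t : twistSections (-1) (z ≫ Ambient.pr₃))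
    (γ : (Fin 2 × Fin 6) × Fin 13) : D.contr z t ((D.genSec γ).1 R z) =
      tautCoord (z ≫ Ambient.pr₃) t γ.2 • D.proj (z ≫ Ambient.pr₁₂) (twelveBasis R γ.1) := by
  rw [tautCoord_eq_pair, pair_comm _ _ (add_neg_cancel 1)]
  rfl

lemma eq_zero_of_contr {z : Spec R ⟶ Ambient} {v : (twist001 D.K).obj z}
    (h : ∀ t, D.contr z t v = 0) : v = 0 := by
  obtain ⟨a, ha⟩ := exists_frame (z ≫ Ambient.pr₃)
  refine (TensorProduct.comm R (D.K.obj (z ≫ Ambient.pr₁₂))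
      (twistSections 1 (z ≫ Ambient.pr₃))).injective ?_
  refine Eq.trans (b := 0) ?_ (map_zero _).symm
  refine eq_zero_of_contract (M := D.K.obj (z ≫ Ambient.pr₁₂)) (x := z ≫ Ambient.pr₃)
    (add_neg_cancel 1) (p := fun k => coordSec _ k) (q := a) ?_ fun k => h (a k)
  rw [← ha]
  exact Finset.sum_congr rfl fun k _ => by
    rw [tautCoord_eq_pair, pair_comm _ _ (neg_add_cancel 1)]

/-- The contraction of a section that is given by a matrix. -/
lemma contr_sum (c : (Fin 2 × Fin 6) × Fin 13 → ℂ) (z : Spec R ⟶ Ambient)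
    (t : twistSections (-1) (z ≫ Ambient.pr₃)) :
    D.contr z t ((∑ γ, c γ • D.genSec γ : (twist001 D.K).H0 Ambient.toC).1 R z) =
      D.proj (z ≫ Ambient.pr₁₂) (∑ β, (∑ m, OModule.scalar Ambient.toC z (c (β, m)) *
        tautCoord (z ≫ Ambient.pr₃) t m) • twelveBasis R β) := by
  rw [OModule.sum_smul_apply, map_sum, map_sum, Fintype.sum_prod_type]
  refine Finset.sum_congr rfl fun β _ => ?_
  rw [map_smul, Finset.sum_smul]
  refine Finset.sum_congr rfl fun m _ => ?_
  rw [map_smul, mul_smul]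
  exact congrArg (OModule.scalar Ambient.toC z (c (β, m)) • ·) (D.contr_genSec z t (β, m))

/-- The sections of `K(0,0,1)` are given by matrices. -/
theorem exists_section (s : (twist001 D.K).H0 Ambient.toC) :
    ∃ c : (Fin 2 × Fin 6) × Fin 13 → ℂ, ∑ γ, c γ • D.genSec γ = s := by
  -- A section of `K(0,0,1)` is a homomorphism from `𝒪(-1)` on `ℙ¹²` to `K`. Its thirteen
  -- coefficients are sections of `K`, and these give the columns of the matrix.
  let A : (O 12 (-1)).pullback Ambient.pr₃ ⟶ D.K.pullback Ambient.pr₁₂ :=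
    OModule.contrHom (OModule.commSec s)
  let F := homFamily isPullback_ambient A
  choose c hc using fun m : Fin 13 => D.exists_section_K
    ⟨fun R x => F.unitVal x m, fun R S f x y h => F.map_unitVal f x y h m⟩
  have hc' {R : CommRingCat.{0}} (x : Spec R ⟶ P12) (m : Fin 13) : F.unitVal x m =
      ∑ β, OModule.scalar P12.toC x (c m β) • D.proj x (twelveBasis R β) :=
    (congrArg (fun s : D.K.H0 P12.toC => s.1 R x) (hc m)).trans (OModule.sum_smul_apply _ _ x)
  let c' : (Fin 2 × Fin 6) × Fin 13 → ℂ := fun γ => c γ.2 γ.1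
  refine ⟨c', (sub_eq_zero.1 (Subtype.ext (funext fun R => funext fun z =>
    D.eq_zero_of_contr fun t => ?_))).symm⟩
  refine (map_sub (D.contr z t) _ _).trans (sub_eq_zero.2 (Eq.trans ?_ (D.contr_sum c' z t).symm))
  refine ((hom_app_eq isPullback_ambient D.isVectorBundle_K.isLocFree A z t).trans ?_)
  rw [map_sum]
  have (β : Fin 2 × Fin 6) : D.proj (z ≫ Ambient.pr₁₂) ((∑ m, OModule.scalar Ambient.toC z (c m β) *
        tautCoord (z ≫ Ambient.pr₃) t m) • twelveBasis R β) =
      ∑ m, tautCoord (z ≫ Ambient.pr₃) t m • OModule.scalar P12.toC (z ≫ Ambient.pr₁₂) (c m β) •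
        D.proj (z ≫ Ambient.pr₁₂) (twelveBasis R β) := by
    rw [map_smul, Finset.sum_smul]
    refine Finset.sum_congr rfl fun m _ => ?_
    rw [smul_smul, mul_comm, scalar_comp rfl]
    rfl
  rw [Finset.sum_congr rfl fun β _ => this β, Finset.sum_comm]
  refine Finset.sum_congr rfl fun m _ => ?_
  rw [← Finset.smul_sum]
  exact congrArg (tautCoord (z ≫ Ambient.pr₃) t m • ·) (hc' (z ≫ Ambient.pr₁₂) m)

/-- The matrix of a section of `K(0,0,1)` is unique. -/
theorem eq_zero_of_sum_eq_zero {c : (Fin 2 × Fin 6) × Fin 13 → ℂ}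
    (hc : ∑ γ, c γ • D.genSec γ = 0) : c = 0 := by
  funext ⟨β, m⟩
  -- Test point for the entry `(β, m)`: `e_j` in `ℙ¹` with `j ≠ β.1`, and `e_m` in `ℙ¹²`; the point
  -- of `ℙ²` is arbitrary. There the line `𝒪(-1,-2)` lies in `e_j ⊗ Sym² ℂ^3` and has no
  -- `β`-component, so the `β`-component `c (β, m)` of the lifted section vanishes.
  obtain ⟨j, hj⟩ := exists_ne β.1
  let R : CommRingCat.{0} := .of ℂ
  let y : Spec R ⟶ P 2 := coordPt (RingHom.id ℂ) (Pi.single 0 1) (isUnit_single ℂ 0)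
  let x : Spec R ⟶ P12 := liftPt isPullback_P2 y (Pi.single j 1) (isUnit_single ℂ j)
  let u : twistSections (-1) (x ≫ P12.pr₁) :=
    liftTaut isPullback_P2 y (Pi.single j 1) (isUnit_single ℂ j)
  have hu : tautMap (x ≫ P12.pr₁) u = (Pi.single j 1 : Fin 2 → ℂ) := tautMap_liftTaut _ _ _ _
  let z : Spec R ⟶ Ambient := liftPt isPullback_ambient x (Pi.single m 1) (isUnit_single ℂ m)
  let t : twistSections (-1) (z ≫ Ambient.pr₃) :=
    liftTaut isPullback_ambient x (Pi.single m 1) (isUnit_single ℂ m)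
  have ht : tautMap (z ≫ Ambient.pr₃) t = (Pi.single m 1 : Fin 13 → ℂ) := tautMap_liftTaut _ _ _ _
  have hz : z ≫ Ambient.pr₁₂ = x := liftPt_fst _ _ _ _
  have h0 := D.contr_sum c z t
  rw [hc] at h0
  have h1 := ((D.proj_eq_zero_iff _ _).1 (h0.symm.trans (map_zero _)))
  rw [hz] at h1
  obtain ⟨v, hv⟩ := h1
  have h2 := repr_segreIncl_eq_zero (u := u) (β := β) (j := j)
    ((congrFun hu j).trans (by simp)) ((congrFun hu β.1).trans (by simp [hj.symm])) v
  rw [hv, map_sum, Finsupp.finsetSum_apply] at h2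
  have h3 (m' : Fin 13) : tautCoord (z ≫ Ambient.pr₃) t m' = (Pi.single m 1 : Fin 13 → ℂ) m' :=
    congrFun ht m'
  simp only [map_smul, ← twelveB_apply, Module.Basis.repr_self, Finsupp.smul_apply, h3] at h2
  rw [Finset.sum_eq_single β (by intro γ _ hγ; simp [hγ.symm]) (by simp)] at h2
  simpa [Pi.single_apply] using h2

lemma linearCombination_genSec_bijective :
    Function.Bijective (Fintype.linearCombination ℂ D.genSec) :=
  ⟨(injective_iff_map_eq_zero _).2 fun _ h => D.eq_zero_of_sum_eq_zero h, D.exists_section⟩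

/-- The space of sections of `K(0,0,1)` is the space of matrices. -/
def matrixEquiv : ((Fin 2 × Fin 6) × Fin 13 → ℂ) ≃ₗ[ℂ] (twist001 D.K).H0 Ambient.toC :=
  LinearEquiv.ofBijective (Fintype.linearCombination ℂ D.genSec)
    D.linearCombination_genSec_bijective

end Completion

end Fano

namespace Fano

/-! ### Line subbundles -/

section LineSubbundle

variable {R A B C : Type} [CommRing R] [AddCommGroup A] [Module R A] [AddCommGroup B] [Module R B]
  [AddCommGroup C] [Module R C]

lemma isLineSubbundle_range [Module.Finite R B] [Module.Projective R B] {g : A →ₗ[R] B}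
    {ρ : B →ₗ[R] A} (h : ∀ a, ρ (g a) = a)
    (hA : ∀ p : PrimeSpectrum R, Module.rankAtStalk A p = 1) :
    OModule.IsLineSubbundle (LinearMap.range g) := by
  refine ⟨(projective_rank_of_retract (LinearMap.exact_map_mkQ_range g)
    (Submodule.mkQ_surjective _) ρ h).2.1, fun p => ?_⟩
  rw [← Module.rankAtStalk_eq_of_equiv
    (LinearEquiv.ofInjective g (Function.LeftInverse.injective h)), hA]

/-- The projective quotient provides a retraction of `B` onto `N`; preceded by `ρ`, it retracts `C`
onto the image of `N`. -/
lemma OModule.IsLineSubbundle.map {N : Submodule R B} (hN : OModule.IsLineSubbundle N)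
    [Module.Finite R C] [Module.Projective R C] {g : B →ₗ[R] C} {ρ : C →ₗ[R] B}
    (h : ∀ b, ρ (g b) = b) : OModule.IsLineSubbundle (N.map g) := by
  have := hN.1
  obtain ⟨σ, hσ⟩ := Module.projective_lifting_property N.mkQ LinearMap.id N.mkQ_surjective
  have hσ' (b : B) : N.mkQ (σ (N.mkQ b)) = N.mkQ b := congrArg (fun k => k (N.mkQ b)) hσ
  let r : B →ₗ[R] N := (LinearMap.id - σ ∘ₗ N.mkQ).codRestrict N fun b =>
    (Submodule.Quotient.mk_eq_zero N).1 ((map_sub N.mkQ _ _).trans (sub_eq_zero.2 (hσ' b).symm))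
  have hr (a : N) : r a.1 = a := by
    refine Subtype.ext ?_
    have : N.mkQ a.1 = 0 := (Submodule.Quotient.mk_eq_zero N).2 a.2
    change a.1 - σ (N.mkQ a.1) = a.1
    rw [this, map_zero, sub_zero]
  have := isLineSubbundle_range (g := g ∘ₗ N.subtype) (ρ := r ∘ₗ ρ)
    (fun a => (congrArg r (h a.1)).trans (hr a)) hN.2
  rwa [LinearMap.range_comp, Submodule.range_subtype] at this

end LineSubbundle

/-! ### The matrix of a section -/

section Matrices

variable (c : (Fin 2 × Fin 6) × Fin 13 → ℂ)

/-- The numbering of the first twelve columns. -/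
def colIdx : Fin 2 × Fin 6 ≃ Fin 12 := finProdFinEquiv (m := 2) (n := 6)

/-- The minor of the first twelve columns. -/
def minor : Matrix (Fin 2 × Fin 6) (Fin 2 × Fin 6) ℂ :=
  Matrix.of fun β γ => c (β, (colIdx γ).castSucc)

variable {R S : Type} [CommRing R] [CommRing S] (φ : ℂ →+* R)

/-- The homomorphism `R^13 → R^2 ⊗ Sym² R^3` that belongs to a matrix. -/
def matMap : (Fin 13 → R) →ₗ[R] Twelve R :=
  (twelveB R).equivFun.symm.toLinearMap ∘ₗ Matrix.toLin' (Matrix.of fun β m => φ (c (β, m)))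

lemma matMap_apply (v : Fin 13 → R) :
    matMap c φ v = ∑ β, (∑ m, φ (c (β, m)) * v m) • twelveBasis R β := by
  refine ((twelveB R).equivFun_symm_apply _).trans (Finset.sum_congr rfl fun β _ => ?_)
  rw [twelveB_apply]
  rfl

lemma equivFun_matMap (v : Fin 13 → R) : (twelveB R).equivFun (matMap c φ v) =
    ((minor c).map φ).mulVec (fun γ => v (colIdx γ).castSucc) +
      fun β => φ (c (β, Fin.last 12)) * v (Fin.last 12) := by
  refine ((twelveB R).equivFun.apply_symm_apply _).trans (funext fun β => ?_)
  refine (Fin.sum_univ_castSucc (n := 12) (fun m => φ (c (β, m)) * v m)).trans ?_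
  refine congrArg (· + _) ?_
  exact (Equiv.sum_comp colIdx fun m : Fin 12 => φ (c (β, m.castSucc)) * v m.castSucc).symm

/-- The homomorphism that belongs to a matrix, together with the last coordinate. -/
def matLast : (Fin 13 → R) →ₗ[R] Twelve R × (Fin 1 → R) :=
  (matMap c φ).prod (LinearMap.pi fun _ => LinearMap.proj (Fin.last 12))

variable {c}

lemma isUnit_minor (hc : (minor c).det ≠ 0) : IsUnit ((minor c).map φ).det := by
  have := (isUnit_iff_ne_zero.2 hc).map φ
  rwa [RingHom.map_det] at this

/-- In coordinates the map is block triangular, with the invertible minor and `1` as diagonal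
blocks. -/
lemma matLast_bijective (hc : (minor c).det ≠ 0) : Function.Bijective (matLast c φ) := by
  have hu := isUnit_minor φ hc
  constructor
  · refine (injective_iff_map_eq_zero _).2 fun v hv => ?_
    have h₁ : matMap c φ v = 0 := congrArg Prod.fst hv
    have h₂ : v (Fin.last 12) = 0 := congrFun (congrArg Prod.snd hv) 0
    have h₃ := equivFun_matMap c φ v
    rw [h₁, map_zero, h₂] at h₃
    have h₄ : (fun γ => v (colIdx γ).castSucc) = 0 := by
      refine Matrix.mulVec_injective_of_isUnit ((Matrix.isUnit_iff_isUnit_det _).2 hu) ?_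
      rw [Matrix.mulVec_zero]
      have e : (fun β => φ (c (β, Fin.last 12)) * (0 : R)) = 0 := funext fun _ => mul_zero _
      rw [e, add_zero] at h₃
      exact h₃.symm
    funext m
    induction m using Fin.lastCases with
    | last => exact h₂
    | cast m =>
      have := congrFun h₄ (colIdx.symm m)
      rwa [Equiv.apply_symm_apply] at this
  · rintro ⟨z, r⟩
    let w : Fin 2 × Fin 6 → R := ((minor c).map φ)⁻¹.mulVec
      ((twelveB R).equivFun z - fun β => φ (c (β, Fin.last 12)) * r 0)
    let v : Fin 13 → R := Fin.snoc (α := fun _ => R) (n := 12) (fun m => w (colIdx.symm m)) (r 0)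
    have hv : v (Fin.last 12) = r 0 := Fin.snoc_last (α := fun _ => R) _ _
    have hw : (fun γ => v (colIdx γ).castSucc) = w := funext fun γ =>
      (Fin.snoc_castSucc (α := fun _ => R) _ _ _).trans (by rw [Equiv.symm_apply_apply])
    refine ⟨v, Prod.ext ((twelveB R).equivFun.injective ?_) (funext fun k => ?_)⟩
    · refine (equivFun_matMap c φ v).trans ?_
      rw [hw, hv, Matrix.mulVec_mulVec, Matrix.mul_nonsing_inv _ hu, Matrix.one_mulVec,
        sub_add_cancel]
    · rw [Subsingleton.elim k 0]
      exact hv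

/-- The isomorphism `R^13 ≃ (R^2 ⊗ Sym² R^3) × R`. -/
def matEquiv (hc : (minor c).det ≠ 0) : (Fin 13 → R) ≃ₗ[R] Twelve R × (Fin 1 → R) :=
  LinearEquiv.ofBijective (matLast c φ) (matLast_bijective φ hc)

end Matrices

lemma map_matMap (c : (Fin 2 × Fin 6) × Fin 13 → ℂ) {R S : CommRingCat.{0}} (f : R ⟶ S)
    (x : Spec R ⟶ P12) (y : Spec S ⟶ P12)
    (h : Spec.map f ≫ x = y) (v : Fin 13 → R) :
    O_12.map f x y h (matMap c (OModule.scalar P12.toC x) v) =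
      matMap c (OModule.scalar P12.toC y) (fun m => f.hom (v m)) := by
  rw [matMap_apply, matMap_apply]
  refine (map_sum (O_12.map f x y h) _ _).trans (Finset.sum_congr rfl fun β _ => ?_)
  refine ((O_12.map f x y h).map_smulₛₗ _ _).trans ?_
  refine congrArg₂ (· • ·) ?_ (map_twelveBasis f x y h β)
  refine (map_sum f.hom _ _).trans (Finset.sum_congr rfl fun m _ => ?_)
  refine (map_mul f.hom _ _).trans (congrArg (· * f.hom (v m)) ?_)
  exact OModule.scalar_map P12.toC f x y h _

end Fano

namespace Fano

/-! ### The zero locus as a projective bundle -/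

variable {R S : CommRingCat.{0}}

/-- The fibre of `𝒪(-1,-2) ⊕ 𝒪` at a point. -/
abbrev SplitFibre (w : Spec R ⟶ P12) : Type :=
  (twistSections (-1) (w ≫ P12.pr₁) ⊗[R] twistSections (-2) (w ≫ P12.pr₂)) × (Fin 1 → R)

variable {c : (Fin 2 × Fin 6) × Fin 13 → ℂ} (hc : (minor c).det ≠ 0)

/-- The embedding of `𝒪(-1,-2) ⊕ 𝒪` into `𝒪^{⊕13}` that belongs to a matrix. -/
def splitIncl (w : Spec R ⟶ P12) : SplitFibre w →ₗ[R] (Fin 13 → R) :=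
  (matEquiv (OModule.scalar P12.toC w) hc).symm.toLinearMap ∘ₗ
    (segreIncl w).prodMap LinearMap.id

lemma matLast_splitIncl (w : Spec R ⟶ P12) (b : SplitFibre w) :
    matLast c (OModule.scalar P12.toC w) (splitIncl hc w b) = (segreIncl w b.1, b.2) :=
  (matEquiv (OModule.scalar P12.toC w) hc).apply_symm_apply _

lemma exists_splitIncl_retract (w : Spec R ⟶ P12) : ∃ ρ : (Fin 13 → R) →ₗ[R] SplitFibre w,
    ∀ b, ρ (splitIncl hc w b) = b := by
  obtain ⟨ρ, hρ⟩ := exists_segreIncl_retract w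
  refine ⟨ρ.prodMap LinearMap.id ∘ₗ matLast c (OModule.scalar P12.toC w), fun b => ?_⟩
  rw [LinearMap.comp_apply, matLast_splitIncl]
  exact Prod.ext (hρ b.1) rfl

lemma splitIncl_injective (w : Spec R ⟶ P12) : Function.Injective (splitIncl hc w) := by
  obtain ⟨ρ, hρ⟩ := exists_splitIncl_retract hc w
  exact Function.LeftInverse.injective hρ

lemma splitIncl_map (f : R ⟶ S) (x : Spec R ⟶ P12) (y : Spec S ⟶ P12) (h : Spec.map f ≫ x = y)
    (b : SplitFibre x) :
    splitIncl hc y (splitBundle.map f x y h b) = fun k => f.hom (splitIncl hc x b k) := by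
  refine (matLast_bijective (OModule.scalar P12.toC y) hc).1 ?_
  refine (matLast_splitIncl hc y _).trans (Prod.ext ?_ ?_)
  · refine Eq.trans ?_ (map_matMap c f x y h _)
    refine (segreVeronese.naturality f x y h b.1).symm.trans ?_
    exact congrArg (O_12.map f x y h) (congrArg Prod.fst (matLast_splitIncl hc x b)).symm
  · exact funext fun k =>
      congrArg f.hom (congrFun (congrArg Prod.snd (matLast_splitIncl hc x b)) k).symm

/-- The preimage of `𝒪(-1,-2)` under the matrix puts no condition on the last coordinate; this free
coordinate is the summand `𝒪`. -/
lemma mem_range_splitIncl {w : Spec R ⟶ P12} {v : Fin 13 → R}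
    (h : matMap c (OModule.scalar P12.toC w) v ∈ LinearMap.range (segreIncl w)) :
    v ∈ LinearMap.range (splitIncl hc w) := by
  obtain ⟨a, ha⟩ := h
  refine ⟨(a, fun _ => v (Fin.last 12)), (matLast_bijective (OModule.scalar P12.toC w) hc).1 ?_⟩
  exact (matLast_splitIncl hc w _).trans (Prod.ext ha rfl)

namespace Completion

variable (D : Completion)

lemma matrixEquiv_apply (c : (Fin 2 × Fin 6) × Fin 13 → ℂ) :
    D.matrixEquiv c = ∑ γ, c γ • D.genSec γ := by
  rw [matrixEquiv, LinearEquiv.ofBijective_apply, Fintype.linearCombination_apply]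

/-- Contraction with sections of `𝒪(0,0,-1)` turns the section into the matrix applied to the line
in `R^13`, read modulo `𝒪(-1,-2)`. -/
lemma matrixEquiv_eq_zero_iff (c : (Fin 2 × Fin 6) × Fin 13 → ℂ) {z : Spec R ⟶ Ambient}
    {w : Spec R ⟶ P12} (hw : z ≫ Ambient.pr₁₂ = w) : (D.matrixEquiv c).1 R z = 0 ↔
      ∀ t : twistSections (-1) (z ≫ Ambient.pr₃), matMap c (OModule.scalar P12.toC w)
        (tautMap (z ≫ Ambient.pr₃) t) ∈ LinearMap.range (segreIncl w) := by
  subst hw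
  have key (t : twistSections (-1) (z ≫ Ambient.pr₃)) : D.contr z t ((D.matrixEquiv c).1 R z) =
      D.proj (z ≫ Ambient.pr₁₂) (matMap c (OModule.scalar P12.toC (z ≫ Ambient.pr₁₂))
        (tautMap (z ≫ Ambient.pr₃) t)) := by
    rw [matrixEquiv_apply, matMap_apply, scalar_comp (qX := Ambient.toC) rfl]
    exact D.contr_sum c z t
  refine ⟨fun h t => ?_, fun h => D.eq_zero_of_contr fun t => ?_⟩
  · rw [← D.proj_eq_zero_iff, ← key, h, map_zero]
  · rw [key, D.proj_eq_zero_iff]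
    exact h t

/-- The isomorphism of `𝒪(0,0,-1)` with the tautological line subbundle, on sections. -/
def modelMap {z : Spec R ⟶ Ambient} {w : Spec R ⟶ P12} (hw : z ≫ Ambient.pr₁₂ = w)
    (hz : (D.matrixEquiv c).1 R z = 0) :
    twistSections (-1) (z ≫ Ambient.pr₃) →ₗ[R] SplitFibre w :=
  (LinearEquiv.ofInjective (splitIncl hc w) (splitIncl_injective hc w)).symm.toLinearMap ∘ₗ
    (tautMap (z ≫ Ambient.pr₃)).codRestrict (LinearMap.range (splitIncl hc w)) fun t =>
      mem_range_splitIncl hc ((D.matrixEquiv_eq_zero_iff c hw).1 hz t)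

lemma splitIncl_modelMap {z : Spec R ⟶ Ambient} {w : Spec R ⟶ P12} (hw : z ≫ Ambient.pr₁₂ = w)
    (hz : (D.matrixEquiv c).1 R z = 0) (t : twistSections (-1) (z ≫ Ambient.pr₃)) :
    splitIncl hc w (D.modelMap hc hw hz t) = tautMap (z ≫ Ambient.pr₃) t :=
  congrArg Subtype.val ((LinearEquiv.ofInjective (splitIncl hc w)
    (splitIncl_injective hc w)).apply_symm_apply _)

lemma map_range_modelMap {z : Spec R ⟶ Ambient} {w : Spec R ⟶ P12} (hw : z ≫ Ambient.pr₁₂ = w)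
    (hz : (D.matrixEquiv c).1 R z = 0) :
    (LinearMap.range (D.modelMap hc hw hz)).map (splitIncl hc w) = tautLine (z ≫ Ambient.pr₃) := by
  rw [← LinearMap.range_comp]
  exact congrArg LinearMap.range (LinearMap.ext fun t => D.splitIncl_modelMap hc hw hz t)

lemma modelMap_injective {z : Spec R ⟶ Ambient} {w : Spec R ⟶ P12} (hw : z ≫ Ambient.pr₁₂ = w)
    (hz : (D.matrixEquiv c).1 R z = 0) : Function.Injective (D.modelMap hc hw hz) := by
  intro t t' h
  refine taut_injective 12 (z ≫ Ambient.pr₃) ?_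
  exact (D.splitIncl_modelMap hc hw hz t).symm.trans
    ((congrArg (splitIncl hc w) h).trans (D.splitIncl_modelMap hc hw hz t'))

lemma isLineSubbundle_modelMap {z : Spec R ⟶ Ambient} {w : Spec R ⟶ P12}
    (hw : z ≫ Ambient.pr₁₂ = w) (hz : (D.matrixEquiv c).1 R z = 0) :
    OModule.IsLineSubbundle (R := R) (M := SplitFibre w)
      (LinearMap.range (D.modelMap hc hw hz)) := by
  obtain ⟨s, hs⟩ := exists_frame (z ≫ Ambient.pr₃)
  refine isLineSubbundle_range (ρ := Fintype.linearCombination R s ∘ₗ splitIncl hc w) (fun t => ?_)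
    fun p => rankAtStalk_of_invertible p
  rw [LinearMap.comp_apply, splitIncl_modelMap]
  exact linearCombination_tautMap hs t

variable {D} {Z : Scheme.{0}} {i : Z ⟶ Ambient} (hi : OModule.IsZeroLocus (D.matrixEquiv c) i)

/-- The isomorphism of `𝒪(0,0,-1)` with the tautological line subbundle. -/
def modelHom : ((O 12 (-1)).pullback Ambient.pr₃).pullback i ⟶
    splitBundle.pullback (i ≫ Ambient.pr₁₂) where
  app y := D.modelMap hc (Category.assoc y i Ambient.pr₁₂) ((hi.2 _).1 ⟨y, rfl⟩)
  naturality f x y h t := by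
    have h₁ : Spec.map f ≫ x ≫ i ≫ Ambient.pr₁₂ = y ≫ i ≫ Ambient.pr₁₂ := by
      rw [← h, Category.assoc]
    have h₂ : Spec.map f ≫ (x ≫ i) ≫ Ambient.pr₃ = (y ≫ i) ≫ Ambient.pr₃ := by
      rw [← h, Category.assoc, Category.assoc, Category.assoc]
    refine splitIncl_injective hc _ ?_
    refine (splitIncl_map hc f (x ≫ i ≫ Ambient.pr₁₂) (y ≫ i ≫ Ambient.pr₁₂) h₁ _).trans ?_
    refine Eq.trans ?_ (D.splitIncl_modelMap hc _ _ _).symm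
    refine Eq.trans (funext fun k => congrArg f.hom (congrFun (D.splitIncl_modelMap hc _ _ t) k)) ?_
    exact (taut 12).naturality f ((x ≫ i) ≫ Ambient.pr₃) ((y ≫ i) ≫ Ambient.pr₃) h₂ t

/-- Inside `R^13` the tautological subbundle becomes the line of the component in `ℙ¹²`. The lifting
condition is thereby an equality of lines, which the functor of points of `ℙ¹²` handles. -/
lemma range_modelHom_iff {y : Spec R ⟶ Z} {w : Spec R ⟶ P12} (h : y ≫ i ≫ Ambient.pr₁₂ = w)
    (h' : Spec.map (𝟙 R) ≫ y ≫ i ≫ Ambient.pr₁₂ = w) (N : Submodule R (SplitFibre w)) :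
    ((N : Set (SplitFibre w)) = Set.range fun t =>
      splitBundle.map (𝟙 R) (y ≫ i ≫ Ambient.pr₁₂) w h' ((modelHom hc hi).app y t)) ↔
      tautLine ((y ≫ i) ≫ Ambient.pr₃) = N.map (splitIncl hc w) := by
  subst h
  have e : (Set.range fun t => splitBundle.map (𝟙 R) (y ≫ i ≫ Ambient.pr₁₂) _ h'
      ((modelHom hc hi).app y t)) = (LinearMap.range (D.modelMap hc
        (Category.assoc y i Ambient.pr₁₂) ((hi.2 _).1 ⟨y, rfl⟩)) : Set (SplitFibre _)) :=
    congrArg Set.range (funext fun t => splitBundle.map_id _ _ _)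
  rw [e, SetLike.coe_set_eq, ← D.map_range_modelMap hc (Category.assoc y i Ambient.pr₁₂)
    ((hi.2 _).1 ⟨y, rfl⟩),
    (Submodule.map_injective_of_injective (splitIncl_injective hc _)).eq_iff, eq_comm]

/-- The image of `N` in `R^13` is a line subbundle and so defines a point of `ℙ¹²`. The matrix maps
this line into `𝒪(-1,-2)`, hence the resulting point of the product lies on the zero locus. For
uniqueness, `i` is a monomorphism and both components are determined, the second by its line. -/
lemma existsUnique_lift (x : Spec R ⟶ P12) (N : Submodule R (SplitFibre x))
    (hN : OModule.IsLineSubbundle (R := R) (M := SplitFibre x) N) : ∃! y : Spec R ⟶ Z, ∃ h : y ≫ i ≫ Ambient.pr₁₂ = x,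
      (N : Set (SplitFibre x)) = Set.range fun t => splitBundle.map (𝟙 R)
        (y ≫ i ≫ Ambient.pr₁₂) x (by simp [h]) ((modelHom hc hi).app y t) := by
  obtain ⟨ρ, hρ⟩ := exists_splitIncl_retract hc x
  obtain ⟨a, ha, haN⟩ := exists_point (OModule.scalar P12.toC x)
    (OModule.IsLineSubbundle.map (g := splitIncl hc x) hN hρ)
  let z : Spec R ⟶ Ambient := isPullback_ambient.lift x a (by rw [ha, map_scalar])
  have hz₁ : z ≫ Ambient.pr₁₂ = x := isPullback_ambient.lift_fst _ _ _
  have hz₂ : z ≫ Ambient.pr₃ = a := isPullback_ambient.lift_snd _ _ _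
  have hz : (D.matrixEquiv c).1 R z = 0 := (D.matrixEquiv_eq_zero_iff c hz₁).2 fun t => by
    have ht : tautMap (z ≫ Ambient.pr₃) t ∈ N.map (splitIncl hc x) := by
      rw [← haN, ← hz₂]
      exact ⟨t, rfl⟩
    obtain ⟨b, -, hb⟩ := ht
    rw [← hb]
    exact ⟨b.1, (congrArg Prod.fst (matLast_splitIncl hc x b)).symm⟩
  obtain ⟨y, hy⟩ := (hi.2 z).2 hz
  have hyx : y ≫ i ≫ Ambient.pr₁₂ = x := by rw [← Category.assoc, hy, hz₁]
  have := hi.1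
  refine ⟨y, ⟨hyx, (range_modelHom_iff hc hi hyx _ N).2 ?_⟩, ?_⟩
  · rw [hy, hz₂, haN]
  · rintro y' ⟨hyx', hN'⟩
    have h' := (range_modelHom_iff hc hi hyx' _ N).1 hN'
    refine (cancel_mono i).1 (isPullback_ambient.hom_ext ?_ ?_)
    · rw [Category.assoc, Category.assoc, hyx, hyx']
    · refine eq_of_tautLine ?_ ?_
      · have e (u : Spec R ⟶ Z) (hu : u ≫ i ≫ Ambient.pr₁₂ = x) :
            ((u ≫ i) ≫ Ambient.pr₃) ≫ P.toC 12 = x ≫ P12.toC := by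
          rw [Category.assoc, ← isPullback_ambient.w, ← hu]
          simp only [Category.assoc]
        rw [e y hyx, e y' hyx']
      · rw [h', hy, hz₂, haN]

include hc hi in
/-- The zero locus of the section of a matrix with an invertible minor is a projective bundle. -/
theorem isModel : IsModel i :=
  ⟨modelHom hc hi, fun y =>
      D.modelMap_injective hc (Category.assoc y i _) ((hi.2 _).1 ⟨y, rfl⟩),
    fun y => D.isLineSubbundle_modelMap hc (Category.assoc y i _) ((hi.2 _).1 ⟨y, rfl⟩),
    fun x N hN => existsUnique_lift hc hi x N hN⟩

variable (D)

lemma isLocFree_twist001 : (twist001 D.K).IsLocFree :=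
  (D.isVectorBundle_K.isLocFree.pullback _).tensor ((isLocFree_O 12 1).pullback _)

/-- The numbering of the entries of a matrix. -/
def entryIdx : (Fin 2 × Fin 6) × Fin 13 ≃ Fin 156 :=
  (colIdx.prodCongr (Equiv.refl _)).trans (finProdFinEquiv (m := 12) (n := 13))

/-- The entries of the matrix as coordinates of a section of `K(0,0,1)`. -/
def sectionBasis : Module.Basis (Fin 156) ℂ ((twist001 D.K).H0 Ambient.toC) :=
  (Module.Basis.ofEquivFun D.matrixEquiv.symm).reindex entryIdx

lemma sectionBasis_repr (s : (twist001 D.K).H0 Ambient.toC) (γ : (Fin 2 × Fin 6) × Fin 13) :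
    D.sectionBasis.repr s (entryIdx γ) = D.matrixEquiv.symm s γ := by
  rw [sectionBasis, Module.Basis.repr_reindex_apply, Equiv.symm_apply_apply]
  exact Module.Basis.ofEquivFun_repr_apply D.matrixEquiv.symm s γ

/-- The minor of the first twelve columns, as a polynomial. -/
def minorPoly : MvPolynomial (Fin 156) ℂ :=
  (Matrix.of fun β γ : Fin 2 × Fin 6 =>
    (MvPolynomial.X (entryIdx (β, (colIdx γ).castSucc)) : MvPolynomial (Fin 156) ℂ)).det

lemma eval_minorPoly (v : Fin 156 → ℂ) :
    MvPolynomial.eval v minorPoly = (minor fun γ => v (entryIdx γ)).det := by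
  rw [minorPoly, RingHom.map_det]
  congr 1
  ext β γ
  exact MvPolynomial.eval_X _

lemma minorPoly_ne_zero : minorPoly ≠ 0 := fun h => by
  -- Evaluation at the matrix whose first twelve columns form the identity and whose last column is
  -- zero.
  have := eval_minorPoly fun k => if (entryIdx.symm k).2 = (colIdx (entryIdx.symm k).1).castSucc
    then 1 else 0
  rw [h, map_zero] at this
  refine one_ne_zero (α := ℂ) ((this.trans ?_).symm)
  refine Eq.trans (congrArg Matrix.det ?_) Matrix.det_one
  ext β γ
  simp [minor, Matrix.one_apply, eq_comm]

/-- The zero locus of the general section of `K(0,0,1)` is a projective bundle. -/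
theorem general_isModel : General fun s : (twist001 D.K).H0 Ambient.toC =>
    ∃ (Z : Scheme.{0}) (i : Z ⟶ Ambient), OModule.IsZeroLocus s i ∧ IsModel i := by
  refine ⟨156, D.sectionBasis, minorPoly, minorPoly_ne_zero, fun s hs => ?_⟩
  rw [eval_minorPoly] at hs
  have e : (fun γ => D.sectionBasis.repr s (entryIdx γ)) = D.matrixEquiv.symm s :=
    funext fun γ => D.sectionBasis_repr s γ
  rw [e] at hs
  -- The zero scheme exists for every section; the nonvanishing minor only serves to identify it
  -- with the projective bundle.
  have h := OModule.isZeroLocus_zeroIdeal D.isLocFree_twist001 s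
  refine ⟨_, _, h, isModel (c := D.matrixEquiv.symm s) hs (D := D) ?_⟩
  rw [LinearEquiv.apply_symm_apply]
  exact h

end Completion

end Fano

end

theorem lemma4p2 :
    -- the Euler sequences and the dual sequence of principal parts are exact
    Fano.OModule.IsShortExact Fano.eulerIncl Fano.eulerProj ∧
    Fano.OModule.IsShortExact Fano.partsIncl Fano.partsProj ∧
    Fano.OModule.IsShortExact (Fano.taut 1) Fano.toO1 ∧
    -- the diagrams have a completion, unique up to a unique isomorphism
    Nonempty Fano.Completion ∧
    (∀ D D' : Fano.Completion, Nonempty (Unique (Fano.Completion.Iso D D'))) ∧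
    ∀ D : Fano.Completion,
      -- `Λ` and `K` are vector bundles, `K` is homogeneous
      Fano.OModule.IsVectorBundle 5 D.Λ ∧
      Fano.OModule.IsVectorBundle 11 D.K ∧
      Fano.IsHomogeneous D.K ∧
      -- the two exact sequences that describe `K` as an iterated extension
      Fano.OModule.IsShortExact
        (Fano.extMap (CategoryTheory.CategoryStruct.id (Fano.O 1 (-1))) D.i)
        (Fano.extMap (CategoryTheory.CategoryStruct.id (Fano.O 1 (-1))) D.j) ∧
      Fano.OModule.IsShortExact D.i' D.j' ∧
      -- the zero locus of the general section of `K(0,0,1)` is the projective bundle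
      Fano.General fun s : (Fano.twist001 D.K).H0 Fano.Ambient.toC =>
        ∃ (Z : AlgebraicGeometry.Scheme.{0}) (i : Z ⟶ Fano.Ambient),
          Fano.OModule.IsZeroLocus s i ∧ Fano.IsModel i := by
  refine ⟨Fano.isShortExact_euler_plane, Fano.isShortExact_parts, Fano.isShortExact_euler_line,
    ⟨Fano.stdCompletion⟩, fun D D' => ⟨⟨⟨D.iso D'⟩, fun e => D.iso_unique D' e⟩⟩,
    fun D => ⟨D.isVectorBundle_Λ, D.isVectorBundle_K, D.isHomogeneous_K,
      Fano.isShortExact_extMap_left (Fano.isLocFree_O 1 (-1)) D.exact_col, D.exact_col',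
      D.general_isModel⟩⟩
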